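/- Let $k\ge 1$ and let $t^{1/2},a_1^{1/2},(-a_2)^{1/2},b_1^{1/2},(-b_2)^{1/2},a,a_0,a_k\in\mathbb C^\times$; put $t_k^{1/2}=a_1^{1/2}(-a_2)^{-1/2}$, $t_0^{1/2}=b_1^{1/2}(-b_2)^{-1/2}$, and write $[\![x]\!]=x^{1/2}+x^{-1/2}$ (square roots of products being the corresponding products of the chosen roots) and $[k]=\frac{t^{k/2}-t^{-k/2}}{t^{1/2}-t^{-1/2}}=\sum_{i=0}^{k-1}t^{(k-1-2i)/2}$. Assume $[k]\neq0$. **Hecke algebra.** The extended two boundary braid group $\mathcal B_k^{\mathrm{ext}}$ is generated by $\bar T_0,\dots,\bar T_k,P$ with the relations $\bar T_i\bar T_j=\bar T_j\bar T_i$ for $|i-j|\ge2$; $\bar T_i\bar T_{i+1}\bar T_i=\bar T_{i+1}\bar T_i\bar T_{i+1}$ for $1\le i\le k-2$; if $k\ge 2$, $\bar T_0\bar T_1\bar T_0\bar T_1=\bar T_1\bar T_0\bar T_1\bar T_0$ and $\bar T_{k-1}\bar T_k\bar T_{k-1}\bar T_k=\bar T_k\bar T_{k-1}\bar T_k\bar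 T_{k-1}$; and, with $Y_1=\bar T_0$, $X_1=\bar T_1^{-1}\cdots\bar T_{k-1}^{-1}\bar T_k\bar T_{k-1}\cdots\bar T_1$ and $Z_1=X_1Y_1$, the relations $PX_1P^{-1}=Z_1^{-1}X_1Z_1$, $PY_1P^{-1}=Z_1^{-1}Y_1Z_1$, $PZ_1P^{-1}=Z_1$ and $P\bar T_iP^{-1}=\bar T_i$ for $1\le i\le k-1$. The algebra $H_k^{\mathrm{ext}}$ is the quotient of $\mathbb C\mathcal B_k^{\mathrm{ext}}$ by $(X_1-a_1)(X_1-a_2)=0$, $(Y_1-b_1)(Y_1-b_2)=0$ and $(\bar T_i-t^{1/2})(\bar T_i+t^{-1/2})=0$ for $1\le i\le k-1$. In it let $T_i=\bar T_i$ for $1\le i\le k-1$, $T_0=b_1^{-1/2}(-b_2)^{-1/2}\bar T_0$, $T_k=a_1^{-1/2}(-a_2)^{-1/2}\bar T_k$, and define $e_0,\dots,e_k$ by $a_0e_0=T_0-t_0^{1/2}$, $ae_i=T_i-t^{1/2}$ ($1\le i\le k-1$), $a_ke_k=T_k-t_k^{1/2}$. Let $W_1=T_1^{-1}\cdots T_{k-1}^{-1}T_kT_{k-1}\cdots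 T_1T_0$, $W_{j+1}=T_jW_jT_j$ for $1\le j\le k-1$, and $Z=\sum_{j=1}^k(W_j+W_j^{-1})$. **Temperley-Lieb algebra.** The extended two boundary Temperley-Lieb algebra $TL_k^{\mathrm{ext}}$ is either of the following quotients of $H_k^{\mathrm{ext}}$; the result holds for each of them. (a) The quotient by $a_0a^2e_1e_0e_1=a[\![t_0t^{-1}]\!]e_1$ and $a_ka^2e_{k-1}e_ke_{k-1}=a[\![t_kt^{-1}]\!]e_{k-1}$ (if $k\ge2$), and $a^3e_ie_{i+1}e_i=ae_i$, $a^3e_{i+1}e_ie_{i+1}=ae_{i+1}$ for $1\le i\le k-2$. (b) Provided that the idempotents below exist, that is, that $[\![t]\!]$, $[\![t_0]\!]$, $[\![t_0t]\!]$, $[\![t_0t^{-1}]\!]$, $[\![t_k]\!]$, $[\![t_kt]\!]$, $[\![t_kt^{-1}]\!]$ are nonzero (if $k\ge2$) and $t+1+t^{-1}\ne0$ (if $k\ge3$): the quotient by $p_0^{(\emptyset,1^2)}=p_0^{(1^2,\emptyset)}$ and $p_{0^\vee}^{(\emptyset,1^2)}=p_{0^\vee}^{(1^2,\emptyset)}$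 (if $k\ge2$), and $p_i^{(1^3)}=0$ for $1\le i\le k-2$. Here $p_0^{(\emptyset,1^2)}$ and $p_0^{(1^2,\emptyset)}$ are the nonzero idempotents $p$ of the subalgebra generated by $T_0,T_1$ with $T_1p=-t^{-1/2}p$ and, respectively, $T_0p=-t_0^{-1/2}p$ and $T_0p=t_0^{1/2}p$; $p_{0^\vee}^{(\emptyset,1^2)}$ and $p_{0^\vee}^{(1^2,\emptyset)}$ are defined in the same way from $T_{0^\vee}=W_1T_0^{-1}$ and $t_k^{1/2}$ in place of $T_0$ and $t_0^{1/2}$; and $p_i^{(1^3)}$ is the nonzero idempotent $p$ of the subalgebra generated by $T_i,T_{i+1}$ with $T_ip=T_{i+1}p=-t^{-1/2}p$. Let $TL_k$ be the subalgebra of $TL_k^{\mathrm{ext}}$ generated by $a_0e_0,ae_1,\dots,ae_{k-1},a_ke_k$, and let $$I_1=\begin{cases}(ae_1)(ae_3)\cdots(ae_{k-1}),&k\text{ even},\\(ae_1)(ae_3)\cdots(ae_{k-2})\,e_k,&k\text{ odd},\end{cases}\qquad I_2=\begin{cases}e_0(ae_2)\cdots(ae_{k-2})\,e_k,&k\text{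 even},\\e_0(ae_2)\cdots(ae_{k-1}),&k\text{ odd}\end{cases}$$ (for $k=1$: $I_1=e_1$ and $I_2=e_0$). **Corollary.** In $TL_k^{\mathrm{ext}}$ the elements $Z,I_1,I_2$ belong to $TL_k$ and $Z$ is central. If $k$ is even, then $$a_0a_kI_1I_2I_1=\Big(\tfrac1{[k]}Z-[\![t_0t_kt^{-1}]\!]\Big)I_1,\qquad a_0a_kI_2I_1I_2=\Big(\tfrac1{[k]}Z-[\![t_0t_kt^{-1}]\!]\Big)I_2.$$ If $k$ is odd, then $$a_0a_kI_1I_2I_1=\Big(\tfrac1{[k]}Z+[\![t_0t_k^{-1}]\!]\Big)I_1,\qquad a_0a_kI_2I_1I_2=\Big(\tfrac1{[k]}Z+[\![t_0t_k^{-1}]\!]\Big)I_2.$$ Consequently there is an element $c\in TL_k$, central in $TL_k^{\mathrm{ext}}$, with $I_1I_2I_1=cI_1$ and $I_2I_1I_2=cI_2$. -/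

import Mathlib

noncomputable section

namespace TwoBoundary

/-! ### The extended two boundary braid group -/

/-- Generators of the extended two boundary braid group: `some i` stands for the braid generator
with index `i ∈ {0, …, k}`, and `none` for the twist `P` of the two poles. -/
abbrev Gen (k : ℕ) : Type := Option (Fin (k + 1))

/-- The letter of index `i`; it is only ever used for `i ≤ k`. -/
def wT (k i : ℕ) : FreeGroup (Gen k) := FreeGroup.of (some (Fin.ofNat (k + 1) i))

/-- The letter `P`. -/
def wP (k : ℕ) : FreeGroup (Gen k) := FreeGroup.of none

/-- The word `T_{k-1} T_{k-2} ⋯ T_1` (empty for `k = 1`). -/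
def wC (k : ℕ) : FreeGroup (Gen k) :=
  ((List.range (k - 1)).map fun j => wT k (k - 1 - j)).prod

/-- `X_1 = T_1⁻¹ ⋯ T_{k-1}⁻¹ T_k T_{k-1} ⋯ T_1` (with the braid generator of index `k`). -/
def wX (k : ℕ) : FreeGroup (Gen k) := (wC k)⁻¹ * wT k k * wC k

/-- `Y_1`, the braid generator of index `0`. -/
def wY (k : ℕ) : FreeGroup (Gen k) := wT k 0

/-- `Z_1 = X_1 Y_1`. -/
def wZ (k : ℕ) : FreeGroup (Gen k) := wX k * wY k

/-- Defining relations of the extended two boundary braid group. -/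
inductive BraidRel (k : ℕ) : FreeGroup (Gen k) → FreeGroup (Gen k) → Prop
  | comm (i j : ℕ) (hij : i + 2 ≤ j) (hj : j ≤ k) :
      BraidRel k (wT k i * wT k j) (wT k j * wT k i)
  | braid (i : ℕ) (hi : 1 ≤ i) (hik : i + 2 ≤ k) :
      BraidRel k (wT k i * wT k (i + 1) * wT k i) (wT k (i + 1) * wT k i * wT k (i + 1))
  | left (hk : 2 ≤ k) :
      BraidRel k (wT k 0 * wT k 1 * wT k 0 * wT k 1) (wT k 1 * wT k 0 * wT k 1 * wT k 0)
  | right (hk : 2 ≤ k) :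
      BraidRel k (wT k (k - 1) * wT k k * wT k (k - 1) * wT k k)
        (wT k k * wT k (k - 1) * wT k k * wT k (k - 1))
  | twistX : BraidRel k (wP k * wX k * (wP k)⁻¹) ((wZ k)⁻¹ * wX k * wZ k)
  | twistY : BraidRel k (wP k * wY k * (wP k)⁻¹) ((wZ k)⁻¹ * wY k * wZ k)
  | twistZ : BraidRel k (wP k * wZ k * (wP k)⁻¹) (wZ k)
  | twistT (i : ℕ) (hi : 1 ≤ i) (hik : i + 1 ≤ k) :
      BraidRel k (wP k * wT k i * (wP k)⁻¹) (wT k i)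

/-- The extended two boundary braid group on `k` strands. -/
abbrev BraidGroup (k : ℕ) : Type :=
  PresentedGroup {w : FreeGroup (Gen k) | ∃ u v, BraidRel k u v ∧ w = u * v⁻¹}

/-- The element of the braid group represented by a word. -/
def br (k : ℕ) (w : FreeGroup (Gen k)) : BraidGroup k := PresentedGroup.mk _ w

/-! ### Parameters -/

/-- The parameters: nonzero complex numbers, given through the chosen square roots
`t^{1/2}`, `a_1^{1/2}`, `(-a_2)^{1/2}`, `b_1^{1/2}`, `(-b_2)^{1/2}`, together with the
normalizations `a`, `a_0`, `a_k`. -/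
structure Params where
  /-- `t^{1/2}` -/
  rt : ℂˣ
  /-- `a_1^{1/2}` -/
  ra₁ : ℂˣ
  /-- `(-a_2)^{1/2}` -/
  ra₂ : ℂˣ
  /-- `b_1^{1/2}` -/
  rb₁ : ℂˣ
  /-- `(-b_2)^{1/2}` -/
  rb₂ : ℂˣ
  /-- normalization of `e_i`, `1 ≤ i ≤ k - 1` -/
  a : ℂˣ
  /-- normalization of `e_0` -/
  a₀ : ℂˣ
  /-- normalization of `e_k` -/
  aₖ : ℂˣ

/-- `t_0^{1/2} = b_1^{1/2} (-b_2)^{-1/2}`. -/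
def Params.rt₀ (p : Params) : ℂˣ := p.rb₁ * p.rb₂⁻¹

/-- `t_k^{1/2} = a_1^{1/2} (-a_2)^{-1/2}`. -/
def Params.rtₖ (p : Params) : ℂˣ := p.ra₁ * p.ra₂⁻¹

/-- `dbl (x^{1/2})` is `⟦x⟧ = x^{1/2} + x^{-1/2}`. -/
def dbl (r : ℂˣ) : ℂ := (r : ℂ) + ((r⁻¹ : ℂˣ) : ℂ)

/-- The quantum integer `[k] = (t^{k/2} - t^{-k/2}) / (t^{1/2} - t^{-1/2})`, written as the
Laurent polynomial `t^{(k-1)/2} + t^{(k-3)/2} + ⋯ + t^{-(k-1)/2}` (so that it also makes sense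
at `t = 1`). -/
def qInt (p : Params) (k : ℕ) : ℂ :=
  ∑ i ∈ Finset.range k, (p.rt : ℂ) ^ ((k : ℤ) - 1 - 2 * (i : ℤ))

/-! ### The extended two boundary Hecke algebra -/

/-- A word of the braid group as an element of the group algebra. -/
def ga (k : ℕ) (w : FreeGroup (Gen k)) : MonoidAlgebra ℂ (BraidGroup k) :=
  MonoidAlgebra.of ℂ (BraidGroup k) (br k w)

/-- Quadratic relation `(x - c)(x - d) = 0` on generators `X_1`, `Y_1`, `T_1, …, T_{k-1}`. -/
inductive HeckeRel (p : Params) (k : ℕ) :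
    MonoidAlgebra ℂ (BraidGroup k) → MonoidAlgebra ℂ (BraidGroup k) → Prop
  | X : HeckeRel p k
      ((ga k (wX k) - algebraMap ℂ _ ((p.ra₁ : ℂ) ^ 2)) *
        (ga k (wX k) - algebraMap ℂ _ (-(p.ra₂ : ℂ) ^ 2))) 0
  | Y : HeckeRel p k
      ((ga k (wY k) - algebraMap ℂ _ ((p.rb₁ : ℂ) ^ 2)) *
        (ga k (wY k) - algebraMap ℂ _ (-(p.rb₂ : ℂ) ^ 2))) 0
  | T (i : ℕ) (hi : 1 ≤ i) (hik : i + 1 ≤ k) : HeckeRel p k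
      ((ga k (wT k i) - algebraMap ℂ _ (p.rt : ℂ)) *
        (ga k (wT k i) + algebraMap ℂ _ ((p.rt⁻¹ : ℂˣ) : ℂ))) 0

/-- The extended two boundary Hecke algebra. -/
abbrev Hext (p : Params) (k : ℕ) : Type := RingQuot (HeckeRel p k)

/-- The canonical homomorphism from the braid group to the units of the Hecke algebra. -/
def toH (p : Params) (k : ℕ) : BraidGroup k →* (Hext p k)ˣ :=
  MonoidHom.toHomUnits
    (((RingQuot.mkAlgHom ℂ (HeckeRel p k) :
        MonoidAlgebra ℂ (BraidGroup k) →ₐ[ℂ] Hext p k) :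
        MonoidAlgebra ℂ (BraidGroup k) →* Hext p k).comp (MonoidAlgebra.of ℂ (BraidGroup k)))

/-- `T_0 = b_1^{-1/2} (-b_2)^{-1/2} Y_1`,
`T_k = a_1^{-1/2} (-a_2)^{-1/2} T_{k-1} ⋯ T_1 X_1 T_1⁻¹ ⋯ T_{k-1}⁻¹`, and the images `T_i` of the
braid generators for `1 ≤ i ≤ k - 1`. -/
def T (p : Params) (k i : ℕ) : (Hext p k)ˣ :=
  if i = 0 then (p.rb₁ * p.rb₂)⁻¹ • toH p k (br k (wY k))
  else if i = k then (p.ra₁ * p.ra₂)⁻¹ • toH p k (br k (wC k * wX k * (wC k)⁻¹))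
  else toH p k (br k (wT k i))

/-- `a_0 e_0 = T_0 - t_0^{1/2}`, `a_k e_k = T_k - t_k^{1/2}`, `a e_i = T_i - t^{1/2}`. -/
def ae (p : Params) (k i : ℕ) : Hext p k :=
  (T p k i : Hext p k) -
    algebraMap ℂ _ (if i = 0 then (p.rt₀ : ℂ) else if i = k then (p.rtₖ : ℂ) else (p.rt : ℂ))

/-- The elements `e_0, e_1, …, e_k`. -/
def e (p : Params) (k i : ℕ) : Hext p k :=
  (if i = 0 then p.a₀⁻¹ else if i = k then p.aₖ⁻¹ else p.a⁻¹) • ae p k i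

/-- The product `T_{k-1} ⋯ T_2 T_1` in the Hecke algebra. -/
def TC (p : Params) (k : ℕ) : (Hext p k)ˣ :=
  ((List.range (k - 1)).map fun j => T p k (k - 1 - j)).prod

/-- The Murphy elements, `murphy p k j = W_{j+1}`:
`W_1 = T_1⁻¹ ⋯ T_{k-1}⁻¹ T_k T_{k-1} ⋯ T_1 T_0` and `W_{j+1} = T_j W_j T_j`. -/
def murphy (p : Params) (k : ℕ) : ℕ → (Hext p k)ˣ
  | 0 => (TC p k)⁻¹ * T p k k * TC p k * T p k 0
  | j + 1 => T p k (j + 1) * murphy p k j * T p k (j + 1)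

/-- `Z = W_1 + W_1⁻¹ + ⋯ + W_k + W_k⁻¹`. -/
def Z (p : Params) (k : ℕ) : Hext p k :=
  ∑ j ∈ Finset.range k,
    ((murphy p k j : Hext p k) + (((murphy p k j)⁻¹ : (Hext p k)ˣ) : Hext p k))

/-- `I_1 = (ae_1)(ae_3)⋯(ae_{k-1})` for `k` even, `(ae_1)(ae_3)⋯(ae_{k-2}) e_k` for `k` odd. -/
def I₁ (p : Params) (k : ℕ) : Hext p k :=
  if Even k then ((List.range (k / 2)).map fun j => ae p k (2 * j + 1)).prod
  else ((List.range ((k - 1) / 2)).map fun j => ae p k (2 * j + 1)).prod * e p k k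

/-- `I_2 = e_0 (ae_2)⋯(ae_{k-2}) e_k` for `k` even, `e_0 (ae_2)⋯(ae_{k-1})` for `k` odd. -/
def I₂ (p : Params) (k : ℕ) : Hext p k :=
  if Even k then
    e p k 0 * ((List.range ((k - 2) / 2)).map fun j => ae p k (2 * j + 2)).prod * e p k k
  else e p k 0 * ((List.range ((k - 1) / 2)).map fun j => ae p k (2 * j + 2)).prod

/-! ### The extended two boundary Temperley-Lieb algebra, in its two descriptions -/

/-- `q` is a nonzero idempotent of the subalgebra generated by `x` and `y` on which `x` and `y`
act from the left by the scalars `c` and `d`. -/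
structure IsEigenIdem {A : Type} [Ring A] [Algebra ℂ A] (x y : A) (c d : ℂ) (q : A) : Prop where
  mem : q ∈ Algebra.adjoin ℂ ({x, y} : Set A)
  ne_zero : q ≠ 0
  idem : q * q = q
  eigen_x : x * q = c • q
  eigen_y : y * q = d • q

/-- `T_{0^∨} = W_1 T_0⁻¹`. -/
def Tvee (p : Params) (k : ℕ) : (Hext p k)ˣ := murphy p k 0 * (T p k 0)⁻¹

/-- The relations `p_0^{(∅,1²)} = p_0^{(1²,∅)}`, `p_{0^∨}^{(∅,1²)} = p_{0^∨}^{(1²,∅)}` and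
`p_i^{(1³)} = 0` for `1 ≤ i ≤ k - 2`. -/
inductive IdemRel (p : Params) (k : ℕ) : Hext p k → Hext p k → Prop
  | left (hk : 2 ≤ k) (q q' : Hext p k)
      (hq : IsEigenIdem (T p k 0 : Hext p k) (T p k 1 : Hext p k)
        (-((p.rt₀⁻¹ : ℂˣ) : ℂ)) (-((p.rt⁻¹ : ℂˣ) : ℂ)) q)
      (hq' : IsEigenIdem (T p k 0 : Hext p k) (T p k 1 : Hext p k)
        (p.rt₀ : ℂ) (-((p.rt⁻¹ : ℂˣ) : ℂ)) q') : IdemRel p k q q'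
  | right (hk : 2 ≤ k) (q q' : Hext p k)
      (hq : IsEigenIdem (Tvee p k : Hext p k) (T p k 1 : Hext p k)
        (-((p.rtₖ⁻¹ : ℂˣ) : ℂ)) (-((p.rt⁻¹ : ℂˣ) : ℂ)) q)
      (hq' : IsEigenIdem (Tvee p k : Hext p k) (T p k 1 : Hext p k)
        (p.rtₖ : ℂ) (-((p.rt⁻¹ : ℂˣ) : ℂ)) q') : IdemRel p k q q'
  | bulk (i : ℕ) (hi : 1 ≤ i) (hik : i + 2 ≤ k) (q : Hext p k)
      (hq : IsEigenIdem (T p k i : Hext p k) (T p k (i + 1) : Hext p k)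
        (-((p.rt⁻¹ : ℂˣ) : ℂ)) (-((p.rt⁻¹ : ℂˣ) : ℂ)) q) : IdemRel p k q 0

/-- The parameters for which all the idempotents used in `IdemRel` exist. Up to units,
`p_i^{(1³)}` needs `⟦t⟧(t + 1 + t⁻¹) ≠ 0`, `p_0^{(∅,1²)}` needs `⟦t_0⟧⟦t⟧⟦t_0 t⟧ ≠ 0`,
`p_0^{(1²,∅)}` needs `⟦t_0⟧⟦t⟧⟦t_0 t⁻¹⟧ ≠ 0`, and likewise at the other boundary. -/
def IdemExist (p : Params) (k : ℕ) : Prop :=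
  (2 ≤ k → dbl p.rt ≠ 0 ∧
    dbl p.rt₀ ≠ 0 ∧ dbl (p.rt₀ * p.rt) ≠ 0 ∧ dbl (p.rt₀ * p.rt⁻¹) ≠ 0 ∧
    dbl p.rtₖ ≠ 0 ∧ dbl (p.rtₖ * p.rt) ≠ 0 ∧ dbl (p.rtₖ * p.rt⁻¹) ≠ 0) ∧
  (3 ≤ k → (p.rt : ℂ) ^ 2 + 1 + ((p.rt⁻¹ : ℂˣ) : ℂ) ^ 2 ≠ 0)

/-- The relations of the two boundary Temperley-Lieb algebra in terms of the `e_i`, which make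
sense for all parameters. -/
inductive TLRel (p : Params) (k : ℕ) : Hext p k → Hext p k → Prop
  | left (hk : 2 ≤ k) : TLRel p k
      ((p.a₀ * p.a ^ 2) • (e p k 1 * e p k 0 * e p k 1) -
        ((p.a : ℂ) * dbl (p.rt₀ * p.rt⁻¹)) • e p k 1) 0
  | right (hk : 2 ≤ k) : TLRel p k
      ((p.aₖ * p.a ^ 2) • (e p k (k - 1) * e p k k * e p k (k - 1)) -
        ((p.a : ℂ) * dbl (p.rtₖ * p.rt⁻¹)) • e p k (k - 1)) 0
  | up (i : ℕ) (hi : 1 ≤ i) (hik : i + 2 ≤ k) : TLRel p k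
      (p.a ^ 3 • (e p k i * e p k (i + 1) * e p k i) - p.a • e p k i) 0
  | down (i : ℕ) (hi : 1 ≤ i) (hik : i + 2 ≤ k) : TLRel p k
      (p.a ^ 3 • (e p k (i + 1) * e p k i * e p k (i + 1)) - p.a • e p k (i + 1)) 0

/-- The quotient map from the extended Hecke algebra to its quotient by the relations `r`. -/
abbrev quo (p : Params) (k : ℕ) (r : Hext p k → Hext p k → Prop) :
    Hext p k →ₐ[ℂ] RingQuot r :=
  RingQuot.mkAlgHom ℂ r

/-- The subalgebra `TL_k` of the quotient generated by the images of
`a_0 e_0, a e_1, …, a e_{k-1}, a_k e_k`. -/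
def TL (p : Params) (k : ℕ) (r : Hext p k → Hext p k → Prop) : Subalgebra ℂ (RingQuot r) :=
  Algebra.adjoin ℂ {x | ∃ i ≤ k, x = quo p k r (ae p k i)}

end TwoBoundary

end

open TwoBoundary

/-! Write `E i` for `a_0 e_0`, `a e_i`, `a_k e_k`, and s, x, y for the square roots of t, t_0, t_k.
In the quotient each `T i` and its inverse differ from `E i` by a scalar. Both presentations lead to
the same list of relations, `TLData`, and the identities follow from that list and the braid
relations alone.

Centrality already holds in the Hecke algebra. For 1 ≤ i < k, T_i commutes with the Murphy elements
other than W_i and W_{i+1} = T_i W_i T_i, and the quadratic relation makes it commute with W_i +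
W_i⁻¹ + W_{i+1} + W_{i+1}⁻¹ (`commute_conj_pair`). In the same way T_0 and X_1 commute with W_1 +
W_1⁻¹ (`commute_mul_add_inv`). Moreover T_k is a conjugate of X_1, and P commutes with every W_j.

For the identities, think of `E i` as a cap joining strands i and i+1, of `E 0` and `E k` as
attaching a strand to a wall, and multiply the products of caps by Z. On two strands joined by a
cap, the two Murphy elements reduce to a single loop (`conj_pair_mul`), which slides left past the
other caps at the cost of a power of s (`strand_pair_mul_row`). The inverse Murphy elements give the
same loop with s inverted. Hence every pair contributes a multiple of one fixed element, `pairLoop`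
or `startLoop`, and the coefficients add up to a quantum integer. Pushing the right pole of that
loop to the right end (`pole_mul_row`) turns it into T_k = E_k + y: the term E_k completes the
triple product of alternating rows, and the term y collapses to a scalar.

If the product contains `E k`, the last strand is unpaired. It is computed from W_k = T_k · (T_{k-1}
⋯ T_0 ⋯ T_{k-1}), and the unwanted cross terms cancel because [k] = s[k-1] + s^{1-k} = s⁻¹[k-1] +
s^{k-1}. Division by [k] gives the result.

For the presentation by idempotents, explicit quasi-idempotents `signA` and `signB` realize the
sign-type characters. Equating two eigenvectors of T_0 with different eigenvalues kills both, and
their difference is the boundary relation (`boundary_of_signB_eq`). -/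

noncomputable section

namespace TwoBoundary

/-! ### Affine braid relations of type C -/

/-- The elements `T 0, …, T k` satisfy the braid relations of affine type `C`. -/
structure BraidC {G : Type*} [Group G] (k : ℕ) (T : ℕ → G) : Prop where
  comm : ∀ i j, i + 2 ≤ j → j ≤ k → T i * T j = T j * T i
  braid : ∀ i, 1 ≤ i → i + 2 ≤ k → T i * T (i + 1) * T i = T (i + 1) * T i * T (i + 1)
  left : 2 ≤ k → T 0 * T 1 * T 0 * T 1 = T 1 * T 0 * T 1 * T 0
  right : 2 ≤ k → T (k - 1) * T k * T (k - 1) * T k = T k * T (k - 1) * T k * T (k - 1)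

section Group

variable {G : Type*} [Group G]

/-- `poleAux k T n = T_{k-n}⁻¹ ⋯ T_{k-1}⁻¹ T_k T_{k-1} ⋯ T_{k-n}`. -/
def poleAux (k : ℕ) (T : ℕ → G) : ℕ → G
  | 0 => T k
  | n + 1 => (T (k - (n + 1)))⁻¹ * poleAux k T n * T (k - (n + 1))

/-- `pole k T j = T_j⁻¹ ⋯ T_{k-1}⁻¹ T_k T_{k-1} ⋯ T_j`. -/
def pole (k : ℕ) (T : ℕ → G) (j : ℕ) : G := poleAux k T (k - j)

/-- The Murphy elements attached to `T 0, …, T k`. -/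
def murphyOf (k : ℕ) (T : ℕ → G) : ℕ → G
  | 0 => pole k T 1 * T 0
  | j + 1 => T (j + 1) * murphyOf k T j * T (j + 1)

theorem pole_self (k : ℕ) (T : ℕ → G) : pole k T k = T k := by
  simp [pole, poleAux]

theorem mul_pole {k j : ℕ} (T : ℕ → G) (h : j < k) :
    T j * pole k T j = pole k T (j + 1) * T j := by
  obtain ⟨n, rfl⟩ : ∃ n, k = j + (n + 1) := ⟨k - j - 1, by omega⟩
  have h1 : j + (n + 1) - j = n + 1 := by omega
  have h2 : j + (n + 1) - (j + 1) = n := by omega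
  have h3 : j + (n + 1) - (n + 1) = j := by omega
  simp only [pole, h1, h2, poleAux, h3]
  group

theorem pole_eq {k j : ℕ} (T : ℕ → G) (h : j < k) :
    pole k T j = (T j)⁻¹ * pole k T (j + 1) * T j := by
  rw [mul_assoc, ← mul_pole T h, inv_mul_cancel_left]

/-- Downward induction from `k`. -/
theorem downward_induction {k : ℕ} {P : ℕ → Prop} (base : P k)
    (step : ∀ j, j < k → P (j + 1) → P j) (j : ℕ) (hj : j ≤ k) : P j := by
  induction hn : k - j generalizing j with
  | zero => exact (show j = k by omega) ▸ base
  | succ n ih => exact step j (by omega) (ih (j + 1) (by omega) (by omega))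

namespace BraidC

variable {k : ℕ} {T : ℕ → G} (h : BraidC k T)

include h

/-- Only generators of index at least j ≥ i + 2 occur in the pole. -/
theorem pole_comm_low {i j : ℕ} (hij : i + 2 ≤ j) (hj : j ≤ k) :
    T i * pole k T j = pole k T j * T i := by
  revert hij
  refine downward_induction (P := fun j => i + 2 ≤ j → T i * pole k T j = pole k T j * T i)
    ?_ ?_ j hj
  · intro hij
    rw [pole_self]
    exact h.comm i k hij le_rfl
  · intro j hj ih hij
    have h1 := h.comm i j hij hj.le
    have h2 := ih (by omega)
    have h3 := mul_pole T hj
    refine mul_left_cancel (a := T j) ?_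
    grind

/-- Descending from j + 1 to j adds a generator far from `T i`, except when i = j + 1; that case is
the braid relation. -/
theorem pole_comm_high {i j : ℕ} (h1j : 1 ≤ j) (hij : j < i) (hik : i < k) :
    T i * pole k T j = pole k T j * T i := by
  have hjk : j ≤ k := by omega
  revert h1j hij
  refine downward_induction
    (P := fun j => 1 ≤ j → j < i → T i * pole k T j = pole k T j * T i) ?_ ?_ j hjk
  · intro _ _
    omega
  · intro j hj ih h1j hij
    have h3 := mul_pole T hj
    rcases Nat.lt_or_ge (j + 1) i with hlt | hge
    · have h1 := h.comm j i (by omega) hik.le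
      have h2 := ih (by omega) hlt
      refine mul_left_cancel (a := T j) ?_
      grind
    · obtain rfl : i = j + 1 := by omega
      have h1 := h.braid j h1j (by omega)
      have h2 := h.pole_comm_low (i := j) (j := j + 1 + 1) (by omega) (by omega)
      have h4 := mul_pole T (j := j + 1) (k := k) (by omega)
      -- This factor trades the pole at j for the pole at j + 2, which commutes with `T j`.
      refine mul_left_cancel (a := T (j + 1) * T j) ?_
      generalize T (j + 1) = b at *
      generalize T j = a at *
      generalize pole k T j = X at *
      generalize pole k T (j + 1) = X' at *
      generalize pole k T (j + 1 + 1) = X'' at *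
      calc b * a * (b * X) = (b * a * b) * X := by simp only [mul_assoc]
        _ = a * b * (a * X) := by rw [← h1]; simp only [mul_assoc]
        _ = a * (b * X') * a := by rw [h3]; simp only [mul_assoc]
        _ = (a * X'') * b * a := by rw [h4]; simp only [mul_assoc]
        _ = X'' * (a * b * a) := by rw [h2]; simp only [mul_assoc]
        _ = (X'' * b) * a * b := by rw [h1]; simp only [mul_assoc]
        _ = b * (X' * a) * b := by rw [← h4]; simp only [mul_assoc]
        _ = b * a * (X * b) := by rw [← h3]; simp only [mul_assoc]

/-- Conjugation by `T j * T (j + 1)` carries the pair (`T j`, pole at j + 1) to (`T (j + 1)`, pole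
at j + 2), so the relation descends from the defining one between `T (k - 1)` and `T k`. -/
theorem pole_four {j : ℕ} (h1j : 1 ≤ j) (hj : j < k) :
    pole k T (j + 1) * T j * pole k T (j + 1) * T j =
      T j * pole k T (j + 1) * T j * pole k T (j + 1) := by
  revert h1j
  refine downward_induction (k := k - 1) (P := fun j => 1 ≤ j →
    pole k T (j + 1) * T j * pole k T (j + 1) * T j =
      T j * pole k T (j + 1) * T j * pole k T (j + 1)) ?_ ?_ j (by omega)
  · intro hk
    rw [show k - 1 + 1 = k by omega, pole_self]
    exact (h.right (by omega)).symm
  · intro j hj ih h1j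
    have h1 := ih (by omega)
    have h2 := h.braid j h1j (by omega)
    have h3 := h.pole_comm_low (i := j) (j := j + 1 + 1) (by omega) (by omega)
    have h4 := mul_pole T (j := j + 1) (k := k) (by omega)
    refine mul_left_cancel (a := T j * T (j + 1)) ?_
    have h5 : T j * T (j + 1) * pole k T (j + 1) = pole k T (j + 1 + 1) * (T j * T (j + 1)) := by
      clear h1 h2 ih
      grind
    have h6 : T j * T (j + 1) * T j = T (j + 1) * (T j * T (j + 1)) := by grind
    generalize T j * T (j + 1) = c at *
    generalize pole k T (j + 1) = X' at *
    generalize pole k T (j + 1 + 1) = X'' at *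
    generalize T (j + 1) = b at *
    generalize T j = a at *
    calc c * (X' * a * X' * a) = (c * X') * a * X' * a := by simp only [mul_assoc]
      _ = X'' * (c * a) * X' * a := by rw [h5]; simp only [mul_assoc]
      _ = X'' * b * (c * X') * a := by rw [h6]; simp only [mul_assoc]
      _ = X'' * b * X'' * (c * a) := by rw [h5]; simp only [mul_assoc]
      _ = (X'' * b * X'' * b) * c := by rw [h6]; simp only [mul_assoc]
      _ = b * X'' * b * (X'' * c) := by rw [h1]; simp only [mul_assoc]
      _ = b * X'' * (b * c) * X' := by rw [← h5]; simp only [mul_assoc]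
      _ = b * (X'' * c) * a * X' := by rw [← h6]; simp only [mul_assoc]
      _ = (b * c) * X' * a * X' := by rw [← h5]; simp only [mul_assoc]
      _ = c * (a * X' * a * X') := by rw [← h6]; simp only [mul_assoc]

theorem pole_four_one (hk : 2 ≤ k) :
    pole k T 1 * T 1 * pole k T 1 * T 1 = T 1 * pole k T 1 * T 1 * pole k T 1 := by
  have h1 := h.pole_four (j := 1) le_rfl (by omega)
  have h2 := mul_pole T (j := 1) (k := k) (by omega)
  refine mul_left_cancel (a := T 1) ?_
  grind

theorem murphy_comm_high {i j : ℕ} (hij : j + 1 < i) (hik : i < k) :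
    T i * murphyOf k T j = murphyOf k T j * T i := by
  induction j with
  | zero =>
    have h1 := h.pole_comm_high le_rfl hij hik
    have h2 := h.comm 0 i (by omega) hik.le
    simp only [murphyOf]
    grind
  | succ j ih =>
    have h1 := ih (by omega)
    have h2 := h.comm (j + 1) i (by omega) hik.le
    simp only [murphyOf]
    grind

/-- The essential case is j = i + 1 for `murphyOf`: the braid relation turns `T i` into `T (i + 1)`,
which passes the inner Murphy element by `murphy_comm_high` and is turned back on the other side. -/
theorem murphy_comm_low {i j : ℕ} (h1i : 1 ≤ i) (hij : i < j) (hjk : j < k) :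
    T i * murphyOf k T j = murphyOf k T j * T i := by
  induction j with
  | zero => omega
  | succ j ih =>
    rcases Nat.lt_or_ge i j with hlt | hge
    · have h1 := ih hlt (by omega)
      have h2 := h.comm i (j + 1) (by omega) hjk.le
      simp only [murphyOf]
      grind
    · obtain ⟨l, rfl⟩ : ∃ l, i = l + 1 := ⟨i - 1, by omega⟩
      obtain rfl : j = l + 1 := by omega
      have h1 := h.murphy_comm_high (i := l + 1 + 1) (j := l) (by omega) hjk
      have h2 := h.braid (l + 1) (by omega) (by omega)
      simp only [murphyOf]
      generalize T (l + 1) = a at *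
      generalize T (l + 1 + 1) = b at *
      generalize murphyOf k T l = w at *
      calc a * (b * (a * w * a) * b) = a * b * a * w * a * b := by simp only [mul_assoc]
        _ = b * a * (b * w) * a * b := by rw [h2]; simp only [mul_assoc]
        _ = b * a * w * (b * a * b) := by rw [h1]; simp only [mul_assoc]
        _ = b * (a * w * a) * b * a := by rw [← h2]; simp only [mul_assoc]

/-- In the base case the pole at 1 is traded for the pole at 2, which commutes with `T 0`; what
remains is the four-term relation of `T 0` and `T 1`. -/
theorem murphy_comm_zero {j : ℕ} (h1j : 1 ≤ j) (hjk : j < k) :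
    T 0 * murphyOf k T j = murphyOf k T j * T 0 := by
  induction j, h1j using Nat.le_induction with
  | base =>
    have h1 := h.left (by omega)
    have h2 := mul_pole T (j := 1) (k := k) (by omega)
    have h3 := h.pole_comm_low (i := 0) (j := 1 + 1) (by omega) (by omega)
    simp only [murphyOf]
    generalize pole k T 1 = X at *
    generalize pole k T (1 + 1) = Y at *
    generalize T 1 = a at *
    generalize T 0 = o at *
    calc o * (a * (X * o) * a) = o * (a * X) * o * a := by simp only [mul_assoc]
      _ = (o * Y) * a * o * a := by rw [h2]; simp only [mul_assoc]
      _ = Y * (o * a * o * a) := by rw [h3]; simp only [mul_assoc]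
      _ = (Y * a) * o * a * o := by rw [h1]; simp only [mul_assoc]
      _ = a * (X * o) * a * o := by rw [← h2]; simp only [mul_assoc]
  | succ j hj ih =>
    have h1 := ih (by omega)
    have h2 := h.comm 0 (j + 1) (by omega) hjk.le
    simp only [murphyOf] at h1 ⊢
    grind

/-- Mirror image of `murphy_comm_zero`: the four-term relation now is the one between the pole at 1
and `T 1`. -/
theorem murphy_comm_pole {j : ℕ} (h1j : 1 ≤ j) (hjk : j < k) :
    pole k T 1 * murphyOf k T j = murphyOf k T j * pole k T 1 := by
  induction j, h1j using Nat.le_induction with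
  | base =>
    have h1 := h.pole_four_one (by omega)
    have h2 := mul_pole T (j := 1) (k := k) (by omega)
    have h3 := h.pole_comm_low (i := 0) (j := 1 + 1) (by omega) (by omega)
    simp only [murphyOf]
    generalize pole k T 1 = X at *
    generalize pole k T (1 + 1) = Y at *
    generalize T 1 = a at *
    calc X * (a * (X * T 0) * a) = X * (a * X) * T 0 * a := by simp only [mul_assoc]
      _ = (X * a * X * a) * (a⁻¹ * T 0 * a) := by group
      _ = a * X * Y * T 0 * a := by rw [h1, mul_assoc (a * X), h2]; group
      _ = a * X * (T 0 * Y) * a := by rw [h3]; simp only [mul_assoc]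
      _ = a * X * T 0 * (a * X) := by rw [h2]; simp only [mul_assoc]
      _ = a * (X * T 0) * a * X := by simp only [mul_assoc]
  | succ j hj ih =>
    have h1 := ih (by omega)
    have h2 := h.pole_comm_high (i := j + 1) (j := 1) le_rfl (by omega) hjk
    simp only [murphyOf] at h1 ⊢
    grind

end BraidC

end Group

/-! ### The central element -/

section Center

variable {A : Type*} [Ring A] [Algebra ℂ A]

theorem coe_inv_eq_sub {q : ℂ} {t : Aˣ} (ht : (t : A) * t = 1 + q • (t : A)) :
    ((t⁻¹ : Aˣ) : A) = t - q • 1 := by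
  have h1 : (t : A) * (t - q • 1) = 1 := by
    rw [mul_sub, ht, mul_smul_comm, mul_one, add_sub_cancel_right]
  exact Units.inv_eq_of_mul_eq_one_right h1

theorem inv_mul_inv_eq {q : ℂ} {t : Aˣ} (ht : (t : A) * t = 1 + q • (t : A)) :
    ((t⁻¹ : Aˣ) : A) * ((t⁻¹ : Aˣ) : A) = 1 + (-q) • ((t⁻¹ : Aˣ) : A) := by
  simp only [coe_inv_eq_sub ht, sub_mul, mul_sub, ht, smul_mul_assoc, mul_smul_comm, mul_one,
    one_mul]
  module

/-- Both products equal tw + wt + q·twt. -/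
theorem commute_add_conj {q : ℂ} {t : Aˣ} (ht : (t : A) * t = 1 + q • (t : A)) (w : Aˣ) :
    Commute (t : A) ((w : A) + ((t * w * t : Aˣ) : A)) := by
  have h1 : ∀ z : A, (t : A) * (t * z) = z + q • ((t : A) * z) := fun z => by
    rw [← mul_assoc, ht, add_mul, one_mul, smul_mul_assoc]
  simp only [Commute, SemiconjBy, Units.val_mul, mul_add, add_mul, mul_assoc, ht, h1, mul_one,
    mul_smul_comm]
  module

/-- Apply `commute_add_conj` to (t, w) and to (t⁻¹, w⁻¹), the inverse satisfying the quadratic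
relation with -q; commuting with t⁻¹ is the same as commuting with t. -/
theorem commute_conj_pair {q : ℂ} {t : Aˣ} (ht : (t : A) * t = 1 + q • (t : A)) (w : Aˣ) :
    Commute (t : A) ((w : A) + ((w⁻¹ : Aˣ) : A) +
      (((t * w * t : Aˣ) : A) + (((t * w * t)⁻¹ : Aˣ) : A))) := by
  have h1 := commute_add_conj ht w
  have h2 := commute_add_conj (inv_mul_inv_eq ht) w⁻¹
  have h3 : t⁻¹ * w⁻¹ * t⁻¹ = (t * w * t)⁻¹ := by group
  rw [h3] at h2
  have h4 : Commute (t : A) _ := (Commute.units_inv_left_iff.mp h2)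
  have h5 := h1.add_right h4
  convert h5 using 1
  abel

/-- Since t⁻¹ = t - d and x⁻¹ = x - c, the sum is xt + tx - dx - ct + cd. Multiplying xt + tx - dx
by t on either side gives txt + x, and the rest is a polynomial in t; the argument for x is
symmetric. -/
theorem commute_mul_add_inv {c d : ℂ} {x t : Aˣ} (hx : (x : A) * x = 1 + c • (x : A))
    (ht : (t : A) * t = 1 + d • (t : A)) :
    Commute (t : A) (((x * t : Aˣ) : A) + (((x * t)⁻¹ : Aˣ) : A)) ∧
    Commute (x : A) (((x * t : Aˣ) : A) + (((x * t)⁻¹ : Aˣ) : A)) := by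
  have h1 : ∀ z : A, (t : A) * (t * z) = z + d • ((t : A) * z) := fun z => by
    rw [← mul_assoc, ht, add_mul, one_mul, smul_mul_assoc]
  have h2 : ∀ z : A, (x : A) * (x * z) = z + c • ((x : A) * z) := fun z => by
    rw [← mul_assoc, hx, add_mul, one_mul, smul_mul_assoc]
  rw [mul_inv_rev]
  simp only [Commute, SemiconjBy, Units.val_mul, coe_inv_eq_sub hx, coe_inv_eq_sub ht, mul_add,
    add_mul, mul_sub, sub_mul, mul_assoc, ht, h1, hx, h2, mul_one, one_mul, mul_smul_comm,
    smul_mul_assoc]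
  constructor <;> module

theorem commute_val {A : Type*} [Ring A] {u v : Aˣ} (h : u * v = v * u) :
    Commute (u : A) (v : A) := by
  simp only [Commute, SemiconjBy, ← Units.val_mul, h]

theorem commute_units_add_inv {A : Type*} [Ring A] {u v : Aˣ} (h : u * v = v * u) :
    Commute (u : A) ((v : A) + ((v⁻¹ : Aˣ) : A)) := by
  have h1 := commute_val h
  exact h1.add_right h1.units_inv_right

/-- The sum of the Murphy elements and their inverses. -/
def murphySum (k : ℕ) (T : ℕ → Aˣ) : A :=
  ∑ j ∈ Finset.range k, (((murphyOf k T j : Aˣ) : A) + (((murphyOf k T j)⁻¹ : Aˣ) : A))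

theorem commute_sum_of_erase {M : Type*} [Ring M] {k : ℕ} {f : ℕ → M} {u : M} {s : Finset ℕ}
    (hs : s ⊆ Finset.range k) (h1 : Commute u (∑ j ∈ s, f j))
    (h2 : ∀ j < k, j ∉ s → Commute u (f j)) :
    Commute u (∑ j ∈ Finset.range k, f j) := by
  rw [← Finset.sum_sdiff hs]
  refine Commute.add_right (Commute.sum_right _ _ _ fun j hj => ?_) h1
  rw [Finset.mem_sdiff, Finset.mem_range] at hj
  exact h2 j hj.1 hj.2

variable {k : ℕ} {T : ℕ → Aˣ} {q c d : ℂ}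

/-- Each generator fails to commute separately with at most two Murphy elements, and these are
handled together. `T k` is replaced by its conjugate, the pole at 1, whose interaction is with the
first Murphy element only. -/
theorem BraidC.commute_murphySum (h : BraidC k T) (hk : 1 ≤ k)
    (hT : ∀ i, 1 ≤ i → i < k → (T i : A) * T i = 1 + q • (T i : A))
    (hT0 : (T 0 : A) * T 0 = 1 + d • (T 0 : A))
    (hX : ((pole k T 1 : Aˣ) : A) * (pole k T 1 : Aˣ) = 1 + c • ((pole k T 1 : Aˣ) : A)) :
    (∀ i < k, Commute (T i : A) (murphySum k T)) ∧
      Commute ((pole k T 1 : Aˣ) : A) (murphySum k T) := by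
  have hW := commute_mul_add_inv hX hT0
  refine ⟨fun i hi => ?_, ?_⟩
  · rcases i with _ | i
    · refine commute_sum_of_erase (s := {0}) (by simp only [Finset.singleton_subset_iff, Finset.mem_range]; omega) ?_ fun j hj hj0 => ?_
      · simpa [murphyOf] using hW.1
      · exact commute_units_add_inv (h.murphy_comm_zero (by simp at hj0; omega) hj)
    · refine commute_sum_of_erase (s := {i, i + 1}) ?_ ?_ fun j hj hjs => ?_
      · intro j
        simp only [Finset.mem_insert, Finset.mem_singleton, Finset.mem_range]
        omega
      · rw [Finset.sum_pair (by omega)]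
        exact commute_conj_pair (hT (i + 1) (by omega) hi) (murphyOf k T i)
      · simp only [Finset.mem_insert, Finset.mem_singleton, not_or] at hjs
        apply commute_units_add_inv
        rcases Nat.lt_or_ge j i with hlt | hge
        · exact h.murphy_comm_high (by omega) hi
        · exact h.murphy_comm_low (by omega) (by omega) hj
  · refine commute_sum_of_erase (s := {0}) (by simp only [Finset.singleton_subset_iff, Finset.mem_range]; omega) ?_ fun j hj hj0 => ?_
    · simpa [murphyOf] using hW.2
    · exact commute_units_add_inv (h.murphy_comm_pole (by simp at hj0; omega) hj)

end Center

/-! ### Two boundary Temperley-Lieb relations -/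

section TemperleyLieb

theorem mul_mul_left_of_eq {A : Type*} [Semigroup A] {a b c : A} (h : a * b = c) (z : A) :
    a * (b * z) = c * z := by
  rw [← mul_assoc, h]

theorem mul_mul_mul_left_of_eq {A : Type*} [Semigroup A] {a b c d : A} (h : a * (b * c) = d)
    (z : A) : a * (b * (c * z)) = d * z := by
  rw [← h]; simp only [mul_assoc]

theorem val_pole_eq {A : Type*} [Ring A] {k j : ℕ} (T : ℕ → Aˣ) (hj : j < k) :
    ((pole k T j : Aˣ) : A) = (((T j)⁻¹ : Aˣ) : A) * (pole k T (j + 1) : Aˣ) * T j := by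
  rw [pole_eq T hj]; simp only [Units.val_mul]

variable {A : Type*} [Ring A] [Algebra ℂ A]

/-- The elements `E i`, and the units `T i` that differ from them by scalars, satisfy the two
boundary Temperley-Lieb relations. -/
structure TLData (k : ℕ) (s x y : ℂ) (T : ℕ → Aˣ) (E : ℕ → A) : Prop where
  s_ne : s ≠ 0
  x_ne : x ≠ 0
  y_ne : y ≠ 0
  T_zero : (T 0 : A) = E 0 + x • 1
  T_zero_inv : (((T 0)⁻¹ : Aˣ) : A) = E 0 + x⁻¹ • 1
  T_mid : ∀ i, 1 ≤ i → i < k → (T i : A) = E i + s • 1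
  T_mid_inv : ∀ i, 1 ≤ i → i < k → (((T i)⁻¹ : Aˣ) : A) = E i + s⁻¹ • 1
  T_last : (T k : A) = E k + y • 1
  T_last_inv : (((T k)⁻¹ : Aˣ) : A) = E k + y⁻¹ • 1
  sq_zero : E 0 * E 0 = -(x + x⁻¹) • E 0
  sq_mid : ∀ i, 1 ≤ i → i < k → E i * E i = -(s + s⁻¹) • E i
  sq_last : E k * E k = -(y + y⁻¹) • E k
  comm : ∀ i j, i + 2 ≤ j → j ≤ k → E i * E j = E j * E i
  up : ∀ i, 1 ≤ i → i + 2 ≤ k → E i * (E (i + 1) * E i) = E i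
  down : ∀ i, 1 ≤ i → i + 2 ≤ k → E (i + 1) * (E i * E (i + 1)) = E (i + 1)
  left : 2 ≤ k → E 1 * (E 0 * E 1) = (x * s⁻¹ + x⁻¹ * s) • E 1
  right : 2 ≤ k → E (k - 1) * (E k * E (k - 1)) = (y * s⁻¹ + y⁻¹ * s) • E (k - 1)

/-- From tE = -s⁻¹E one gets tVtE = -s⁻¹(E + s)VE, and its second term cancels VE. -/
theorem conj_pair_mul {s : ℂ} (hs : s ≠ 0) {t E : A} (ht : t = E + s • 1)
    (hE : E * E = -(s + s⁻¹) • E) (V : A) :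
    (V + t * V * t) * E = -s⁻¹ • (E * (V * E)) := by
  have h1 : t * E = -s⁻¹ • E := by
    rw [ht, add_mul, hE, smul_mul_assoc, one_mul]; module
  rw [add_mul, mul_assoc (t * V), h1, ht]
  simp only [add_mul, mul_smul_comm, smul_mul_assoc, one_mul, mul_assoc]
  match_scalars <;> (field_simp; try ring)

namespace TLData

variable {k : ℕ} {s x y : ℂ} {T : ℕ → Aˣ} {E : ℕ → A} (D : TLData k s x y T E)

include D

/-- The relations are invariant under inverting the `T i` and the parameters. -/
theorem bar : TLData k s⁻¹ x⁻¹ y⁻¹ (fun i => (T i)⁻¹) E where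
  s_ne := inv_ne_zero D.s_ne
  x_ne := inv_ne_zero D.x_ne
  y_ne := inv_ne_zero D.y_ne
  T_zero := D.T_zero_inv
  T_zero_inv := by simpa using D.T_zero
  T_mid := D.T_mid_inv
  T_mid_inv := by simpa using D.T_mid
  T_last := D.T_last_inv
  T_last_inv := by simpa using D.T_last
  sq_zero := by rw [D.sq_zero, inv_inv, add_comm]
  sq_mid := fun i h1 h2 => by rw [D.sq_mid i h1 h2, inv_inv, add_comm]
  sq_last := by rw [D.sq_last, inv_inv, add_comm]
  comm := D.comm
  up := D.up
  down := D.down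
  left := fun h => by rw [D.left h, inv_inv, inv_inv, add_comm]
  right := fun h => by rw [D.right h, inv_inv, inv_inv, add_comm]

theorem T_form {i : ℕ} (hi : i ≤ k) : ∃ c : ℂ, (T i : A) = E i + c • 1 := by
  rcases Nat.eq_zero_or_pos i with rfl | h
  · exact ⟨_, D.T_zero⟩
  · rcases hi.lt_or_eq with h1 | rfl
    · exact ⟨_, D.T_mid i h h1⟩
    · exact ⟨_, D.T_last⟩

theorem commute_E {i j : ℕ} (hij : i + 2 ≤ j ∨ j + 2 ≤ i) (hi : i ≤ k) (hj : j ≤ k) :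
    Commute (E i) (E j) := by
  rcases hij with h | h
  · exact D.comm i j h hj
  · exact (D.comm j i h hi).symm

theorem commute_E_of_commute_T {i : ℕ} (hi : i ≤ k) {V : A} (h : Commute V (T i : A)) :
    Commute V (E i) := by
  obtain ⟨c, hc⟩ := D.T_form hi
  rw [eq_sub_of_add_eq hc.symm]
  exact h.sub_right ((Commute.one_right V).smul_right c)

theorem commute_E_T {i j : ℕ} (hij : i + 2 ≤ j ∨ j + 2 ≤ i) (hi : i ≤ k) (hj : j ≤ k) :
    Commute (E i) (T j : A) := by
  obtain ⟨c, hc⟩ := D.T_form hj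
  rw [hc]
  exact (D.commute_E hij hi hj).add_right ((Commute.one_right _).smul_right c)

/-- A cap slides through two crossings: in the expansion the multiples of `E i` cancel. -/
theorem T_mul_T_mul_E {i : ℕ} (h1 : 1 ≤ i) (h2 : i + 2 ≤ k) :
    (T i : A) * (T (i + 1) * E i) = s • (E (i + 1) * E i) := by
  have hs := D.s_ne
  simp only [D.T_mid i h1 (by omega), D.T_mid (i + 1) (by omega) (by omega), add_mul, mul_add,
    smul_mul_assoc, mul_smul_comm, one_mul, D.up i h1 h2, D.sq_mid i h1 (by omega)]
  match_scalars <;> (field_simp; try ring)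

theorem T_succ_mul_T_mul_E {i : ℕ} (h1 : 1 ≤ i) (h2 : i + 2 ≤ k) :
    (T (i + 1) : A) * (T i * E (i + 1)) = s • (E i * E (i + 1)) := by
  have hs := D.s_ne
  simp only [D.T_mid i h1 (by omega), D.T_mid (i + 1) (by omega) (by omega), add_mul, mul_add,
    smul_mul_assoc, mul_smul_comm, one_mul, D.down i h1 h2,
    D.sq_mid (i + 1) (by omega) (by omega)]
  match_scalars <;> (field_simp; try ring)

/-- A strand element passes below a cap. -/
theorem strand_mul_E {i : ℕ} (h1 : 1 ≤ i) (h2 : i + 2 ≤ k) {V : A}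
    (hV : Commute V (E (i + 1))) :
    (T (i + 1) * (T i * V * T i) * T (i + 1) : A) * E i =
      s ^ 2 • (E i * (E (i + 1) * (V * E i))) := by
  have h3 := hV.eq
  calc (T (i + 1) * (T i * V * T i) * T (i + 1) : A) * E i
      = T (i + 1) * (T i * (V * (T i * (T (i + 1) * E i)))) := by simp only [mul_assoc]
    _ = s • (T (i + 1) * (T i * ((V * E (i + 1)) * E i))) := by
        rw [D.T_mul_T_mul_E h1 h2]; simp only [mul_smul_comm, mul_assoc]
    _ = s • (T (i + 1) * (T i * E (i + 1)) * (V * E i)) := by rw [h3]; simp only [mul_assoc]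
    _ = _ := by
        rw [D.T_succ_mul_T_mul_E h1 h2, smul_mul_assoc, smul_smul, ← pow_two]
        simp only [mul_assoc]

/-- A pole element passes below a cap. -/
theorem pole_mul_E {i : ℕ} (h1 : 1 ≤ i) (h2 : i + 2 ≤ k) {V : A} (hV : Commute V (E i)) :
    (((T i)⁻¹ : Aˣ) * ((((T (i + 1))⁻¹ : Aˣ) : A) * V * T (i + 1)) * T i : A) * E (i + 1) =
      E (i + 1) * (E i * (V * E (i + 1))) := by
  have h3 := hV.eq
  have hs := D.s_ne
  have h4 := D.bar.T_mul_T_mul_E h1 h2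
  calc (((T i)⁻¹ : Aˣ) * ((((T (i + 1))⁻¹ : Aˣ) : A) * V * T (i + 1)) * T i : A) * E (i + 1)
      = ((T i)⁻¹ : Aˣ) * (((T (i + 1))⁻¹ : Aˣ) * (V * (T (i + 1) * (T i * E (i + 1))))) := by
        simp only [mul_assoc]
    _ = s • (((T i)⁻¹ : Aˣ) * (((T (i + 1))⁻¹ : Aˣ) * ((V * E i) * E (i + 1)))) := by
        rw [D.T_succ_mul_T_mul_E h1 h2]; simp only [mul_smul_comm, mul_assoc]
    _ = s • (((T i)⁻¹ : Aˣ) * (((T (i + 1))⁻¹ : Aˣ) * E i) * (V * E (i + 1))) := by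
        rw [h3]; simp only [mul_assoc]
    _ = _ := by
        rw [h4, smul_mul_assoc, smul_smul, mul_inv_cancel₀ hs, one_smul]
        simp only [mul_assoc]

theorem commute_pole_E (h : BraidC k T) {i j : ℕ} (hij : i + 2 ≤ j) (hj : j ≤ k) :
    Commute ((pole k T j : Aˣ) : A) (E i) := by
  exact D.commute_E_of_commute_T (by omega) (commute_val (h.pole_comm_low hij hj)).symm

theorem pole_mul_E_succ (h : BraidC k T) {j : ℕ} (h1 : 1 ≤ j) (h2 : j + 2 ≤ k) :
    ((pole k T j : Aˣ) : A) * E (j + 1) =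
      E (j + 1) * (E j * ((pole k T (j + 2) : Aˣ) * E (j + 1))) := by
  rw [val_pole_eq T (by omega), val_pole_eq T (by omega)]
  exact D.pole_mul_E h1 h2 (D.commute_pole_E h le_rfl h2)

/-- A loop around the right pole. -/
theorem E_pole_E (h : BraidC k T) {j : ℕ} (h1 : 1 ≤ j) (h2 : j < k) :
    E j * ((pole k T (j + 1) : Aˣ) * E j) = (-s * (y - y⁻¹)) • E j := by
  have hs := D.s_ne
  have hy := D.y_ne
  -- The scalar does not depend on j, so the boundary relation at k - 1 is propagated downwards.
  revert h1
  refine downward_induction (k := k - 1) (P := fun j => 1 ≤ j →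
    E j * ((pole k T (j + 1) : Aˣ) * E j) = (-s * (y - y⁻¹)) • E j) ?_ ?_ j (by omega)
  · intro h1
    rw [show k - 1 + 1 = k by omega, pole_self, D.T_last]
    simp only [add_mul, mul_add, smul_mul_assoc, mul_smul_comm, one_mul, D.right (by omega),
      D.sq_mid (k - 1) h1 (by omega)]
    match_scalars <;> (field_simp; try ring)
  · intro j hj ih h1
    have h3 := ih (by omega)
    have h4 := (D.commute_pole_E h (i := j) (j := j + 1 + 1) (by omega) (by omega)).eq
    have h5 := D.up j h1 (by omega)
    rw [val_pole_eq T (by omega), D.T_mid (j + 1) (by omega) (by omega),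
      D.T_mid_inv (j + 1) (by omega) (by omega)]
    generalize ((pole k T (j + 1 + 1) : Aˣ) : A) = V at *
    have e1 : E j * (E (j + 1) * (V * (E (j + 1) * E j))) = (-s * (y - y⁻¹)) • E j := by
      calc E j * (E (j + 1) * (V * (E (j + 1) * E j)))
          = E j * ((E (j + 1) * (V * E (j + 1))) * E j) := by simp only [mul_assoc]
        _ = _ := by rw [h3, smul_mul_assoc, mul_smul_comm, h5]
    have e2 : E j * (V * (E (j + 1) * E j)) = V * E j := by
      rw [← mul_assoc, ← h4, mul_assoc, h5]
    have e3 : E j * (E (j + 1) * (V * E j)) = V * E j := by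
      rw [h4, show E j * (E (j + 1) * (E j * V)) = E j * (E (j + 1) * E j) * V by
        simp only [mul_assoc], h5]
    have e4 : E j * (V * E j) = -(s + s⁻¹) • (V * E j) := by
      rw [h4, ← mul_assoc, D.sq_mid j h1 (by omega), smul_mul_assoc]
    simp only [add_mul, mul_add, smul_mul_assoc, mul_smul_comm, one_mul, mul_one, smul_add,
      mul_assoc, e1, e2, e3, e4]
    match_scalars <;> (field_simp; try ring)

/-- At the wall the cap does not slide off cleanly: the term in `E (k - 1) * E k` survives, and is
cancelled only after summing over all strands. -/
theorem pole_pred_mul_E (hk : 2 ≤ k) :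
    ((pole k T (k - 1) : Aˣ) : A) * E k = (-y * (s - s⁻¹)) • (E (k - 1) * E k) +
      s⁻¹ • (E k * (E (k - 1) * E k)) - y⁻¹ • E k := by
  have hs := D.s_ne
  have hy := D.y_ne
  rw [val_pole_eq T (by omega), show k - 1 + 1 = k by omega, pole_self, D.T_last,
    D.T_mid (k - 1) (by omega) (by omega), D.T_mid_inv (k - 1) (by omega) (by omega)]
  simp only [add_mul, mul_add, smul_mul_assoc, mul_smul_comm, one_mul, mul_one, smul_add,
    mul_assoc, D.sq_last, mul_mul_mul_left_of_eq (D.right hk),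
    mul_mul_left_of_eq (D.sq_mid (k - 1) (by omega) (by omega))]
  match_scalars <;> (field_simp; try ring)

theorem strand_zero_mul_E (hk : 2 ≤ k) :
    (T 1 * T 0 * T 1 : A) * E 0 = s • (E 0 * (E 1 * E 0)) - (s ^ 2 * x⁻¹) • E 0 := by
  have hs := D.s_ne
  have hx := D.x_ne
  rw [D.T_zero, D.T_mid 1 (by omega) (by omega)]
  simp only [add_mul, mul_add, smul_mul_assoc, mul_smul_comm, one_mul, mul_one, smul_add,
    mul_assoc, D.sq_zero, mul_mul_mul_left_of_eq (D.left hk),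
    mul_mul_left_of_eq (D.sq_mid 1 (by omega) (by omega))]
  match_scalars <;> (field_simp; try ring)

theorem E_one_T_zero (hk : 2 ≤ k) : E 1 * (T 0 * E 1) = (-s * (x - x⁻¹)) • E 1 := by
  have hs := D.s_ne
  have hx := D.x_ne
  rw [D.T_zero]
  simp only [add_mul, mul_add, smul_mul_assoc, mul_smul_comm, one_mul, D.left hk,
    D.sq_mid 1 (by omega) (by omega)]
  match_scalars <;> (field_simp; try ring)

theorem T_mul_E {i : ℕ} (h1 : 1 ≤ i) (h2 : i < k) : (T i : A) * E i = (-s⁻¹) • E i := by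
  rw [D.T_mid i h1 h2, add_mul, D.sq_mid i h1 h2, smul_mul_assoc, one_mul]; module

theorem E_mul_T {i : ℕ} (h1 : 1 ≤ i) (h2 : i < k) : E i * (T i : A) = (-s⁻¹) • E i := by
  rw [D.T_mid i h1 h2, mul_add, D.sq_mid i h1 h2, mul_smul_comm, mul_one]; module

end TLData

end TemperleyLieb

/-! ### The first Murphy elements enclosed between caps -/

section TemperleyLieb

variable {A : Type*} [Ring A] [Algebra ℂ A]

namespace TLData

variable {k : ℕ} {s x y : ℂ} {T : ℕ → Aˣ} {E : ℕ → A} (D : TLData k s x y T E)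

include D

theorem pole_mul_pole {j : ℕ} (hj : j ≤ k) : ((pole k T j : Aˣ) : A) * (pole k T j : Aˣ) =
    1 + (y - y⁻¹) • ((pole k T j : Aˣ) : A) := by
  refine downward_induction (P := fun j => ((pole k T j : Aˣ) : A) * (pole k T j : Aˣ) =
    1 + (y - y⁻¹) • ((pole k T j : Aˣ) : A)) ?_ ?_ j hj
  · have hy := D.y_ne
    rw [pole_self, D.T_last]
    simp only [add_mul, mul_add, smul_mul_assoc, mul_smul_comm, one_mul, mul_one, D.sq_last]
    match_scalars <;> (field_simp; try ring)
  · intro j hj ih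
    rw [val_pole_eq T hj]
    generalize ((pole k T (j + 1) : Aˣ) : A) = V at *
    calc ((((T j)⁻¹ : Aˣ) : A) * V * T j) * ((((T j)⁻¹ : Aˣ) : A) * V * T j)
        = (((T j)⁻¹ : Aˣ) : A) * (V * V) * T j := by simp only [mul_assoc, Units.mul_inv_cancel_left]
      _ = _ := by
        rw [ih, mul_add, add_mul, mul_one, Units.inv_mul, mul_smul_comm, smul_mul_assoc]

theorem val_pole_inv {j : ℕ} (hj : j ≤ k) : (((pole k T j)⁻¹ : Aˣ) : A) =
    (pole k T j : Aˣ) - (y - y⁻¹) • 1 :=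
  coe_inv_eq_sub (D.pole_mul_pole hj)

/-- The boundary loop at a left boundary that starts with `E 0`. -/
theorem murphy_zero_add_inv_mul_E_zero (hk : 1 ≤ k) :
    ((murphyOf k T 0 : Aˣ) : A) * E 0 + (((murphyOf k T 0)⁻¹ : Aˣ) : A) * E 0 =
      E 0 * ((pole k T 1 : Aˣ) * E 0) + (x * (y - y⁻¹)) • E 0 := by
  have hx := D.x_ne
  have h1 : ((T 0 : Aˣ) : A) * E 0 = (-x⁻¹) • E 0 := by
    rw [D.T_zero, add_mul, D.sq_zero, smul_mul_assoc, one_mul]; module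
  simp only [murphyOf, mul_inv_rev, Units.val_mul, mul_assoc, h1, D.val_pole_inv hk, D.T_zero_inv,
    mul_smul_comm, smul_mul_assoc, add_mul, mul_sub, sub_mul, one_mul, smul_sub, D.sq_zero]
  match_scalars <;> (field_simp; try ring)

/-- This and `E_one_murphy_inv_E_one` produce the same element, with factors -s² and -s⁻²; hence a
Murphy element and its inverse contribute multiples of one loop. -/
theorem E_one_murphy_E_one (h : BraidC k T) (hk : 2 ≤ k) :
    E 1 * ((murphyOf k T 0 : Aˣ) * E 1) = (-s ^ 2) • (E 1 * ((pole k T 2 : Aˣ) * (E 0 * E 1)) -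
      (s * x⁻¹ * (y - y⁻¹)) • E 1) := by
  have hs := D.s_ne
  have hx := D.x_ne
  have h1 := D.bar.E_mul_T (i := 1) le_rfl (by omega)
  have h2 := D.T_mid 1 le_rfl (by omega)
  have h3 := D.E_one_T_zero hk
  have h4 := D.E_pole_E h (j := 1) le_rfl (by omega)
  simp only [murphyOf, Units.val_mul, val_pole_eq T (show 1 < k by omega), mul_assoc,
    mul_mul_left_of_eq h1]
  simp only [h2, add_mul, smul_mul_assoc, mul_add, mul_smul_comm, one_mul, h3, h4, smul_add]
  simp only [D.T_zero, add_mul, smul_mul_assoc, mul_add, mul_smul_comm, one_mul, h4]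
  match_scalars <;> (field_simp; try ring)

theorem E_one_murphy_inv_E_one (h : BraidC k T) (hk : 2 ≤ k) :
    E 1 * (((murphyOf k T 0)⁻¹ : Aˣ) * E 1) =
      (-s⁻¹ ^ 2) • (E 1 * ((pole k T 2 : Aˣ) * (E 0 * E 1)) - (s * x⁻¹ * (y - y⁻¹)) • E 1) := by
  have hs := D.s_ne
  have hx := D.x_ne
  have h1 := D.T_mul_E (i := 1) le_rfl (by omega)
  have h2 := D.T_mid_inv 1 le_rfl (by omega)
  have h3 := mul_mul_mul_left_of_eq (D.bar.E_one_T_zero hk)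
  have h4 := D.E_pole_E h (j := 1) le_rfl (by omega)
  have h5 : (((pole k T 1)⁻¹ : Aˣ) : A) = (((T 1)⁻¹ : Aˣ) : A) * ((pole k T 2)⁻¹ : Aˣ) * T 1 := by
    rw [pole_eq T (show 1 < k by omega)]
    simp only [mul_inv_rev, inv_inv, Units.val_mul, mul_assoc]
  have h6 := (D.commute_pole_E h (i := 0) (j := 2) le_rfl hk).eq
  -- The inverse Murphy element has `T 0` and the pole in the opposite order; this restores the
  -- order of the noninverted case.
  have h7 : ∀ z : A, (pole k T 2 : Aˣ) * (E 0 * z) = E 0 * ((pole k T 2 : Aˣ) * z) := fun z => by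
    rw [mul_mul_left_of_eq h6, mul_assoc]
  simp only [Nat.reduceAdd] at h4
  simp only [murphyOf, Units.val_mul, mul_inv_rev, h5, mul_assoc, h1, mul_smul_comm]
  simp only [h2, add_mul, smul_mul_assoc, mul_add, mul_smul_comm, one_mul, h3, smul_add]
  simp only [D.val_pole_inv hk, sub_mul, mul_sub, D.T_zero_inv, smul_sub, h4, smul_mul_assoc,
    add_mul, mul_add, mul_smul_comm, one_mul, smul_add, D.sq_mid 1 le_rfl (by omega), D.left hk, h7]
  match_scalars <;> (field_simp; try ring)

/-- When strand 1 is attached to the left wall, the first pair is (2, 3). Its loop is converted into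
the loop of strand 1, so that single strand and pairs give the same element. -/
theorem E_two_murphy_E_two (h : BraidC k T) (hk : 3 ≤ k) :
    E 2 * ((murphyOf k T 1 : Aˣ) * (E 2 * E 0)) =
      (-s ^ 3) • ((E 0 * ((pole k T 1 : Aˣ) * E 0) + (x * (y - y⁻¹)) • E 0) * E 2) := by
  have hs := D.s_ne
  have hx := D.x_ne
  have h1 := D.strand_zero_mul_E (by omega)
  have h2 : (murphyOf k T 1 : Aˣ) = pole k T 2 * (T 1 * T 0 * T 1) := by
    have := mul_pole T (show 1 < k by omega)
    simp only [murphyOf, zero_add, ← mul_assoc, this]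
  have h3 := D.pole_mul_E_succ h (j := 1) le_rfl (by omega)
  have h4 := D.E_pole_E h (j := 2) (by omega) (by omega)
  have h5 := (D.commute_pole_E h (i := 1) (j := 3) le_rfl (by omega)).eq
  have h6 := (D.commute_pole_E h (i := 0) (j := 2) le_rfl (by omega)).eq
  have h02 := D.comm 0 2 le_rfl (by omega)
  have h7 := D.down 1 le_rfl (by omega)
  simp only [Nat.reduceAdd] at h3 h4 h5 h6 h7
  -- Here `pole_mul_E_succ` is read backwards: `E 2 * E 1`, the pole at 3 and `E 2` recombine into
  -- the pole at 1 times `E 2`.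
  have e1 : E 2 * ((pole k T 2 : Aˣ) * (E 1 * E 2)) =
      (s ^ 2 * (y - y⁻¹)) • E 2 - s ^ 2 • ((pole k T 1 : Aˣ) * E 2) := by
    rw [val_pole_eq T (show 2 < k by omega)]
    simp only [mul_assoc, mul_mul_left_of_eq (D.bar.E_mul_T (i := 2) (by omega) (by omega)),
      smul_mul_assoc]
    rw [D.T_mid 2 (by omega) (by omega)]
    simp only [add_mul, mul_add, h7, h4, smul_mul_assoc, mul_smul_comm, one_mul, Nat.reduceAdd]
    rw [mul_mul_left_of_eq h5, mul_assoc, ← h3]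
    match_scalars <;> (field_simp; try ring)
  have e2 : E 2 * ((pole k T 2 : Aˣ) * E 2) = (-s * (y - y⁻¹)) • E 2 := by
    rw [val_pole_eq T (show 2 < k by omega)]
    simp only [mul_assoc, mul_mul_left_of_eq (D.bar.E_mul_T (i := 2) (by omega) (by omega)),
      smul_mul_assoc, D.T_mul_E (i := 2) (by omega) (by omega), mul_smul_comm, Nat.reduceAdd, h4]
    match_scalars; field_simp
  have e3 : E 2 * ((pole k T 2 : Aˣ) * (E 0 * (E 1 * (E 0 * E 2)))) =
      E 0 * ((E 2 * ((pole k T 2 : Aˣ) * (E 1 * E 2))) * E 0) := by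
    generalize ((pole k T 2 : Aˣ) : A) = V at *
    clear * - h02 h6
    grind
  rw [← h02, h2]
  simp only [Units.val_mul] at h1 ⊢
  rw [mul_assoc, mul_mul_left_of_eq h1]
  simp only [sub_mul, smul_mul_assoc, mul_assoc, mul_sub, mul_smul_comm, e3, e1]
  simp only [h02, e2, mul_mul_left_of_eq h02, smul_mul_assoc, mul_smul_comm, mul_sub, sub_mul,
    mul_mul_mul_left_of_eq e2, mul_assoc, add_mul, D.sq_zero, smul_sub, smul_add]
  simp only [← h02, ← mul_assoc, D.sq_zero, smul_mul_assoc]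
  match_scalars <;> (field_simp; try ring)

theorem E_two_murphy_inv_E_two (h : BraidC k T) (hk : 3 ≤ k) :
    E 2 * (((murphyOf k T 1)⁻¹ : Aˣ) * (E 2 * E 0)) =
      (-s⁻¹ ^ 3) • ((E 0 * ((pole k T 1 : Aˣ) * E 0) + (x * (y - y⁻¹)) • E 0) * E 2) := by
  have hs := D.s_ne
  have hx := D.x_ne
  have h1 := D.bar.strand_zero_mul_E (by omega)
  have h2 : (murphyOf k T 1 : Aˣ)⁻¹ = (T 1)⁻¹ * (T 0)⁻¹ * (T 1)⁻¹ * (pole k T 2)⁻¹ := by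
    rw [← mul_inv_rev, ← mul_inv_rev, ← mul_inv_rev]
    have := mul_pole T (show 1 < k by omega)
    simp only [murphyOf, zero_add, ← mul_assoc, this]
  have h3 := D.pole_mul_E_succ h (j := 1) le_rfl (by omega)
  have h4 := D.E_pole_E h (j := 2) (by omega) (by omega)
  have h6 := (D.commute_pole_E h (i := 0) (j := 2) le_rfl (by omega)).units_inv_left.eq
  have h02 := D.comm 0 2 le_rfl (by omega)
  have h7 := D.down 1 le_rfl (by omega)
  have h8 := D.sq_mid 2 (by omega) (by omega)
  have h9 : (((pole k T 2)⁻¹ : Aˣ) : A) = (((T 2)⁻¹ : Aˣ) : A) * ((pole k T 3)⁻¹ : Aˣ) * T 2 := by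
    rw [pole_eq T (show 2 < k by omega)]
    simp only [mul_inv_rev, inv_inv, Units.val_mul, mul_assoc]
  simp only [Nat.reduceAdd] at h3 h4 h6 h7
  have e1 : E 2 * (E 1 * (((pole k T 2)⁻¹ : Aˣ) * E 2)) = (-s⁻¹ ^ 2) • ((pole k T 1 : Aˣ) * E 2) := by
    rw [h9, D.val_pole_inv (show 3 ≤ k by omega), D.T_mid_inv 2 (by omega) (by omega)]
    simp only [mul_assoc, D.T_mul_E (i := 2) (by omega) (by omega), smul_mul_assoc,
      mul_smul_comm, add_mul, mul_add, sub_mul, mul_sub, one_mul, smul_sub, smul_add,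
      mul_mul_mul_left_of_eq h7, h4, h7, ← h3, h8]
    match_scalars <;> (field_simp; try ring)
  have e2 : E 2 * (((pole k T 2)⁻¹ : Aˣ) * E 2) = (s⁻¹ * (y - y⁻¹)) • E 2 := by
    rw [h9, D.val_pole_inv (show 3 ≤ k by omega)]
    simp only [mul_assoc, mul_mul_left_of_eq (D.bar.E_mul_T (i := 2) (by omega) (by omega)),
      smul_mul_assoc, D.T_mul_E (i := 2) (by omega) (by omega), mul_smul_comm, mul_sub, sub_mul,
      one_mul, h4, h8, smul_sub]
    match_scalars <;> (field_simp; try ring)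
  have e3 : E 2 * (E 0 * (E 1 * (E 0 * (((pole k T 2)⁻¹ : Aˣ) * E 2)))) =
      E 0 * ((E 2 * (E 1 * (((pole k T 2)⁻¹ : Aˣ) * E 2))) * E 0) := by
    generalize (((pole k T 2)⁻¹ : Aˣ) : A) = V at *
    clear * - h02 h6
    grind
  rw [← h02, h2]
  simp only [Units.val_mul] at h1 ⊢
  rw [mul_assoc _ _ (E 0 * E 2), mul_mul_left_of_eq h6, mul_assoc (E 0), mul_mul_left_of_eq h1]
  simp only [sub_mul, smul_mul_assoc, mul_assoc, mul_sub, mul_smul_comm, e3, e1]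
  simp only [mul_mul_left_of_eq h02.symm, mul_assoc, e2, smul_mul_assoc, mul_smul_comm,
    add_mul, smul_add]
  simp only [← h02]
  match_scalars <;> (field_simp; try ring)

end TLData

end TemperleyLieb

/-! ### Rows of mutually commuting caps -/

section TemperleyLieb

variable {A : Type*} [Ring A]

/-- `row E a n = E_a E_{a+2} ⋯ E_{a+2n-2}`. -/
def row (E : ℕ → A) (a n : ℕ) : A := ((List.range n).map fun j => E (a + 2 * j)).prod

theorem row_zero (E : ℕ → A) (a : ℕ) : row E a 0 = 1 := by simp [row]

theorem row_succ (E : ℕ → A) (a n : ℕ) : row E a (n + 1) = row E a n * E (a + 2 * n) := by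
  simp [row, List.range_succ]

theorem row_add (E : ℕ → A) (a m n : ℕ) :
    row E a (m + n) = row E a m * row E (a + 2 * m) n := by
  induction n with
  | zero => simp [row_zero]
  | succ n ih =>
    rw [← add_assoc, row_succ, row_succ, ih, mul_assoc]
    ring_nf

theorem row_one (E : ℕ → A) (a : ℕ) : row E a 1 = E a := by simp [row]

theorem row_succ' (E : ℕ → A) (a n : ℕ) : row E a (n + 1) = E a * row E (a + 2) n := by
  rw [add_comm n 1, row_add, row_one]

theorem commute_row {E : ℕ → A} {u : A} {a n : ℕ} (h : ∀ j < n, Commute u (E (a + 2 * j))) :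
    Commute u (row E a n) := by
  induction n with
  | zero => rw [row_zero]; exact Commute.one_right u
  | succ n ih =>
    rw [row_succ]
    exact (ih fun j hj => h j (by omega)).mul_right (h n (by omega))

namespace TLData

variable [Algebra ℂ A] {k : ℕ} {s x y : ℂ} {T : ℕ → Aˣ} {E : ℕ → A} (D : TLData k s x y T E)

include D

theorem commute_E_row {i a n : ℕ} (hi : i ≤ k) (hn : a + 2 * n ≤ k + 2)
    (H : i + 2 ≤ a ∨ a + 2 * n ≤ i ∨ ∃ j, i = a + 2 * j) : Commute (E i) (row E a n) := by
  refine commute_row fun j hj => ?_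
  -- In each case i differs from every index of the row by 0 or by at least 2.
  have H' : i + 2 ≤ a ∨ a + 2 * n ≤ i ∨ i % 2 = a % 2 := by
    rcases H with H | H | ⟨l, hl⟩ <;> omega
  clear H
  by_cases hij : i = a + 2 * j
  · rw [hij]
  · exact D.commute_E (by omega) hi (by omega)

/-- Peel off the leftmost cap: `E a` commutes with the whole middle row except `E (a + 1)`, so one
zigzag straightens at a time. -/
theorem row_zig {a n : ℕ} (ha : 1 ≤ a) (hn : a + 2 * n ≤ k) :
    row E a n * (row E (a + 1) n * row E a n) = row E a n := by
  induction n generalizing a with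
  | zero => simp [row_zero]
  | succ n ih =>
    have h1 := ih (a := a + 2) (by omega) (by omega)
    have h2 := D.up a ha (by omega)
    have h3 := (D.commute_E_row (i := a) (a := a + 3) (n := n) (by omega) (by omega)
      (by omega)).eq
    have h4 := (D.commute_E_row (i := a) (a := a + 2) (n := n) (by omega) (by omega)
      (by omega)).eq
    rw [row_succ', row_succ', show a + 1 + 2 = a + 3 by omega]
    rw [show a + 2 + 1 = a + 3 by omega] at h1
    generalize row E (a + 2) n = r at *
    generalize row E (a + 3) n = r' at *
    calc E a * r * (E (a + 1) * r' * (E a * r))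
        = (E a * r) * E (a + 1) * (r' * E a) * r := by simp only [mul_assoc]
      _ = r * (E a * (E (a + 1) * E a)) * r' * r := by rw [← h3, h4]; simp only [mul_assoc]
      _ = E a * (r * (r' * r)) := by rw [h2, ← h4]; simp only [mul_assoc]
      _ = _ := by rw [h1]

/-- Here it is the rightmost cap that meets only one member of the middle row. -/
theorem row_zag {a n : ℕ} (ha : 1 ≤ a) (hn : a + 2 * n ≤ k) :
    row E (a + 1) n * (row E a n * row E (a + 1) n) = row E (a + 1) n := by
  induction n with
  | zero => simp [row_zero]
  | succ n ih =>
    have h1 := ih (by omega)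
    have h2 := D.down (a + 2 * n) (by omega) (by omega)
    have h3 := (D.commute_E_row (i := a + 1 + 2 * n) (a := a) (n := n) (by omega) (by omega)
      (by omega)).eq
    have h4 := (D.commute_E_row (i := a + 1 + 2 * n) (a := a + 1) (n := n) (by omega) (by omega)
      (by omega)).eq
    rw [row_succ, row_succ]
    rw [show a + 2 * n + 1 = a + 1 + 2 * n by omega] at h2
    generalize row E (a + 1) n = r at *
    generalize row E a n = r' at *
    generalize E (a + 1 + 2 * n) = f at *
    generalize E (a + 2 * n) = g at *
    calc r * f * (r' * g * (r * f)) = r * (f * r') * g * (r * f) := by simp only [mul_assoc]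
      _ = r * r' * (f * (g * f)) * r := by rw [h3, ← h4]; simp only [mul_assoc]
      _ = r * r' * (f * r) := by rw [h2]; simp only [mul_assoc]
      _ = r * (r' * r) * f := by rw [h4]; simp only [mul_assoc]
      _ = r * f := by rw [h1]

/-- All zigzags straighten except the one at `E 0`, where the left boundary relation yields the
scalar. -/
theorem row_zag_left {n : ℕ} (h1n : 1 ≤ n) (hn : 2 * n ≤ k) :
    row E 1 n * (row E 0 n * row E 1 n) = (x * s⁻¹ + x⁻¹ * s) • row E 1 n := by
  obtain ⟨m, rfl⟩ : ∃ m, n = m + 1 := ⟨n - 1, by omega⟩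
  have h1 := D.row_zag (a := 2) (n := m) (by omega) (by omega)
  have h2 := D.left (by omega)
  have h3 := (D.commute_E_row (i := 1) (a := 3) (n := m) (by omega) (by omega) (by omega)).eq
  have h4 := (D.commute_E_row (i := 0) (a := 3) (n := m) (by omega) (by omega) (by omega)).eq
  simp only [row_succ', zero_add, Nat.reduceAdd] at h1 ⊢
  generalize row E 3 m = r at *
  generalize row E 2 m = r' at *
  calc E 1 * r * (E 0 * r' * (E 1 * r)) = E 1 * (r * E 0) * r' * (E 1 * r) := by
        simp only [mul_assoc]
    _ = E 1 * E 0 * (r * (r' * r)) * E 1 := by rw [← h4, h3]; simp only [mul_assoc]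
    _ = E 1 * E 0 * (r * E 1) := by rw [h1]; simp only [mul_assoc]
    _ = (E 1 * (E 0 * E 1)) * r := by rw [← h3]; simp only [mul_assoc]
    _ = _ := by rw [h2, smul_mul_assoc]

/-- Iterated `strand_mul_E`. -/
theorem strand_mul_row {a n : ℕ} (ha : 1 ≤ a) (hn : a + 2 * n ≤ k) {V : ℕ → A}
    (hV : ∀ j, a ≤ j → j < k → V (j + 1) = T j * V j * T j)
    (hVE : ∀ j i, a ≤ j → j < i → i < k → Commute (V j) (E i)) :
    V (a + 2 * n) * row E a n =
      (s ^ 2) ^ n • (row E a n * (row E (a + 1) n * (V a * row E a n))) := by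
  induction n with
  | zero => simp [row_zero]
  | succ n ih =>
    have h1 := ih (by omega)
    have h2 := D.strand_mul_E (i := a + 2 * n) (by omega) (by omega)
      (hVE (a + 2 * n) (a + 2 * n + 1) (by omega) (by omega) (by omega))
    have h3 := (D.commute_E_row (i := a + 2 * n) (a := a) (n := n) (by omega) (by omega)
      (by omega)).eq
    have h4 := (D.commute_E_row (i := a + 1 + 2 * n) (a := a) (n := n) (by omega) (by omega)
      (by omega)).eq
    have h5 := (D.commute_E_row (i := a + 1 + 2 * n) (a := a + 1) (n := n) (by omega) (by omega)
      (by omega)).eq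
    rw [show a + 2 * (n + 1) = a + 2 * n + 1 + 1 by ring, hV (a + 2 * n + 1) (by omega) (by omega),
      hV (a + 2 * n) (by omega) (by omega)]
    rw [show a + 2 * n + 1 = a + 1 + 2 * n by ring] at *
    simp only [row_succ]
    generalize row E a n = r at *
    generalize row E (a + 1) n = r' at *
    generalize E (a + 2 * n) = g at *
    generalize E (a + 1 + 2 * n) = f at *
    generalize (T (a + 1 + 2 * n) : A) * (T (a + 2 * n) * V (a + 2 * n) * T (a + 2 * n)) *
      T (a + 1 + 2 * n) = U at *
    generalize V (a + 2 * n) = u at *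
    generalize V a = v at *
    calc U * (r * g) = (U * g) * r := by rw [← h3, mul_assoc]
      _ = s ^ 2 • (g * f * u * (g * r)) := by rw [h2, smul_mul_assoc]; simp only [mul_assoc]
      _ = s ^ 2 • (g * f * (u * r) * g) := by rw [h3]; simp only [mul_assoc]
      _ = (s ^ 2) ^ (n + 1) • (g * (f * r) * r' * v * r * g) := by
        rw [h1, pow_succ' (s ^ 2)]
        simp only [mul_smul_comm, smul_mul_assoc, smul_smul, mul_assoc]
      _ = (s ^ 2) ^ (n + 1) • ((g * r) * (f * r') * v * r * g) := by
        rw [h4]; simp only [mul_assoc]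
      _ = _ := by rw [h3, h5]; simp only [mul_assoc]

/-- Iterated `pole_mul_E_succ`. -/
theorem pole_mul_row (h : BraidC k T) {j n : ℕ} (hj : 1 ≤ j) (hn : j + 2 * n ≤ k) :
    ((pole k T j : Aˣ) : A) * row E (j + 1) n =
      row E (j + 1) n * (row E j n * ((pole k T (j + 2 * n) : Aˣ) * row E (j + 1) n)) := by
  induction n with
  | zero => simp [row_zero]
  | succ n ih =>
    have h1 := ih (by omega)
    have h2 := D.pole_mul_E_succ h (j := j + 2 * n) (by omega) (by omega)
    have h3 := (D.commute_E_row (i := j + 1 + 2 * n) (a := j + 1) (n := n) (by omega) (by omega)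
      (by omega)).eq
    have h4 := (D.commute_E_row (i := j + 1 + 2 * n) (a := j) (n := n) (by omega) (by omega)
      (by omega)).eq
    rw [show j + 2 * n + 1 = j + 1 + 2 * n by ring,
      show j + 2 * n + 2 = j + 2 * (n + 1) by ring] at h2
    simp only [row_succ]
    generalize row E j n = r' at *
    generalize row E (j + 1) n = r at *
    generalize E (j + 2 * n) = g at *
    generalize E (j + 1 + 2 * n) = f at *
    generalize ((pole k T j : Aˣ) : A) = p at *
    generalize ((pole k T (j + 2 * n) : Aˣ) : A) = p' at *
    generalize ((pole k T (j + 2 * (n + 1)) : Aˣ) : A) = p'' at *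
    calc p * (r * f) = (p * r) * f := by rw [mul_assoc]
      _ = r * r' * p' * (r * f) := by rw [h1]; simp only [mul_assoc]
      _ = r * r' * (p' * f) * r := by rw [← h3]; simp only [mul_assoc]
      _ = r * (r' * f) * g * p'' * (f * r) := by rw [h2]; simp only [mul_assoc]
      _ = _ := by rw [← h4, h3]; simp only [mul_assoc]

/-- The last cap merges the two strand elements into one loop, `strand_mul_row` slides the loop to
position a with factor s² per cap, and the zigzag left behind collapses by `row_zag`. For abstract
`V` this covers Murphy elements and, through `bar`, their inverses. -/
theorem strand_pair_mul_row {a m : ℕ} (ha : 1 ≤ a) (hm : a + 2 * m + 1 ≤ k) {V : ℕ → A}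
    (hV : ∀ j, a ≤ j → j < k → V (j + 1) = T j * V j * T j)
    (hVE : ∀ j i, a ≤ j → j < i → i < k → Commute (V j) (E i)) :
    (V (a + 2 * m) + V (a + 2 * m + 1)) * row E a (m + 1) =
      (-s⁻¹ * (s ^ 2) ^ m) • (E a * (V a * (E a * row E (a + 2) m))) := by
  have h1 := conj_pair_mul D.s_ne (D.T_mid (a + 2 * m) (by omega) (by omega))
    (D.sq_mid (a + 2 * m) (by omega) (by omega)) (V (a + 2 * m))
  have h2 := D.strand_mul_row ha (show a + 2 * m ≤ k by omega) hV hVE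
  have h3 := (D.commute_E_row (i := a + 2 * m) (a := a) (n := m) (by omega) (by omega)
    (by omega)).eq
  have h4 : Commute (V a) (row E (a + 2) m) :=
    commute_row fun j hj => hVE _ _ le_rfl (by omega) (by omega)
  have h5 := (D.commute_E_row (i := a) (a := a + 2) (n := m) (by omega) (by omega)
    (by omega)).eq
  have h6 := D.row_zag (a := a + 1) (n := m) (by omega) (by omega)
  have h7 : row E a m * E (a + 2 * m) = E a * row E (a + 2) m := by
    rw [← row_succ, row_succ']
  rw [hV (a + 2 * m) (by omega) (by omega), row_succ]
  rw [show a + 1 + 1 = a + 2 by ring] at h6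
  generalize row E (a + 2) m = r at *
  generalize row E (a + 1) m = r' at *
  generalize E (a + 2 * m) = g at *
  generalize (T (a + 2 * m) : A) * V (a + 2 * m) * T (a + 2 * m) = U at *
  generalize V (a + 2 * m) = u at *
  calc (u + U) * (row E a m * g) = ((u + U) * g) * row E a m := by rw [← h3, mul_assoc]
    _ = (-s⁻¹) • (g * u * (g * row E a m)) := by
      rw [h1, smul_mul_assoc]; simp only [mul_assoc]
    _ = (-s⁻¹) • (g * (u * row E a m) * g) := by rw [h3]; simp only [mul_assoc]
    _ = (-s⁻¹ * (s ^ 2) ^ m) • ((g * row E a m) * r' * V a * (row E a m * g)) := by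
      rw [h2]
      simp only [mul_smul_comm, smul_mul_assoc, smul_smul, mul_assoc]
    _ = (-s⁻¹ * (s ^ 2) ^ m) • (E a * r * r' * V a * (E a * r)) := by rw [h3, h7]
    _ = (-s⁻¹ * (s ^ 2) ^ m) • (E a * r * r' * (V a * r) * E a) := by
      rw [h5]; simp only [mul_assoc]
    _ = (-s⁻¹ * (s ^ 2) ^ m) • (E a * (r * (r' * r)) * V a * E a) := by
      rw [h4.eq]; simp only [mul_assoc]
    _ = (-s⁻¹ * (s ^ 2) ^ m) • (E a * (V a * (r * E a))) := by
      rw [h6, mul_assoc (E a) r, ← h4.eq]; simp only [mul_assoc]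
    _ = _ := by rw [← h5]

end TLData

end TemperleyLieb

/-! ### Quantum integers and sums over pairs -/

section Quantum

/-- The quantum integer `s^{k-1} + s^{k-3} + ⋯ + s^{1-k}`. -/
def quantumInt (s : ℂ) (k : ℕ) : ℂ := ∑ i ∈ Finset.range k, s ^ ((k : ℤ) - 1 - 2 * (i : ℤ))

/-- This and `quantumInt_succ'` are the two recursions that cancel the cross terms of the last
strand. -/
theorem quantumInt_succ {s : ℂ} (hs : s ≠ 0) (k : ℕ) :
    quantumInt s (k + 1) = s * quantumInt s k + s⁻¹ ^ k := by
  rw [quantumInt, Finset.sum_range_succ, quantumInt, Finset.mul_sum]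
  congr 1
  · refine Finset.sum_congr rfl fun i _ => ?_
    rw [← zpow_one_add₀ hs]
    congr 1; push_cast; ring
  · rw [inv_pow, ← zpow_natCast, ← zpow_neg]
    congr 1; push_cast; ring

theorem quantumInt_succ' {s : ℂ} (hs : s ≠ 0) (k : ℕ) :
    quantumInt s (k + 1) = s⁻¹ * quantumInt s k + s ^ k := by
  rw [quantumInt, Finset.sum_range_succ', quantumInt, Finset.mul_sum]
  congr 1
  · refine Finset.sum_congr rfl fun i _ => ?_
    rw [← zpow_neg_one, ← zpow_add₀ hs]
    congr 1; push_cast; ring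
  · rw [← zpow_natCast]
    congr 1; push_cast; ring

theorem quantumInt_add_two {s : ℂ} (hs : s ≠ 0) (k : ℕ) :
    quantumInt s (k + 2) = quantumInt s k + (s ^ (k + 1) + s⁻¹ ^ (k + 1)) := by
  rw [quantumInt_succ hs, quantumInt_succ' hs, mul_add, mul_inv_cancel_left₀ hs]
  ring

/-- The summands are the coefficients of the successive pairs of strands in `pair_sum_mul_row_one`;
those of `quantumInt_odd` come from `pair_sum_mul_row_zero`, with 1 for the strand on the wall. -/
theorem quantumInt_even {s : ℂ} (hs : s ≠ 0) (n : ℕ) :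
    ∑ m ∈ Finset.range n, (s * (s ^ 2) ^ m + s⁻¹ * (s⁻¹ ^ 2) ^ m) = quantumInt s (2 * n) := by
  induction n with
  | zero => simp [quantumInt]
  | succ n ih =>
    rw [Finset.sum_range_succ, ih, mul_add, mul_one, quantumInt_add_two hs]
    ring

theorem quantumInt_odd {s : ℂ} (hs : s ≠ 0) (n : ℕ) :
    1 + ∑ m ∈ Finset.range n, (s ^ 2 * (s ^ 2) ^ m + s⁻¹ ^ 2 * (s⁻¹ ^ 2) ^ m) =
      quantumInt s (2 * n + 1) := by
  induction n with
  | zero => simp [quantumInt]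
  | succ n ih =>
    rw [Finset.sum_range_succ, ← add_assoc, ih,
      show 2 * (n + 1) + 1 = 2 * n + 1 + 2 by ring, quantumInt_add_two hs]
    ring

theorem sum_range_pairs {M : Type*} [AddCommMonoid M] (f : ℕ → M) (n : ℕ) :
    ∑ j ∈ Finset.range (2 * n), f j = ∑ m ∈ Finset.range n, (f (2 * m) + f (2 * m + 1)) := by
  induction n with
  | zero => simp
  | succ n ih =>
    rw [mul_add, mul_one, Finset.sum_range_succ, Finset.sum_range_succ, ih,
      Finset.sum_range_succ, add_assoc]

theorem sum_range_pairs_succ {M : Type*} [AddCommMonoid M] (f : ℕ → M) (n : ℕ) :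
    ∑ j ∈ Finset.range (2 * n + 1), f j =
      f 0 + ∑ m ∈ Finset.range n, (f (2 * m + 1) + f (2 * m + 2)) := by
  rw [Finset.sum_range_succ', sum_range_pairs, add_comm]

end Quantum

/-! ### Sums of Murphy elements over paired strands -/

section TemperleyLieb

variable {A : Type*} [Ring A] [Algebra ℂ A]

theorem val_murphy_succ {A : Type*} [Ring A] (k : ℕ) (T : ℕ → Aˣ) (j : ℕ) : ((murphyOf k T (j + 1) : Aˣ) : A) =
    T (j + 1) * (murphyOf k T j : Aˣ) * T (j + 1) := by
  simp only [murphyOf, Units.val_mul]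

theorem val_murphy_succ_inv {A : Type*} [Ring A] (k : ℕ) (T : ℕ → Aˣ) (j : ℕ) : (((murphyOf k T (j + 1))⁻¹ : Aˣ) : A) =
    (((T (j + 1))⁻¹ : Aˣ) : A) * ((murphyOf k T j)⁻¹ : Aˣ) * ((T (j + 1))⁻¹ : Aˣ) := by
  simp only [murphyOf, mul_inv_rev, Units.val_mul, mul_assoc]

/-- The contribution of the first pair of strands, when these are joined by `E 1`. -/
def pairLoop (k : ℕ) (s x y : ℂ) (T : ℕ → Aˣ) (E : ℕ → A) : A :=
  E 1 * ((pole k T 2 : Aˣ) * (E 0 * E 1)) - (s * x⁻¹ * (y - y⁻¹)) • E 1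

/-- The contribution of the first strand, when it is attached to the left boundary by `E 0`. -/
def startLoop (k : ℕ) (x y : ℂ) (T : ℕ → Aˣ) (E : ℕ → A) : A :=
  E 0 * ((pole k T 1 : Aˣ) * E 0) + (x * (y - y⁻¹)) • E 0

namespace TLData

variable {k : ℕ} {s x y : ℂ} {T : ℕ → Aˣ} {E : ℕ → A} (D : TLData k s x y T E)

include D

theorem commute_murphy_E (h : BraidC k T) {i j : ℕ} (hij : j + 1 < i) (hik : i < k) :
    Commute ((murphyOf k T j : Aˣ) : A) (E i) :=
  D.commute_E_of_commute_T hik.le (commute_val (h.murphy_comm_high hij hik)).symm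

theorem murphy_pair_mul_row (h : BraidC k T) {a m : ℕ} (hm : a + 2 * m + 2 ≤ k) :
    (((murphyOf k T (a + 2 * m) : Aˣ) : A) + (murphyOf k T (a + 2 * m + 1) : Aˣ)) *
        row E (a + 1) (m + 1) =
      (-s⁻¹ * (s ^ 2) ^ m) •
        (E (a + 1) * ((murphyOf k T a : Aˣ) * (E (a + 1) * row E (a + 3) m))) := by
  have := D.strand_pair_mul_row (a := a + 1) (m := m) (by omega) (by omega)
    -- The shift matches the recursion V(j + 1) = T_j V(j) T_j, since `murphyOf k T j` is W_{j+1}.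
    (V := fun j => (murphyOf k T (j - 1) : Aˣ)) ?_ ?_
  · rw [show a + 1 + 2 * m - 1 = a + 2 * m by omega] at this
    rw [show a + 1 + 2 * m + 1 - 1 = a + 2 * m + 1 by omega] at this
    exact this
  · intro j hj hjk
    obtain ⟨i, rfl⟩ : ∃ i, j = i + 1 := ⟨j - 1, by omega⟩
    exact val_murphy_succ k T i
  · intro j i hj hji hik
    exact D.commute_murphy_E h (by omega) hik

theorem murphy_inv_pair_mul_row (h : BraidC k T) {a m : ℕ} (hm : a + 2 * m + 2 ≤ k) :
    ((((murphyOf k T (a + 2 * m))⁻¹ : Aˣ) : A) + ((murphyOf k T (a + 2 * m + 1))⁻¹ : Aˣ)) *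
        row E (a + 1) (m + 1) =
      (-s * (s⁻¹ ^ 2) ^ m) •
        (E (a + 1) * (((murphyOf k T a)⁻¹ : Aˣ) * (E (a + 1) * row E (a + 3) m))) := by
  have := D.bar.strand_pair_mul_row (a := a + 1) (m := m) (by omega) (by omega)
    (V := fun j => ((murphyOf k T (j - 1))⁻¹ : Aˣ)) ?_ ?_
  · rw [show a + 1 + 2 * m - 1 = a + 2 * m by omega] at this
    rw [show a + 1 + 2 * m + 1 - 1 = a + 2 * m + 1 by omega, inv_inv] at this
    exact this
  · intro j hj hjk
    obtain ⟨i, rfl⟩ : ∃ i, j = i + 1 := ⟨j - 1, by omega⟩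
    exact val_murphy_succ_inv k T i
  · intro j i hj hji hik
    exact (D.commute_murphy_E h (by omega) hik).units_inv_left

/-- Sliding costs -s⁻¹s^{2m} and the first pair -s², together s^{2m+1}; the inverses give the
reciprocal power. -/
theorem pair_sum_mul_row_one (h : BraidC k T) {m : ℕ} (hm : 2 * m + 2 ≤ k) :
    (((murphyOf k T (2 * m) : Aˣ) : A) + ((murphyOf k T (2 * m))⁻¹ : Aˣ) +
      ((murphyOf k T (2 * m + 1) : Aˣ) + ((murphyOf k T (2 * m + 1))⁻¹ : Aˣ))) *
        row E 1 (m + 1) =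
      (s * (s ^ 2) ^ m + s⁻¹ * (s⁻¹ ^ 2) ^ m) • (pairLoop k s x y T E * row E 3 m) := by
  have hs := D.s_ne
  have h1 := D.murphy_pair_mul_row h (a := 0) (m := m) (by omega)
  have h2 := D.murphy_inv_pair_mul_row h (a := 0) (m := m) (by omega)
  simp only [zero_add, mul_mul_mul_left_of_eq (D.E_one_murphy_E_one h (by omega)),
    mul_mul_mul_left_of_eq (D.E_one_murphy_inv_E_one h (by omega))] at h1 h2
  rw [add_add_add_comm, add_mul, h1, h2, pairLoop]
  simp only [smul_mul_assoc]
  match_scalars <;> (field_simp; try ring)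

theorem pair_sum_mul_row_zero (h : BraidC k T) {m : ℕ} (hm : 2 * m + 3 ≤ k) :
    (((murphyOf k T (2 * m + 1) : Aˣ) : A) + ((murphyOf k T (2 * m + 1))⁻¹ : Aˣ) +
      ((murphyOf k T (2 * m + 2) : Aˣ) + ((murphyOf k T (2 * m + 2))⁻¹ : Aˣ))) *
        row E 0 (m + 2) =
      (s ^ 2 * (s ^ 2) ^ m + s⁻¹ ^ 2 * (s⁻¹ ^ 2) ^ m) •
        (startLoop k x y T E * row E 2 (m + 1)) := by
  have hs := D.s_ne
  have h1 := D.murphy_pair_mul_row h (a := 1) (m := m) (by omega)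
  have h2 := D.murphy_inv_pair_mul_row h (a := 1) (m := m) (by omega)
  have h3 := (D.commute_E_row (i := 0) (a := 2) (n := m + 1) (by omega) (by omega)
    (by omega)).eq
  have h4 := (D.commute_E_row (i := 0) (a := 4) (n := m) (by omega) (by omega) (by omega)).eq
  have h5 : E 0 * row E 2 (m + 1) = E 2 * (E 0 * row E 4 m) := by
    rw [h3, h4, row_succ', mul_assoc]
  have e1 := D.E_two_murphy_E_two h (by omega)
  have e2 := D.E_two_murphy_inv_E_two h (by omega)
  simp only [Nat.reduceAdd, show 1 + 2 * m = 2 * m + 1 by ring] at h1 h2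
  rw [row_succ', add_add_add_comm, add_mul, h3, mul_mul_left_of_eq h1,
    mul_mul_left_of_eq h2]
  have e3 : ∀ V : A, E 2 * (V * (E 2 * row E 4 m)) * E 0 = (E 2 * (V * (E 2 * E 0))) * row E 4 m :=
    fun V => by simp only [mul_assoc, h4]
  rw [smul_mul_assoc, smul_mul_assoc, e3, e3, e1, e2, ← startLoop, row_succ']
  simp only [smul_mul_assoc, mul_assoc, Nat.reduceAdd]
  match_scalars
  field_simp

/-- The strands `1, …, 2N` paired by `E 1, E 3, …`. -/
theorem sum_mul_row_one (h : BraidC k T) {N M : ℕ} (hN : 2 * N ≤ k) (hM : N ≤ M) (hM' : 1 ≤ M) :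
    (∑ j ∈ Finset.range (2 * N), (((murphyOf k T j : Aˣ) : A) + ((murphyOf k T j)⁻¹ : Aˣ))) *
      row E 1 M = quantumInt s (2 * N) • (pairLoop k s x y T E * row E 3 (M - 1)) := by
  rw [sum_range_pairs, Finset.sum_mul, ← quantumInt_even D.s_ne, Finset.sum_smul]
  refine Finset.sum_congr rfl fun m hm => ?_
  rw [Finset.mem_range] at hm
  -- The l caps to the right of the current pair are spectators.
  obtain ⟨l, rfl⟩ : ∃ l, M = m + 1 + l := ⟨M - (m + 1), by omega⟩
  rw [row_add, ← mul_assoc, D.pair_sum_mul_row_one h (by omega), smul_mul_assoc, mul_assoc,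
    show m + 1 + l - 1 = m + l by omega, row_add, show 1 + 2 * (m + 1) = 3 + 2 * m by ring]

/-- The strand `1` attached to the left boundary and the strands `2, …, 2N+1` paired by
`E 2, E 4, …`. -/
theorem sum_mul_row_zero (h : BraidC k T) {N M : ℕ} (hN : 2 * N + 1 ≤ k) (hM : N ≤ M) :
    (∑ j ∈ Finset.range (2 * N + 1),
      (((murphyOf k T j : Aˣ) : A) + ((murphyOf k T j)⁻¹ : Aˣ))) * row E 0 (M + 1) =
        quantumInt s (2 * N + 1) • (startLoop k x y T E * row E 2 M) := by
  rw [sum_range_pairs_succ, add_mul, Finset.sum_mul, ← quantumInt_odd D.s_ne, add_smul, one_smul,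
    Finset.sum_smul]
  congr 1
  · rw [row_succ', ← mul_assoc, add_mul, D.murphy_zero_add_inv_mul_E_zero (by omega), startLoop]
  · refine Finset.sum_congr rfl fun m hm => ?_
    rw [Finset.mem_range] at hm
    obtain ⟨l, rfl⟩ : ∃ l, M = m + 1 + l := ⟨M - (m + 1), by omega⟩
    rw [show m + 1 + l + 1 = m + 2 + l by ring, row_add, ← mul_assoc,
      D.pair_sum_mul_row_zero h (by omega), smul_mul_assoc, mul_assoc,
      row_add E 2 (m + 1) l, show 0 + 2 * (m + 2) = 2 + 2 * (m + 1) by ring]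

end TLData

end TemperleyLieb

/-! ### Factoring a Murphy element into a pole and a strand -/

section Strand

variable {G : Type*} [Group G]

/-- `strand T j = T_j ⋯ T_1 T_0 T_1 ⋯ T_j`. -/
def strand (T : ℕ → G) : ℕ → G
  | 0 => T 0
  | j + 1 => T (j + 1) * strand T j * T (j + 1)

theorem strand_inv (T : ℕ → G) (j : ℕ) : strand (fun i => (T i)⁻¹) j = (strand T j)⁻¹ := by
  induction j with
  | zero => rfl
  | succ j ih => simp only [strand, ih, mul_inv_rev, mul_assoc]

theorem murphyOf_eq_pole_mul_strand {k j : ℕ} (T : ℕ → G) (hj : j < k) :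
    murphyOf k T j = pole k T (j + 1) * strand T j := by
  induction j with
  | zero => rfl
  | succ j ih =>
    have h1 := mul_pole T (j := j + 1) (k := k) hj
    rw [murphyOf, ih (by omega), strand, ← mul_assoc, h1]
    simp only [mul_assoc]

end Strand

/-! ### The last strand, attached to the right wall -/

section TemperleyLieb

variable {A : Type*} [Ring A] [Algebra ℂ A]

/-- Used with g = `E k`, f = `E (k - 1)`, P the pole at k - 1, and r, m two rows: it evaluates the
loop of the paired strands in the presence of the right wall. The term r(mf)rg is unwanted and
cancels against the one in `end_strand`. -/
theorem end_loop {s y γ : ℂ} {r m f g P : A} (hgr : g * r = r * g) (hgm : g * m = m * g)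
    (hP : P * g = (-y * (s - s⁻¹)) • (f * g) + s⁻¹ • (g * (f * g)) - y⁻¹ • g)
    (hγ : r * (m * r) = γ • r) :
    r * (m * (P * (r * g))) = s⁻¹ • ((r * g) * ((m * f) * (r * g))) -
      (y * (s - s⁻¹)) • (r * ((m * f) * (r * g))) - (y⁻¹ * γ) • (r * g) := by
  have h1 : r * (m * (g * (f * (g * r)))) = r * (g * (m * (f * (g * r)))) := by
    rw [← mul_assoc m, ← hgm, mul_assoc]
  have h2 : r * (m * (g * r)) = γ • (r * g) := by
    rw [hgr, ← mul_assoc m, ← mul_assoc r, hγ, smul_mul_assoc]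
  rw [← hgr, ← mul_assoc P, hP]
  simp only [sub_mul, add_mul, mul_sub, mul_add, smul_mul_assoc, mul_smul_comm, mul_assoc, h1, h2]
  rw [← mul_assoc g r, hgr]
  simp only [mul_assoc]
  module

/-- Used with t = `T k`, R the last strand, and t', R' their inverses, so that tR + R't' is W_k +
W_k⁻¹. The cross term rMrg carries the factor a - a', which will be s^{k-1} - s^{1-k}. -/
theorem end_strand {y a a' δ δ' : ℂ} {r M g t t' R R' : A} (hgr : g * r = r * g)
    (hg : g * g = -(y + y⁻¹) • g) (ht : t = g + y • 1) (ht' : t' = g + y⁻¹ • 1)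
    (hR : R * r = a • (r * (M * r)) + δ • r) (hR' : R' * r = a' • (r * (M * r)) + δ' • r) :
    (t * R + R' * t') * (r * g) = a • ((r * g) * (M * (r * g))) +
      (y * (a - a')) • (r * (M * (r * g))) - (δ * y⁻¹ + y * δ') • (r * g) := by
  have h1 : t' * (r * g) = (-y) • (r * g) := by
    rw [ht', ← hgr, add_mul, ← mul_assoc, hg, smul_mul_assoc, smul_mul_assoc, one_mul]; module
  have h2 : t * (r * g) = (-y⁻¹) • (r * g) := by
    rw [ht, ← hgr, add_mul, ← mul_assoc, hg, smul_mul_assoc, smul_mul_assoc, one_mul]; module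
  rw [add_mul, mul_assoc R', h1, mul_smul_comm, ← mul_assoc R', hR', mul_assoc t, ← mul_assoc R,
    hR]
  simp only [add_mul, mul_add, smul_mul_assoc, mul_smul_comm, h2, mul_assoc]
  simp only [ht, add_mul, smul_mul_assoc, one_mul, mul_mul_left_of_eq hgr, mul_assoc]
  module

namespace TLData

variable {k : ℕ} {s x y : ℂ} {T : ℕ → Aˣ} {E : ℕ → A} (D : TLData k s x y T E)

include D

theorem commute_strand_E {i j : ℕ} (hij : j + 1 < i) (hik : i ≤ k) :
    Commute ((strand T j : Aˣ) : A) (E i) := by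
  induction j with
  | zero => exact (D.commute_E_T (by omega) hik (by omega)).symm
  | succ j ih =>
    have h1 := (D.commute_E_T (i := i) (j := j + 1) (by omega) hik (by omega)).symm
    simp only [strand, Units.val_mul]
    exact (h1.mul_left (ih (by omega))).mul_left h1

theorem strand_mul_row_succ {a n : ℕ} (hn : a + 1 + 2 * n ≤ k) :
    ((strand T (a + 2 * n) : Aˣ) : A) * row E (a + 1) n =
      (s ^ 2) ^ n • (row E (a + 1) n * (row E (a + 2) n * ((strand T a : Aˣ) *
        row E (a + 1) n))) := by
  have := D.strand_mul_row (a := a + 1) (n := n) (by omega) (by omega)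
    (V := fun j => (strand T (j - 1) : Aˣ)) ?_ ?_
  · rwa [show a + 1 + 2 * n - 1 = a + 2 * n by omega] at this
  · intro j hj hjk
    obtain ⟨i, rfl⟩ : ∃ i, j = i + 1 := ⟨j - 1, by omega⟩
    simp [strand]
  · intro j i hj hji hik
    exact D.commute_strand_E (by omega) hik.le

/-- The strand slides down to `T 0`, which is `E 0` plus x: `E 0` extends the middle row to start at
0, and for x the zigzag straightens. -/
theorem strand_mul_row_one {n : ℕ} (hn : 1 + 2 * n ≤ k) :
    ((strand T (2 * n) : Aˣ) : A) * row E 1 n =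
      s ^ (2 * n) • (row E 1 n * (row E 0 (n + 1) * row E 1 n)) +
        (s ^ (2 * n) * x) • row E 1 n := by
  have h1 := D.strand_mul_row_succ (a := 0) (n := n) (by omega)
  have h2 := D.row_zig (a := 1) (n := n) le_rfl hn
  have h3 := (D.commute_E_row (i := 0) (a := 2) (n := n) (by omega) (by omega) (by omega)).eq
  simp only [zero_add, Nat.reduceAdd, strand] at h1 h2
  rw [h1, D.T_zero, row_succ', zero_add, pow_mul, h3]
  simp only [add_mul, mul_add, smul_mul_assoc, mul_smul_comm, one_mul, h2, mul_assoc, smul_add,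
    smul_smul]

/-- With `E 0` present the sliding stops at `strand T 1`, and `strand_zero_mul_E` finishes. -/
theorem strand_mul_row_zero {n : ℕ} (h1n : 1 ≤ n) (hn : 2 * n ≤ k) :
    ((strand T (2 * n - 1) : Aˣ) : A) * row E 0 n =
      s ^ (2 * n - 1) • (row E 0 n * (row E 1 n * row E 0 n)) +
        (-s ^ (2 * n) * x⁻¹) • row E 0 n := by
  obtain ⟨p, rfl⟩ : ∃ p, n = p + 1 := ⟨n - 1, by omega⟩
  have h1 := D.strand_mul_row_succ (a := 1) (n := p) (by omega)
  have h2 := D.row_zig (a := 2) (n := p) (by omega) (by omega)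
  have h3 := (D.commute_E_row (i := 0) (a := 2) (n := p) (by omega) (by omega) (by omega)).eq
  have h4 := (D.commute_E_row (i := 0) (a := 3) (n := p) (by omega) (by omega) (by omega)).eq
  have h5 := (D.commute_E_row (i := 1) (a := 3) (n := p) (by omega) (by omega) (by omega)).eq
  have h6 := D.strand_zero_mul_E (by omega)
  have h7 : ((strand T 1 : Aˣ) : A) = T 1 * T 0 * T 1 := by simp [strand]
  simp only [Nat.reduceAdd] at h1 h2
  rw [show 2 * (p + 1) - 1 = 1 + 2 * p by omega]
  simp only [row_succ', zero_add, Nat.reduceAdd]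
  rw [h3, mul_mul_left_of_eq h1, h7]
  generalize (T 1 * T 0 * T 1 : A) = S at *
  generalize row E 2 p = r at *
  generalize row E 3 p = r' at *
  have e1 : r * (r' * (S * r)) * E 0 = s • ((r * E 0) * ((E 1 * r') * (r * E 0))) -
      (s ^ 2 * x⁻¹) • (r * E 0) := by
    calc r * (r' * (S * r)) * E 0 = r * r' * (S * E 0) * r := by
          simp only [mul_assoc, h3]
      _ = s • (r * (r' * E 0) * (E 1 * E 0) * r) - (s ^ 2 * x⁻¹) • (r * (r' * (E 0 * r))) := by
          rw [h6]; simp only [mul_sub, sub_mul, mul_smul_comm, smul_mul_assoc, mul_assoc]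
      _ = s • (r * E 0 * (r' * E 1) * (E 0 * r)) - (s ^ 2 * x⁻¹) • (r * (r' * r) * E 0) := by
          rw [← h4, h3]; simp only [mul_assoc, h3]
      _ = _ := by rw [h2, ← h5, h3]; simp only [mul_assoc]
  rw [smul_mul_assoc, e1]
  match_scalars <;> ring

theorem strand_inv_mul_row_one {n : ℕ} (hn : 1 + 2 * n ≤ k) :
    (((strand T (2 * n))⁻¹ : Aˣ) : A) * row E 1 n =
      s⁻¹ ^ (2 * n) • (row E 1 n * (row E 0 (n + 1) * row E 1 n)) +
        (s⁻¹ ^ (2 * n) * x⁻¹) • row E 1 n := by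
  rw [← strand_inv]
  exact D.bar.strand_mul_row_one hn

theorem strand_inv_mul_row_zero {n : ℕ} (h1n : 1 ≤ n) (hn : 2 * n ≤ k) :
    (((strand T (2 * n - 1))⁻¹ : Aˣ) : A) * row E 0 n =
      s⁻¹ ^ (2 * n - 1) • (row E 0 n * (row E 1 n * row E 0 n)) +
        (-s⁻¹ ^ (2 * n) * x) • row E 0 n := by
  rw [← strand_inv]
  have := D.bar.strand_mul_row_zero h1n hn
  rwa [inv_inv] at this

/-- Pushing the pole over the caps leaves the two alternating rows behind. It ends at k, where it is
`T k`, or at k - 1, where `end_loop` takes over. -/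
theorem pairLoop_mul_row (h : BraidC k T) {p : ℕ} (hp : 2 + 2 * p ≤ k) :
    pairLoop k s x y T E * row E 3 p = row E 1 (p + 1) * (row E 0 (p + 1) *
      ((pole k T (2 + 2 * p) : Aˣ) * row E 1 (p + 1))) -
        (s * x⁻¹ * (y - y⁻¹)) • row E 1 (p + 1) := by
  have h1 := D.pole_mul_row h (j := 2) (n := p) (by omega) hp
  have h2 := (D.commute_E_row (i := 0) (a := 2) (n := p) (by omega) (by omega) (by omega)).eq
  have h3 := (D.commute_E_row (i := 0) (a := 3) (n := p) (by omega) (by omega) (by omega)).eq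
  have h4 := (D.commute_E_row (i := 1) (a := 3) (n := p) (by omega) (by omega) (by omega)).eq
  have h5 := (D.commute_pole_E h (i := 0) (j := 2 + 2 * p) (by omega) hp).eq
  simp only [Nat.reduceAdd] at h1
  rw [pairLoop, sub_mul, smul_mul_assoc, row_succ', row_succ']
  simp only [zero_add, Nat.reduceAdd]
  congr 1
  generalize row E 2 p = r' at *
  generalize row E 3 p = r at *
  generalize ((pole k T 2 : Aˣ) : A) = P at *
  generalize ((pole k T (2 + 2 * p) : Aˣ) : A) = P' at *
  calc E 1 * (P * (E 0 * E 1)) * r = E 1 * P * E 0 * (E 1 * r) := by simp only [mul_assoc]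
    _ = E 1 * P * (E 0 * r) * E 1 := by rw [h4]; simp only [mul_assoc]
    _ = E 1 * (P * r) * E 0 * E 1 := by rw [h3]; simp only [mul_assoc]
    _ = E 1 * r * r' * P' * (r * E 0) * E 1 := by rw [h1]; simp only [mul_assoc]
    _ = E 1 * r * r' * (P' * E 0) * (r * E 1) := by rw [← h3]; simp only [mul_assoc]
    _ = E 1 * r * (r' * E 0) * P' * (E 1 * r) := by rw [h5, ← h4]; simp only [mul_assoc]
    _ = _ := by rw [← h2]; simp only [mul_assoc]

theorem startLoop_mul_row (h : BraidC k T) {q : ℕ} (hq : 1 + 2 * q ≤ k) :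
    startLoop k x y T E * row E 2 q = row E 0 (q + 1) * (row E 1 q *
      ((pole k T (1 + 2 * q) : Aˣ) * row E 0 (q + 1))) +
        (x * (y - y⁻¹)) • row E 0 (q + 1) := by
  have h1 := D.pole_mul_row h (j := 1) (n := q) (by omega) hq
  have h2 := (D.commute_E_row (i := 0) (a := 2) (n := q) (by omega) (by omega) (by omega)).eq
  simp only [Nat.reduceAdd] at h1
  rw [startLoop, add_mul, smul_mul_assoc, row_succ']
  simp only [zero_add]
  congr 1
  generalize row E 2 q = r at *
  generalize ((pole k T 1 : Aˣ) : A) = P at *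
  calc E 0 * (P * E 0) * r = E 0 * P * (E 0 * r) := by simp only [mul_assoc]
    _ = E 0 * (P * r) * E 0 := by rw [h2]; simp only [mul_assoc]
    _ = _ := by rw [h1]; simp only [mul_assoc]; simp only [h2]

theorem row_zag_zero {q : ℕ} (hq : 1 + 2 * q ≤ k) :
    row E 0 (q + 1) * (row E 1 q * row E 0 (q + 1)) = (-(x + x⁻¹)) • row E 0 (q + 1) := by
  have h1 := D.row_zag (a := 1) (n := q) le_rfl hq
  have h2 := (D.commute_E_row (i := 0) (a := 2) (n := q) (by omega) (by omega) (by omega)).eq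
  rw [row_succ']
  simp only [zero_add, Nat.reduceAdd] at h1 ⊢
  generalize row E 2 q = r at *
  calc E 0 * r * (row E 1 q * (E 0 * r)) = E 0 * (r * (row E 1 q * r)) * E 0 := by
        simp only [mul_assoc]; simp only [h2]
    _ = (E 0 * E 0) * r := by rw [h1, mul_assoc, ← h2, mul_assoc]
    _ = _ := by rw [D.sq_zero, smul_mul_assoc]

end TLData

end TemperleyLieb

/-! ### The action of the central element on the alternating products -/

section TemperleyLieb

variable {A : Type*} [Ring A] [Algebra ℂ A]

namespace TLData

variable {k : ℕ} {s x y : ℂ} {T : ℕ → Aˣ} {E : ℕ → A} (D : TLData k s x y T E)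

include D

theorem last_murphy_mul (hk : 1 ≤ k) {a a' δ δ' : ℂ} {r M : A} (hr : E k * r = r * E k)
    (hR : ((strand T (k - 1) : Aˣ) : A) * r = a • (r * (M * r)) + δ • r)
    (hR' : (((strand T (k - 1))⁻¹ : Aˣ) : A) * r = a' • (r * (M * r)) + δ' • r) :
    (((murphyOf k T (k - 1) : Aˣ) : A) + ((murphyOf k T (k - 1))⁻¹ : Aˣ)) * (r * E k) =
      a • ((r * E k) * (M * (r * E k))) + (y * (a - a')) • (r * (M * (r * E k))) -
        (δ * y⁻¹ + y * δ') • (r * E k) := by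
  rw [murphyOf_eq_pole_mul_strand T (by omega), show k - 1 + 1 = k by omega, pole_self,
    mul_inv_rev, Units.val_mul, Units.val_mul]
  exact end_strand hr D.sq_last D.T_last D.T_last_inv hR hR'

/-- All strands are paired, so the sum is [k] times one loop whose pole ends as `T k`, that is `E k`
plus y; `E k` completes the middle row and y gives a scalar by `row_zag_left`. -/
theorem murphySum_mul_row_one_even (h : BraidC k T) {n : ℕ} (hn : 1 ≤ n) (hk : k = 2 * n) :
    murphySum k T * row E 1 n = quantumInt s k • (row E 1 n * (row E 0 (n + 1) * row E 1 n) +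
      (x * y * s⁻¹ + (x * y)⁻¹ * s) • row E 1 n) := by
  have hs := D.s_ne
  have hx := D.x_ne
  have hy := D.y_ne
  obtain ⟨p, rfl⟩ : ∃ p, n = p + 1 := ⟨n - 1, by omega⟩
  have h1 := D.sum_mul_row_one h (N := p + 1) (M := p + 1) (by omega) le_rfl (by omega)
  have h2 := D.pairLoop_mul_row h (p := p) (by omega)
  have h3 := D.row_zag_left (n := p + 1) (by omega) (by omega)
  rw [← hk, ← murphySum, Nat.add_sub_cancel, h2, show 2 + 2 * p = k by omega, pole_self,
    D.T_last] at h1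
  rw [h1, row_succ E 0 (p + 1), show 0 + 2 * (p + 1) = k by omega]
  simp only [add_mul, mul_add, smul_mul_assoc, one_mul, mul_smul_comm, h3, mul_assoc]
  match_scalars <;> (field_simp; try ring)

theorem murphySum_mul_row_zero_odd (h : BraidC k T) {n : ℕ} (hk : k = 2 * n + 1) :
    murphySum k T * row E 0 (n + 1) =
      quantumInt s k • (row E 0 (n + 1) * (row E 1 (n + 1) * row E 0 (n + 1)) -
        (x * y⁻¹ + x⁻¹ * y) • row E 0 (n + 1)) := by
  have hs := D.s_ne
  have hx := D.x_ne
  have hy := D.y_ne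
  have h1 := D.sum_mul_row_zero h (N := n) (M := n) (by omega) le_rfl
  have h2 := D.startLoop_mul_row h (q := n) (by omega)
  have h3 := D.row_zag_zero (q := n) (by omega)
  rw [← hk, ← murphySum, h2, show 1 + 2 * n = k by omega, pole_self, D.T_last] at h1
  rw [h1, row_succ E 1 n, show 1 + 2 * n = k by omega]
  simp only [add_mul, mul_add, smul_mul_assoc, one_mul, mul_smul_comm, h3, mul_assoc]
  match_scalars <;> (field_simp; try ring)

/-- The paired strands contribute [k-1] times a loop and the last strand is added separately. The
cross terms cancel since s^{k-1} - s^{1-k} = (s - s⁻¹)[k-1]. -/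
theorem murphySum_mul_row_one_odd (h : BraidC k T) {n : ℕ} (hk : k = 2 * n + 1) :
    murphySum k T * row E 1 (n + 1) =
      quantumInt s k • (row E 1 (n + 1) * (row E 0 (n + 1) * row E 1 (n + 1)) -
        (x * y⁻¹ + x⁻¹ * y) • row E 1 (n + 1)) := by
  have hs := D.s_ne
  have hx := D.x_ne
  have hy := D.y_ne
  have hrow : row E 1 (n + 1) = row E 1 n * E k := by
    rw [row_succ, show 1 + 2 * n = k by omega]
  have hr := (D.commute_E_row (i := k) (a := 1) (n := n) le_rfl (by omega) (by omega)).eq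
  have h1 := D.strand_mul_row_one (n := n) (by omega)
  have h2 := D.strand_inv_mul_row_one (n := n) (by omega)
  rw [show 2 * n = k - 1 by omega] at h1 h2
  have h3 := D.last_murphy_mul (by omega) hr h1 h2
  have h4 : murphySum k T * row E 1 (n + 1) =
      (∑ j ∈ Finset.range (2 * n), (((murphyOf k T j : Aˣ) : A) + ((murphyOf k T j)⁻¹ : Aˣ))) *
        row E 1 (n + 1) + (((murphyOf k T (k - 1) : Aˣ) : A) + ((murphyOf k T (k - 1))⁻¹ : Aˣ)) *
          row E 1 (n + 1) := by
    rw [murphySum, ← add_mul, show k - 1 = 2 * n by omega, ← Finset.sum_range_succ, ← hk]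
  rw [h4, D.sum_mul_row_one h (N := n) (M := n + 1) (by omega) (by omega) (by omega)]
  have q1 := quantumInt_succ hs (2 * n)
  have q2 := quantumInt_succ' hs (2 * n)
  rw [← hk, show 2 * n = k - 1 by omega] at q1 q2
  rw [show 2 * n = k - 1 by omega]
  -- For k = 1 there are no pairs and [0] = 0 removes the loop, which could not be evaluated with
  -- fewer than two strands.
  rcases Nat.eq_zero_or_pos n with rfl | hn
  · have q0 : quantumInt s (k - 1) = 0 := by
      rw [show k - 1 = 0 by omega]; simp [quantumInt]
    have q3 : quantumInt s k = 1 := by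
      rw [q1, q0, show k - 1 = 0 by omega]; simp
    rw [hrow, h3, q0, q3, show k - 1 = 0 by omega]
    match_scalars <;> (field_simp; try ring)
  · obtain ⟨p, rfl⟩ : ∃ p, n = p + 1 := ⟨n - 1, by omega⟩
    have h5 := D.pairLoop_mul_row h (p := p) (by omega)
    have h6 := D.row_zag_left (n := p + 1) (by omega) (by omega)
    have h7 := D.pole_pred_mul_E (by omega)
    have h8 := (D.commute_E_row (i := k) (a := 0) (n := p + 1) le_rfl (by omega) (by omega)).eq
    have h9 : pairLoop k s x y T E * row E 3 (p + 1) =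
        (pairLoop k s x y T E * row E 3 p) * E k := by
      rw [row_succ E 3 p, show 3 + 2 * p = k by omega, mul_assoc]
    rw [show 2 + 2 * p = k - 1 by omega] at h5
    have h10 := end_loop hr h8 h7 h6
    have h11 : row E 0 (p + 1 + 1) = row E 0 (p + 1) * E (k - 1) := by
      rw [row_succ E 0 (p + 1), show 0 + 2 * (p + 1) = k - 1 by omega]
    rw [Nat.add_sub_cancel, h9, h5, sub_mul, smul_mul_assoc]
    simp only [mul_assoc] at h10 h3 hrow ⊢
    rw [hrow, h10, h3, h11]
    simp only [mul_assoc]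
    -- Both powers of s are expressed through [k] and [k-1]; after that the comparison of
    -- coefficients is rational in s.
    rw [eq_sub_of_add_eq' q1.symm, eq_sub_of_add_eq' q2.symm]
    match_scalars <;> (field_simp; try ring)

theorem murphySum_mul_row_zero_even (h : BraidC k T) {n : ℕ} (hn : 1 ≤ n) (hk : k = 2 * n) :
    murphySum k T * row E 0 (n + 1) = quantumInt s k •
      (row E 0 (n + 1) * (row E 1 n * row E 0 (n + 1)) +
        (x * y * s⁻¹ + (x * y)⁻¹ * s) • row E 0 (n + 1)) := by
  have hs := D.s_ne
  have hx := D.x_ne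
  have hy := D.y_ne
  obtain ⟨p, rfl⟩ : ∃ p, n = p + 1 := ⟨n - 1, by omega⟩
  have hrow : row E 0 (p + 1 + 1) = row E 0 (p + 1) * E k := by
    rw [row_succ E 0 (p + 1), show 0 + 2 * (p + 1) = k by omega]
  have hr := (D.commute_E_row (i := k) (a := 0) (n := p + 1) le_rfl (by omega) (by omega)).eq
  have h1 := D.strand_mul_row_zero (n := p + 1) (by omega) (by omega)
  have h2 := D.strand_inv_mul_row_zero (n := p + 1) (by omega) (by omega)
  rw [← hk] at h1 h2
  have h3 := D.last_murphy_mul (by omega) hr h1 h2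
  have h4 : murphySum k T * row E 0 (p + 1 + 1) =
      (∑ j ∈ Finset.range (2 * p + 1),
        (((murphyOf k T j : Aˣ) : A) + ((murphyOf k T j)⁻¹ : Aˣ))) * row E 0 (p + 1 + 1) +
        (((murphyOf k T (k - 1) : Aˣ) : A) + ((murphyOf k T (k - 1))⁻¹ : Aˣ)) *
          row E 0 (p + 1 + 1) := by
    rw [murphySum, ← add_mul, show k - 1 = 2 * p + 1 by omega, ← Finset.sum_range_succ,
      show 2 * p + 1 + 1 = k by omega]
  rw [h4, D.sum_mul_row_zero h (N := p) (M := p + 1) (by omega) (by omega)]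
  have q1 := quantumInt_succ hs (k - 1)
  have q2 := quantumInt_succ' hs (k - 1)
  have q3 : s ^ k = s * s ^ (k - 1) := by rw [← pow_succ']; congr 1; omega
  have q4 : s⁻¹ ^ k = s⁻¹ * s⁻¹ ^ (k - 1) := by rw [← pow_succ']; congr 1; omega
  rw [show k - 1 + 1 = k by omega] at q1 q2
  have h5 := D.startLoop_mul_row h (q := p) (by omega)
  have h6 := D.row_zag_zero (q := p) (by omega)
  have h7 := D.pole_pred_mul_E (by omega)
  have h8 := (D.commute_E_row (i := k) (a := 1) (n := p) le_rfl (by omega) (by omega)).eq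
  have h9 : startLoop k x y T E * row E 2 (p + 1) =
      (startLoop k x y T E * row E 2 p) * E k := by
    rw [row_succ E 2 p, show 2 + 2 * p = k by omega, mul_assoc]
  rw [show 1 + 2 * p = k - 1 by omega] at h5
  have h10 := end_loop hr h8 h7 h6
  have h11 : row E 1 (p + 1) = row E 1 p * E (k - 1) := by
    rw [row_succ E 1 p, show 1 + 2 * p = k - 1 by omega]
  rw [show 2 * p + 1 = k - 1 by omega, h9, h5, add_mul, smul_mul_assoc]
  simp only [mul_assoc] at h10 h3 hrow ⊢
  rw [hrow, h10, h3, h11, q3, q4]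
  simp only [mul_assoc]
  rw [eq_sub_of_add_eq' q1.symm, eq_sub_of_add_eq' q2.symm]
  match_scalars <;> (field_simp; try ring)

end TLData

end TemperleyLieb

/-! ### Temperley-Lieb relations from Hecke relations -/

section Hecke

variable {A : Type} [Ring A] [Algebra ℂ A]

/-- The quadratic relation with eigenvalues `s` and `-s⁻¹`. -/
def Quad (s : ℂ) (t : A) : Prop := t * t = 1 + (s - s⁻¹) • t

theorem Quad.sq {s : ℂ} (hs : s ≠ 0) {t : A} (h : Quad s t) :
    (t - s • 1) * (t - s • 1) = -(s + s⁻¹) • (t - s • 1) := by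
  simp only [mul_sub, sub_mul, mul_smul_comm, smul_mul_assoc, mul_one, one_mul, show t * t = _ from h]
  match_scalars <;> (field_simp; try ring)

/-- The two eigenvalues play symmetric roles, so statements on `signB u` also serve for the
eigenvalue u of T_0, by taking -u⁻¹ for u. -/
theorem Quad.neg_inv {s : ℂ} {t : A} (h : Quad s t) : Quad (-s⁻¹) t := by
  rw [Quad, show t * t = _ from h, inv_neg, inv_inv]
  module

theorem Quad.val_inv {s : ℂ} {t : Aˣ} (h : Quad s (t : A)) :
    ((t⁻¹ : Aˣ) : A) = (t - s • 1) + s⁻¹ • 1 := by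
  rw [coe_inv_eq_sub h]; module

/-- Two-boundary Temperley-Lieb data from Hecke algebra generators. -/
theorem TLData.of_hecke {k : ℕ} {s x y : ℂ} {T : ℕ → Aˣ} {E : ℕ → A} (B : BraidC k T)
    (hk : 1 ≤ k) (hs : s ≠ 0) (hx : x ≠ 0) (hy : y ≠ 0)
    (q0 : Quad x (T 0 : A)) (qm : ∀ i, 1 ≤ i → i < k → Quad s (T i : A)) (qk : Quad y (T k : A))
    (e0 : E 0 = T 0 - x • 1) (em : ∀ i, 1 ≤ i → i < k → E i = T i - s • 1) (ek : E k = T k - y • 1)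
    (up : ∀ i, 1 ≤ i → i + 2 ≤ k → E i * (E (i + 1) * E i) = E i)
    (down : ∀ i, 1 ≤ i → i + 2 ≤ k → E (i + 1) * (E i * E (i + 1)) = E (i + 1))
    (left : 2 ≤ k → E 1 * (E 0 * E 1) = (x * s⁻¹ + x⁻¹ * s) • E 1)
    (right : 2 ≤ k → E (k - 1) * (E k * E (k - 1)) = (y * s⁻¹ + y⁻¹ * s) • E (k - 1)) :
    TLData k s x y T E where
  s_ne := hs
  x_ne := hx
  y_ne := hy
  T_zero := by rw [e0, sub_add_cancel]
  T_zero_inv := by rw [e0, q0.val_inv]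
  T_mid := fun i h1 h2 => by rw [em i h1 h2, sub_add_cancel]
  T_mid_inv := fun i h1 h2 => by rw [em i h1 h2, (qm i h1 h2).val_inv]
  T_last := by rw [ek, sub_add_cancel]
  T_last_inv := by rw [ek, qk.val_inv]
  sq_zero := by rw [e0, q0.sq hx]
  sq_mid := fun i h1 h2 => by rw [em i h1 h2, (qm i h1 h2).sq hs]
  sq_last := by rw [ek, qk.sq hy]
  comm := fun i j hij hj => by
    have form : ∀ l ≤ k, ∃ c : ℂ, E l = T l - c • 1 := fun l hl => by
      rcases Nat.eq_zero_or_pos l with rfl | h1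
      · exact ⟨_, e0⟩
      · rcases hl.lt_or_eq with h2 | rfl
        · exact ⟨_, em l h1 h2⟩
        · exact ⟨_, ek⟩
    obtain ⟨c, hc⟩ := form i (by omega)
    obtain ⟨d, hd⟩ := form j hj
    have h := commute_val (B.comm i j hij hj)
    rw [hc, hd]
    exact (h.sub_right ((Commute.one_right _).smul_right d)).sub_left
      (((Commute.one_left _).sub_right ((Commute.one_right _).smul_right d)).smul_left c)
  up := up
  down := down
  left := left
  right := right

/-- The quasi-idempotent for the sign character of a Hecke algebra of type `B_2`. -/
def signB (u s : ℂ) (t₀ t₁ : A) : A :=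
  (t₀ - u • 1) * ((t₁ - s • 1) * ((t₀ - u • 1) * (t₁ - s • 1))) -
    (u * s⁻¹ + u⁻¹ * s) • ((t₀ - u • 1) * (t₁ - s • 1))

/-- The quasi-idempotent for the sign character of a Hecke algebra of type `A_2`. -/
def signA (s : ℂ) (t₁ t₂ : A) : A :=
  (t₁ - s • 1) * ((t₂ - s • 1) * (t₁ - s • 1)) - (t₁ - s • 1)

/-- The four-term relation makes the element symmetric under reversing words; the reversed form
shows that it is an eigenvector of t₁ as well. -/
theorem signB_eq {u s : ℂ} (hu : u ≠ 0) (hs : s ≠ 0) {t₀ t₁ : A} (q0 : Quad u t₀)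
    (q1 : Quad s t₁) (h : t₀ * t₁ * t₀ * t₁ = t₁ * t₀ * t₁ * t₀) :
    signB u s t₀ t₁ = (t₁ - s • 1) * ((t₀ - u • 1) * ((t₁ - s • 1) * (t₀ - u • 1))) -
      (u * s⁻¹ + u⁻¹ * s) • ((t₁ - s • 1) * (t₀ - u • 1)) := by
  have h0 := mul_mul_left_of_eq (show t₀ * t₀ = _ from q0)
  have h1 := mul_mul_left_of_eq (show t₁ * t₁ = _ from q1)
  simp only [mul_assoc] at h
  simp only [signB, mul_sub, sub_mul, mul_smul_comm, smul_mul_assoc, mul_one, one_mul, smul_sub,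
    show t₀ * t₀ = _ from q0, show t₁ * t₁ = _ from q1, h, add_mul, mul_add, h0, h1, smul_add]
  match_scalars <;> (field_simp; try ring)

theorem signA_eq {s : ℂ} (hs : s ≠ 0) {t₁ t₂ : A} (q1 : Quad s t₁)
    (q2 : Quad s t₂) (h : t₁ * t₂ * t₁ = t₂ * t₁ * t₂) : signA s t₁ t₂ = signA s t₂ t₁ := by
  simp only [mul_assoc] at h
  simp only [signA, mul_sub, sub_mul, mul_smul_comm, smul_mul_assoc, mul_one, one_mul, smul_sub,
    show t₁ * t₁ = _ from q1, show t₂ * t₂ = _ from q2, h, smul_add, mul_add]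
  match_scalars <;> (field_simp; try ring)

theorem mul_signB {u s : ℂ} (hu : u ≠ 0) {t₀ t₁ : A} (q0 : Quad u t₀) :
    (t₀ - u • 1) * signB u s t₀ t₁ = -(u + u⁻¹) • signB u s t₀ t₁ := by
  have h0 := q0.sq hu
  rw [signB]
  generalize t₀ - u • (1 : A) = a at *
  simp only [mul_sub, mul_smul_comm, mul_mul_left_of_eq h0, smul_mul_assoc, smul_sub]
  module

theorem mul_signB' {u s : ℂ} (hu : u ≠ 0) (hs : s ≠ 0) {t₀ t₁ : A} (q0 : Quad u t₀)
    (q1 : Quad s t₁) (h : t₀ * t₁ * t₀ * t₁ = t₁ * t₀ * t₁ * t₀) :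
    (t₁ - s • 1) * signB u s t₀ t₁ = -(s + s⁻¹) • signB u s t₀ t₁ := by
  have h0 := q1.sq hs
  rw [signB_eq hu hs q0 q1 h]
  generalize t₁ - s • (1 : A) = a at *
  simp only [mul_sub, mul_smul_comm, mul_mul_left_of_eq h0, smul_mul_assoc, smul_sub]
  module

theorem mul_signA {s : ℂ} (hs : s ≠ 0) {t₁ t₂ : A} (q1 : Quad s t₁) :
    (t₁ - s • 1) * signA s t₁ t₂ = -(s + s⁻¹) • signA s t₁ t₂ := by
  have h0 := q1.sq hs
  rw [signA]
  generalize t₁ - s • (1 : A) = a at *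
  simp only [mul_sub, mul_mul_left_of_eq h0, h0, smul_mul_assoc, smul_sub]

theorem eigen_of_sub {c d : ℂ} {t q : A} (h : (t - c • 1) * q = -(c + d) • q) :
    t * q = (-d) • q := by
  rw [sub_mul, smul_mul_assoc, one_mul, sub_eq_iff_eq_add] at h
  rw [h]; module

theorem sub_smul_one_mem_adjoin {S : Set A} {t : A} (ht : t ∈ S) (c : ℂ) :
    t - c • 1 ∈ Algebra.adjoin ℂ S :=
  sub_mem (Algebra.subset_adjoin ht) (Subalgebra.smul_mem _ (one_mem _) c)

/-- Multiplication by `signB` from the left acts on `signB` through the eigenvalues, so its square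
is a multiple of it. The character `χ` takes that same multiple as its value, which shows that the
idempotent is nonzero. -/
theorem isEigenIdem_signB {u s : ℂ} (hu : u ≠ 0) (hs : s ≠ 0) {t₀ t₁ : A} (q0 : Quad u t₀)
    (q1 : Quad s t₁) (h : t₀ * t₁ * t₀ * t₁ = t₁ * t₀ * t₁ * t₀)
    (h1 : u + u⁻¹ ≠ 0) (h2 : s + s⁻¹ ≠ 0) (h3 : u * s + (u * s)⁻¹ ≠ 0)
    (χ : A →ₐ[ℂ] ℂ) (χ0 : χ t₀ = -u⁻¹) (χ1 : χ t₁ = -s⁻¹) :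
    IsEigenIdem t₀ t₁ (-u⁻¹) (-s⁻¹)
      (((u + u⁻¹) * (s + s⁻¹) * (u * s + (u * s)⁻¹))⁻¹ • signB u s t₀ t₁) := by
  have hγ : (u + u⁻¹) * (s + s⁻¹) * (u * s + (u * s)⁻¹) ≠ 0 := mul_ne_zero (mul_ne_zero h1 h2) h3
  have e0 := mul_signB (s := s) (t₁ := t₁) hu q0
  have e1 := mul_signB' hu hs q0 q1 h
  have hχ : χ (signB u s t₀ t₁) = (u + u⁻¹) * (s + s⁻¹) * (u * s + (u * s)⁻¹) := by
    simp only [signB, map_sub, map_mul, map_smul, χ0, χ1, map_one, smul_eq_mul]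
    field_simp; ring
  have hsq : signB u s t₀ t₁ * signB u s t₀ t₁ =
      ((u + u⁻¹) * (s + s⁻¹) * (u * s + (u * s)⁻¹)) • signB u s t₀ t₁ := by
    conv_lhs => enter [1]; rw [signB]
    rw [sub_mul _ _ (signB u s t₀ t₁)]
    simp only [smul_mul_assoc, mul_assoc, e0, e1, mul_smul_comm]
    match_scalars
    field_simp; ring
  generalize (u + u⁻¹) * (s + s⁻¹) * (u * s + (u * s)⁻¹) = γ at *
  refine ⟨?_, ?_, ?_, ?_, ?_⟩
  · refine Subalgebra.smul_mem _ ?_ _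
    have m0 := sub_smul_one_mem_adjoin (S := {t₀, t₁}) (t := t₀) (by simp) u
    have m1 := sub_smul_one_mem_adjoin (S := {t₀, t₁}) (t := t₁) (by simp) s
    exact sub_mem (mul_mem m0 (mul_mem m1 (mul_mem m0 m1)))
      (Subalgebra.smul_mem _ (mul_mem m0 m1) _)
  · intro h0
    have := congrArg χ h0
    rw [map_smul, hχ, map_zero, smul_eq_mul, inv_mul_cancel₀ hγ] at this
    exact one_ne_zero this
  · rw [smul_mul_smul_comm, hsq, smul_smul, mul_assoc, inv_mul_cancel₀ hγ, mul_one]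
  · rw [mul_smul_comm, eigen_of_sub e0, smul_comm]
  · rw [mul_smul_comm, eigen_of_sub e1, smul_comm]

theorem isEigenIdem_signA {s : ℂ} (hs : s ≠ 0) {t₁ t₂ : A} (q1 : Quad s t₁)
    (q2 : Quad s t₂) (h : t₁ * t₂ * t₁ = t₂ * t₁ * t₂)
    (h1 : s + s⁻¹ ≠ 0) (h2 : s ^ 2 + 1 + s⁻¹ ^ 2 ≠ 0)
    (χ : A →ₐ[ℂ] ℂ) (χ1 : χ t₁ = -s⁻¹) (χ2 : χ t₂ = -s⁻¹) :
    IsEigenIdem t₁ t₂ (-s⁻¹) (-s⁻¹)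
      ((-((s + s⁻¹) * (s ^ 2 + 1 + s⁻¹ ^ 2)))⁻¹ • signA s t₁ t₂) := by
  have hγ : -((s + s⁻¹) * (s ^ 2 + 1 + s⁻¹ ^ 2)) ≠ 0 := neg_ne_zero.mpr (mul_ne_zero h1 h2)
  have e1 := mul_signA (t₂ := t₂) hs q1
  have e2 : (t₂ - s • 1) * signA s t₁ t₂ = -(s + s⁻¹) • signA s t₁ t₂ := by
    rw [signA_eq hs q1 q2 h]; exact mul_signA hs q2
  have hχ : χ (signA s t₁ t₂) = -((s + s⁻¹) * (s ^ 2 + 1 + s⁻¹ ^ 2)) := by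
    simp only [signA, map_sub, map_mul, map_smul, χ1, χ2, map_one, smul_eq_mul]
    field_simp; ring
  have hsq : signA s t₁ t₂ * signA s t₁ t₂ =
      (-((s + s⁻¹) * (s ^ 2 + 1 + s⁻¹ ^ 2))) • signA s t₁ t₂ := by
    conv_lhs => enter [1]; rw [signA]
    rw [sub_mul _ _ (signA s t₁ t₂)]
    simp only [mul_assoc, e1, e2, mul_smul_comm]
    match_scalars
    field_simp; ring
  generalize -((s + s⁻¹) * (s ^ 2 + 1 + s⁻¹ ^ 2)) = γ at *
  refine ⟨?_, ?_, ?_, ?_, ?_⟩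
  · refine Subalgebra.smul_mem _ ?_ _
    have m1 := sub_smul_one_mem_adjoin (S := {t₁, t₂}) (t := t₁) (by simp) s
    have m2 := sub_smul_one_mem_adjoin (S := {t₁, t₂}) (t := t₂) (by simp) s
    exact sub_mem (mul_mem m1 (mul_mem m2 m1)) m1
  · intro h0
    have := congrArg χ h0
    rw [map_smul, hχ, map_zero, smul_eq_mul, inv_mul_cancel₀ hγ] at this
    exact one_ne_zero this
  · rw [smul_mul_smul_comm, hsq, smul_smul, mul_assoc, inv_mul_cancel₀ hγ, mul_one]
  · rw [mul_smul_comm, eigen_of_sub e1, smul_comm]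
  · rw [mul_smul_comm, eigen_of_sub e2, smul_comm]

/-- If the two one-dimensional idempotents coincide, then the boundary Temperley-Lieb relation
holds. -/
theorem boundary_of_signB_eq {u s α β : ℂ} (hu : u ≠ 0) (hs : s ≠ 0) (hc : u + u⁻¹ ≠ 0)
    (hα : α ≠ 0) (hβ : β ≠ 0) {t₀ t₁ : A} (q0 : Quad u t₀) (q1 : Quad s t₁)
    (h : α • signB u s t₀ t₁ = β • signB (-u⁻¹) s t₀ t₁) :
    (t₁ - s • 1) * ((t₀ - u • 1) * (t₁ - s • 1)) = (u * s⁻¹ + u⁻¹ * s) • (t₁ - s • 1) := by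
  have e0 := eigen_of_sub (mul_signB (s := s) (t₁ := t₁) hu q0)
  have e1 := eigen_of_sub (mul_signB (s := s) (t₁ := t₁) (neg_ne_zero.mpr (inv_ne_zero hu))
    q0.neg_inv)
  -- The common element is an eigenvector of t₀ with eigenvalues -u⁻¹ and u at once.
  have h1 : (u + u⁻¹) • (β • signB (-u⁻¹) s t₀ t₁) = 0 := by
    have h2 : t₀ * (α • signB u s t₀ t₁) = t₀ * (β • signB (-u⁻¹) s t₀ t₁) := by rw [h]
    rw [mul_smul_comm, mul_smul_comm, e0, e1, smul_comm α, h, inv_neg, inv_inv, neg_neg,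
      smul_comm β] at h2
    rw [add_smul, ← h2]
    module
  have h2 : signB (-u⁻¹) s t₀ t₁ = 0 := by
    simpa [hc, hβ] using h1
  have h3 : signB u s t₀ t₁ = 0 := by
    rw [h2, smul_zero] at h
    simpa [hα] using h
  -- Changing u to -u⁻¹ only adds u + u⁻¹ to the factors t₀ - u, so the difference of the two
  -- elements is the boundary relation.
  have h4 : signB (-u⁻¹) s t₀ t₁ = signB u s t₀ t₁ + (u + u⁻¹) •
      ((t₁ - s • 1) * ((t₀ - u • 1) * (t₁ - s • 1)) - (u * s⁻¹ + u⁻¹ * s) • (t₁ - s • 1)) := by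
    have h5 : t₀ - (-u⁻¹) • (1 : A) = (t₀ - u • 1) + (u + u⁻¹) • 1 := by module
    have h6 := q1.sq hs
    rw [signB, signB, h5]
    generalize t₀ - u • (1 : A) = a at *
    generalize t₁ - s • (1 : A) = b at *
    simp only [add_mul, mul_add, smul_mul_assoc, mul_smul_comm, one_mul, h6, smul_add, inv_neg,
      inv_inv, smul_sub]
    match_scalars <;> (field_simp; try ring)
  rw [h2, h3, zero_add, eq_comm, smul_eq_zero_iff_right hc, sub_eq_zero] at h4
  exact h4

/-- Moving a boundary relation along the right pole. -/
theorem BraidC.pole_relation {k : ℕ} {T : ℕ → Aˣ} (B : BraidC k T) (hk : 2 ≤ k) {s y c : ℂ}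
    (hs : s ≠ 0) (q1 : Quad s (T 1 : A))
    (h : ((T 1 : A) - s • 1) * (((pole k T 1 : Aˣ) - y • 1) * (T 1 - s • 1)) = c • (T 1 - s • 1)) :
    ((T (k - 1) : A) - s • 1) * ((T k - y • 1) * (T (k - 1) - s • 1)) =
      c • ((T (k - 1) : A) - s • 1) := by
  have key : ∀ j, 1 ≤ j → j < k → ((T j : A) - s • 1) * (((pole k T (j + 1) : Aˣ) - y • 1) *
      (T j - s • 1)) = c • ((T j : A) - s • 1) := by
    intro j hj
    induction j, hj using Nat.le_induction with
    | base =>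
      -- The pole at 1 is conjugate to the pole at 2 under `T 1`, which acts on `T 1 - s` by
      -- mutually inverse scalars on the two sides.
      intro _
      have h1 : (T 1 : A) * (T 1 - s • 1) = (-s⁻¹) • ((T 1 : A) - s • 1) := by
        rw [mul_sub, show (T 1 : A) * T 1 = _ from q1, mul_smul_comm, mul_one]
        match_scalars <;> (field_simp; try ring)
      have h2 : ((T 1 : A) - s • 1) * ((T 1)⁻¹ : Aˣ) = (-s) • ((T 1 : A) - s • 1) := by
        rw [sub_mul, Units.mul_inv, smul_mul_assoc, one_mul, q1.val_inv]
        match_scalars <;> (field_simp; try ring)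
      have h3 : ((pole k T 1 : Aˣ) : A) - y • 1 =
          ((T 1)⁻¹ : Aˣ) * ((((pole k T (1 + 1) : Aˣ) : A) - y • 1) * T 1) := by
        rw [val_pole_eq T (by omega), sub_mul, mul_sub, smul_mul_assoc, mul_smul_comm, one_mul,
          Units.inv_mul, mul_assoc]
      rw [h3] at h
      simp only [mul_assoc, h1] at h
      rw [← mul_assoc, h2] at h
      simp only [mul_smul_comm, smul_mul_assoc, smul_smul] at h
      rwa [neg_mul_neg, inv_mul_cancel₀ hs, one_smul] at h
    | succ j hj ih =>
      intro hjk
      have h1 := ih (by omega)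
      -- The conjugation of `pole_four` moves the relation one position to the right.
      have g1 : T j * T (j + 1) * pole k T (j + 1) = pole k T (j + 1 + 1) * (T j * T (j + 1)) := by
        rw [mul_assoc, mul_pole T hjk, ← mul_assoc, B.pole_comm_low le_rfl (by omega), mul_assoc]
      have g2 : T j * T (j + 1) * T j = T (j + 1) * (T j * T (j + 1)) := by
        rw [B.braid j hj (by omega), mul_assoc]
      have g1' := congrArg (fun u : Aˣ => (u : A)) g1
      have g2' := congrArg (fun u : Aˣ => (u : A)) g2
      simp only [Units.val_mul] at g1' g2'
      have g3 : ((T j * T (j + 1) : Aˣ) : A) * (T j - s • 1) =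
          ((T (j + 1) : A) - s • 1) * (T j * T (j + 1) : Aˣ) := by
        rw [mul_sub, sub_mul, Units.val_mul, g2', mul_smul_comm, smul_mul_assoc, one_mul, mul_one]
      have g4 : ((T j * T (j + 1) : Aˣ) : A) * ((pole k T (j + 1) : Aˣ) - y • 1) =
          (((pole k T (j + 1 + 1) : Aˣ) : A) - y • 1) * (T j * T (j + 1) : Aˣ) := by
        rw [mul_sub, sub_mul, Units.val_mul, g1', mul_smul_comm, smul_mul_assoc, one_mul, mul_one]
      generalize T j * T (j + 1) = g at *
      refine (Units.mul_left_inj g).mp ?_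
      rw [mul_assoc, mul_assoc, ← g3, ← mul_assoc _ (g : A), ← g4, mul_assoc (g : A), ← mul_assoc _ (g : A),
        ← g3, mul_assoc, h1, mul_smul_comm, g3, smul_mul_assoc]
  have := key (k - 1) (by omega) (by omega)
  rwa [show k - 1 + 1 = k by omega, pole_self] at this

end Hecke

/-! ### The extended Hecke algebra -/

section Extended

instance isScalarTower_units (A : Type*) [Ring A] [Algebra ℂ A] : IsScalarTower ℂˣ Aˣ Aˣ where
  smul_assoc c u v := by
    ext
    simp only [smul_eq_mul, Units.val_mul, Units.val_smul, smul_mul_assoc]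

instance smulCommClass_units (A : Type*) [Ring A] [Algebra ℂ A] : SMulCommClass ℂˣ Aˣ Aˣ where
  smul_comm c u v := by
    ext
    simp only [smul_eq_mul, Units.val_mul, Units.val_smul, mul_smul_comm]

theorem BraidC.map {G G' : Type*} [Group G] [Group G'] {k : ℕ} {T : ℕ → G} (B : BraidC k T)
    (f : G →* G') : BraidC k (fun i => f (T i)) where
  comm := fun i j h1 h2 => by simp only [← map_mul, B.comm i j h1 h2]
  braid := fun i h1 h2 => by simp only [← map_mul, B.braid i h1 h2]
  left := fun h => by simp only [← map_mul, B.left h]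
  right := fun h => by simp only [← map_mul, B.right h]

theorem map_pole {G G' : Type*} [Group G] [Group G'] (k : ℕ) (T : ℕ → G) (f : G →* G') (j : ℕ) :
    f (pole k T j) = pole k (fun i => f (T i)) j := by
  rw [pole, pole]
  induction k - j with
  | zero => rfl
  | succ n ih => simp only [poleAux, map_mul, map_inv, ih]

theorem map_murphyOf {G G' : Type*} [Group G] [Group G'] (k : ℕ) (T : ℕ → G) (f : G →* G')
    (j : ℕ) : f (murphyOf k T j) = murphyOf k (fun i => f (T i)) j := by
  induction j with
  | zero => simp only [murphyOf, map_mul, map_pole]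
  | succ j ih => simp only [murphyOf, map_mul, ih]

theorem br_eq {k : ℕ} {u v : FreeGroup (Gen k)} (h : BraidRel k u v) : br k u = br k v := by
  rw [← mul_inv_eq_one]
  exact PresentedGroup.one_of_mem (rels := {w | ∃ u v, BraidRel k u v ∧ w = u * v⁻¹})
    ⟨u, v, h, rfl⟩

theorem braidC_br (k : ℕ) : BraidC k (fun i => br k (wT k i)) where
  comm := fun i j h1 h2 => br_eq (BraidRel.comm i j h1 h2)
  braid := fun i h1 h2 => br_eq (BraidRel.braid i h1 h2)
  left := fun h => br_eq (BraidRel.left h)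
  right := fun h => br_eq (BraidRel.right h)

theorem wC_mul_wX_mul (k : ℕ) : wC k * wX k * (wC k)⁻¹ = wT k k := by
  rw [wX]; group

variable (p : Params) (k : ℕ)

/-- The image of the braid generator of index `i` in the extended Hecke algebra. -/
def gen (i : ℕ) : (Hext p k)ˣ := toH p k (br k (wT k i))

theorem T_zero_eq : T p k 0 = (p.rb₁ * p.rb₂)⁻¹ • gen p k 0 := by
  rw [T, if_pos rfl]; rfl

theorem T_mid_eq {i : ℕ} (h1 : 1 ≤ i) (h2 : i < k) : T p k i = gen p k i := by
  rw [T, if_neg (by omega), if_neg (by omega)]; rfl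

theorem T_last_eq (hk : 1 ≤ k) : T p k k = (p.ra₁ * p.ra₂)⁻¹ • gen p k k := by
  rw [T, if_neg (by omega), if_pos rfl, wC_mul_wX_mul]; rfl

theorem braidC_gen : BraidC k (gen p k) := (braidC_br k).map (toH p k)

/-- Only `T 0` and `T k` are rescaled, and each of them occurs equally often on both sides of every
relation. -/
theorem braidC_T (hk : 1 ≤ k) : BraidC k (T p k) := by
  have B := braidC_gen p k
  have form : ∀ i ≤ k, ∃ c : ℂˣ, T p k i = c • gen p k i := fun i hi => by
    rcases Nat.eq_zero_or_pos i with rfl | h1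
    · exact ⟨_, T_zero_eq p k⟩
    · rcases hi.lt_or_eq with h2 | rfl
      · exact ⟨1, by rw [T_mid_eq p k h1 h2, one_smul]⟩
      · exact ⟨_, T_last_eq p i hk⟩
  refine ⟨fun i j h1 h2 => ?_, fun i h1 h2 => ?_, fun h => ?_, fun h => ?_⟩
  · obtain ⟨c, hc⟩ := form i (by omega)
    obtain ⟨d, hd⟩ := form j h2
    rw [hc, hd, smul_mul_smul_comm, smul_mul_smul_comm, B.comm i j h1 h2, mul_comm c]
  · rw [T_mid_eq p k h1 (by omega), T_mid_eq p k (i := i + 1) (by omega) (by omega),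
      B.braid i h1 h2]
  · rw [T_mid_eq p k (i := 1) le_rfl (by omega), T_zero_eq]
    simp only [smul_mul_assoc, mul_smul_comm, B.left h]
  · rw [T_mid_eq p k (i := k - 1) (by omega) (by omega), T_last_eq p k hk]
    simp only [smul_mul_assoc, mul_smul_comm, B.right h]

theorem TC_eq : TC p k = toH p k (br k (wC k)) := by
  have h1 : toH p k (br k (wC k)) =
      ((toH p k).comp (PresentedGroup.mk {w | ∃ u v, BraidRel k u v ∧ w = u * v⁻¹})) (wC k) := rfl
  rw [h1, TC, wC, map_list_prod, List.map_map]
  congr 1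
  refine List.map_congr_left fun j hj => ?_
  rw [List.mem_range] at hj
  rw [T_mid_eq p k (by omega) (by omega)]
  rfl

theorem TC_conj_eq_pole : (TC p k)⁻¹ * T p k k * TC p k = pole k (T p k) 1 := by
  rw [TC, pole]
  suffices h : ∀ n, ((List.range n).map fun j => T p k (k - 1 - j)).prod⁻¹ * T p k k *
      ((List.range n).map fun j => T p k (k - 1 - j)).prod = poleAux k (T p k) n from h _
  intro n
  induction n with
  | zero => simp [poleAux]
  | succ n ih =>
    rw [poleAux, ← ih, List.range_succ, List.map_append, List.prod_append]
    simp only [List.map_cons, List.map_nil, List.prod_cons, List.prod_nil, mul_one, mul_inv_rev,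
      mul_assoc, show k - (n + 1) = k - 1 - n by omega]

theorem murphy_eq (j : ℕ) : murphy p k j = murphyOf k (T p k) j := by
  induction j with
  | zero => rw [murphy, murphyOf, TC_conj_eq_pole]
  | succ j ih => rw [murphy, murphyOf, ih]

theorem Z_eq : Z p k = murphySum k (T p k) := by
  simp only [Z, murphySum, murphy_eq]

theorem Tvee_eq : Tvee p k = pole k (T p k) 1 := by
  rw [Tvee, murphy_eq, murphyOf, mul_inv_cancel_right]

theorem pole_one_eq (hk : 1 ≤ k) :
    pole k (T p k) 1 = (p.ra₁ * p.ra₂)⁻¹ • toH p k (br k (wX k)) := by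
  rw [← TC_conj_eq_pole, T_last_eq p k hk, TC_eq, mul_smul_comm, smul_mul_assoc, gen,
    ← map_inv, ← map_mul, ← map_mul]
  rfl

theorem murphyOf_zero_eq (hk : 1 ≤ k) :
    murphyOf k (T p k) 0 =
      ((p.ra₁ * p.ra₂)⁻¹ * (p.rb₁ * p.rb₂)⁻¹) • toH p k (br k (wZ k)) := by
  rw [murphyOf, pole_one_eq p k hk, T_zero_eq, smul_mul_smul_comm, gen, ← map_mul]
  rfl

theorem mkAlgHom_ga (w : FreeGroup (Gen k)) :
    RingQuot.mkAlgHom ℂ (HeckeRel p k) (ga k w) = (toH p k (br k w) : Hext p k) := rfl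

/-- Division by ab turns the eigenvalues a² and -b² into a/b and -b/a. -/
theorem quad_of_factor {a b : ℂˣ} {A : Type} [Ring A] [Algebra ℂ A] {t : A}
    (h : (t - algebraMap ℂ A ((a : ℂ) ^ 2)) * (t - algebraMap ℂ A (-(b : ℂ) ^ 2)) = 0) :
    Quad ((a * b⁻¹ : ℂˣ) : ℂ) ((a * b)⁻¹ • t) := by
  have ha := a.ne_zero
  have hb := b.ne_zero
  simp only [Algebra.algebraMap_eq_smul_one, mul_sub, sub_mul, smul_mul_assoc, mul_smul_comm,
    one_mul, mul_one] at h
  have h1 : t * t = ((a : ℂ) ^ 2 - (b : ℂ) ^ 2) • t + ((a : ℂ) ^ 2 * (b : ℂ) ^ 2) • 1 := by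
    rw [← sub_eq_zero, ← h]; module
  simp only [Quad, Units.smul_def, smul_mul_assoc, mul_smul_comm, h1, Units.val_mul,
    Units.val_inv_eq_inv_val]
  match_scalars <;> (field_simp; try ring)

theorem quad_T_zero : Quad (p.rt₀ : ℂ) (T p k 0 : Hext p k) := by
  rw [T_zero_eq, Units.val_smul, Params.rt₀]
  refine quad_of_factor ?_
  have := RingQuot.mkAlgHom_rel ℂ (HeckeRel.Y (p := p) (k := k))
  simp only [map_mul, map_sub, AlgHom.commutes, map_zero, mkAlgHom_ga] at this
  exact this

theorem quad_pole_one (hk : 1 ≤ k) :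
    Quad (p.rtₖ : ℂ) ((pole k (T p k) 1 : (Hext p k)ˣ) : Hext p k) := by
  rw [pole_one_eq p k hk, Units.val_smul, Params.rtₖ]
  refine quad_of_factor ?_
  have := RingQuot.mkAlgHom_rel ℂ (HeckeRel.X (p := p) (k := k))
  simpa only [map_mul, map_sub, AlgHom.commutes, map_zero, mkAlgHom_ga] using this

theorem quad_T_mid {i : ℕ} (h1 : 1 ≤ i) (h2 : i < k) : Quad (p.rt : ℂ) (T p k i : Hext p k) := by
  have := RingQuot.mkAlgHom_rel ℂ (HeckeRel.T (p := p) (k := k) i h1 h2)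
  simp only [map_mul, map_sub, map_add, AlgHom.commutes, map_zero, mkAlgHom_ga] at this
  rw [T_mid_eq p k h1 h2, Quad, gen]
  generalize ((toH p k (br k (wT k i)) : (Hext p k)ˣ) : Hext p k) = t at *
  simp only [Algebra.algebraMap_eq_smul_one, mul_add, sub_mul, smul_mul_assoc, mul_smul_comm,
    one_mul, mul_one, Units.val_inv_eq_inv_val, smul_sub, smul_smul,
    inv_mul_cancel₀ p.rt.ne_zero, one_smul] at this
  rw [← sub_eq_zero, ← this]; module

/-- The relation is imposed on X_1, of which T_k is a rescaled conjugate. -/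
theorem quad_T_last (hk : 1 ≤ k) : Quad (p.rtₖ : ℂ) (T p k k : Hext p k) := by
  have h1 : T p k k = TC p k * pole k (T p k) 1 * (TC p k)⁻¹ := by
    rw [← TC_conj_eq_pole]; group
  have h2 := quad_pole_one p k hk
  rw [h1, Quad]
  generalize pole k (T p k) 1 = x at *
  generalize TC p k = c at *
  have h3 : c * x * c⁻¹ * (c * x * c⁻¹) = c * (x * x) * c⁻¹ := by group
  rw [← Units.val_mul, h3]
  simp only [Units.val_mul]
  rw [show (x : Hext p k) * x = _ from h2, mul_add, add_mul, mul_one, Units.mul_inv,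
    mul_smul_comm, smul_mul_assoc]

/-! ### Centrality -/

/-- W_1 is a multiple of Z_1, which P fixes by definition, and the later Murphy elements involve in
addition only T_1, …, T_{k-1}. -/
theorem commute_P_murphyOf (hk : 1 ≤ k) {j : ℕ} (hj : j < k) :
    toH p k (br k (wP k)) * murphyOf k (T p k) j = murphyOf k (T p k) j * toH p k (br k (wP k)) := by
  have conj : ∀ u v : FreeGroup (Gen k), BraidRel k (wP k * u * (wP k)⁻¹) v → br k u = br k v →
      toH p k (br k (wP k)) * toH p k (br k u) = toH p k (br k u) * toH p k (br k (wP k)) := by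
    intro u v h h'
    have h1 := br_eq h
    rw [← h'] at h1
    have h2 : br k (wP k) * br k u * (br k (wP k))⁻¹ = br k u := h1
    rw [← map_mul, ← map_mul, mul_inv_eq_iff_eq_mul.mp h2]
  induction j with
  | zero =>
    rw [murphyOf_zero_eq p k hk, mul_smul_comm, smul_mul_assoc, conj _ _ BraidRel.twistZ rfl]
  | succ j ih =>
    have h1 := ih (by omega)
    have h2 : toH p k (br k (wP k)) * T p k (j + 1) = T p k (j + 1) * toH p k (br k (wP k)) := by
      rw [T_mid_eq p k (by omega) hj, gen]
      exact conj _ _ (BraidRel.twistT (j + 1) (by omega) (by omega)) rfl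
    rw [murphyOf]
    calc _ = toH p k (br k (wP k)) * T p k (j + 1) * murphyOf k (T p k) j * T p k (j + 1) := by
          simp only [mul_assoc]
      _ = T p k (j + 1) * (toH p k (br k (wP k)) * murphyOf k (T p k) j) * T p k (j + 1) := by
          rw [h2]; simp only [mul_assoc]
      _ = T p k (j + 1) * murphyOf k (T p k) j * (toH p k (br k (wP k)) * T p k (j + 1)) := by
          rw [h1]; simp only [mul_assoc]
      _ = _ := by rw [h2]; simp only [mul_assoc]

theorem commute_Z_P (hk : 1 ≤ k) : Commute (toH p k (br k (wP k)) : Hext p k) (Z p k) := by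
  rw [Z_eq, murphySum]
  refine Commute.sum_right _ _ _ fun j hj => ?_
  rw [Finset.mem_range] at hj
  exact commute_units_add_inv (commute_P_murphyOf p k hk hj)

theorem commute_of_smul {A : Type} [Ring A] [Algebra ℂ A] {c : ℂˣ} {u z : A}
    (h : Commute (c • u) z) : Commute u z := by
  have := h.smul_left c⁻¹
  rwa [inv_smul_smul] at this

theorem commute_Z_gen (hk : 1 ≤ k) {i : ℕ} (hi : i ≤ k) :
    Commute (gen p k i : Hext p k) (Z p k) := by
  obtain ⟨h1, h2⟩ := (braidC_T p k hk).commute_murphySum hk (q := (p.rt : ℂ) - (p.rt : ℂ)⁻¹)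
    (fun i h1 h2 => quad_T_mid p k h1 h2) (quad_T_zero p k) (quad_pole_one p k hk)
  rw [← Z_eq] at h1 h2
  rcases Nat.eq_zero_or_pos i with rfl | h3
  · have := h1 0 (by omega)
    rw [T_zero_eq, Units.val_smul] at this
    exact commute_of_smul this
  · rcases hi.lt_or_eq with h4 | rfl
    · have := h1 i h4
      rwa [T_mid_eq p k h3 h4] at this
    · have h5 : Commute (TC p i : Hext p i) (Z p i) := by
        rw [TC]
        refine List.prod_induction (fun u : (Hext p i)ˣ => Commute (u : Hext p i) (Z p i))
          (fun a b ha hb => ?_) ?_ ?_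
        · rw [Units.val_mul]; exact ha.mul_left hb
        · rw [Units.val_one]; exact Commute.one_left _
        · intro u hu
          obtain ⟨j, hj, rfl⟩ := List.mem_map.mp hu
          rw [List.mem_range] at hj
          exact h1 _ (by omega)
      have h6 : T p i i = TC p i * pole i (T p i) 1 * (TC p i)⁻¹ := by
        rw [← TC_conj_eq_pole]; group
      have h7 : Commute (T p i i : Hext p i) (Z p i) := by
        rw [h6, Units.val_mul, Units.val_mul]
        exact (h5.mul_left h2).mul_left h5.units_inv_left
      rw [T_last_eq p i hk, Units.val_smul] at h7
      exact commute_of_smul h7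

theorem Z_mem_center (hk : 1 ≤ k) : Z p k ∈ Subalgebra.center ℂ (Hext p k) := by
  rw [Subalgebra.mem_center_iff]
  intro b
  obtain ⟨a, rfl⟩ := RingQuot.mkAlgHom_surjective ℂ (HeckeRel p k) b
  have hg : ∀ w : FreeGroup (Gen k), Commute (toH p k (br k w) : Hext p k) (Z p k) := by
    intro w
    induction w using FreeGroup.induction_on with
    | C1 =>
      rw [show br k 1 = 1 from map_one _, map_one, Units.val_one]
      exact Commute.one_left _
    | of x =>
      rcases x with _ | i
      · exact commute_Z_P p k hk
      · have h1 := commute_Z_gen p k hk (i := i) (by omega)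
        rwa [gen, wT, Fin.ofNat_eq_cast, Fin.cast_val_eq_self] at h1
    | inv_of x h =>
      rw [show br k (FreeGroup.of x)⁻¹ = (br k (FreeGroup.of x))⁻¹ from map_inv _ _, map_inv]
      exact h.units_inv_left
    | mul u v hu hv =>
      rw [show br k (u * v) = br k u * br k v from map_mul _ _ _, map_mul, Units.val_mul]
      exact hu.mul_left hv
  induction a using MonoidAlgebra.induction_on with
  | of g =>
    obtain ⟨w, rfl⟩ := PresentedGroup.mk_surjective _ g
    exact hg w
  | add f g hf hg' => rw [map_add]; exact Commute.add_left hf hg'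
  | smul c f hf => rw [map_smul]; exact Commute.smul_left hf c

end Extended

/-! ### One-dimensional representations -/

section Characters

variable (p : Params) (k : ℕ)

/-- The values of a one-dimensional representation on the generators of the braid group. -/
def charGen (v₀ vₖ : ℂˣ) : Gen k → ℂˣ
  | none => 1
  | some i => if (i : ℕ) = 0 then p.rb₁ * p.rb₂ * v₀ else if (i : ℕ) = k then p.ra₁ * p.ra₂ * vₖ
      else -p.rt⁻¹

theorem lift_wT (v₀ vₖ : ℂˣ) {i : ℕ} (hi : i ≤ k) :
    FreeGroup.lift (charGen p k v₀ vₖ) (wT k i) = if i = 0 then p.rb₁ * p.rb₂ * v₀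
      else if i = k then p.ra₁ * p.ra₂ * vₖ else -p.rt⁻¹ := by
  have h : ((Fin.ofNat (k + 1) i : Fin (k + 1)) : ℕ) = i := by
    simp [Fin.ofNat, Nat.mod_eq_of_lt (show i < k + 1 by omega)]
  simp only [wT, FreeGroup.lift_apply_of, charGen, h]

theorem lift_wX (v₀ vₖ : ℂˣ) (hk : 1 ≤ k) :
    FreeGroup.lift (charGen p k v₀ vₖ) (wX k) = p.ra₁ * p.ra₂ * vₖ := by
  rw [wX, map_mul, map_mul, map_inv, mul_comm, mul_inv_cancel_left, lift_wT p k v₀ vₖ le_rfl,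
    if_neg (by omega), if_pos rfl]

/-- The one-dimensional representations of the braid group. -/
def braidChar (v₀ vₖ : ℂˣ) : BraidGroup k →* ℂˣ :=
  PresentedGroup.toGroup (f := charGen p k v₀ vₖ) <| by
    rintro _ ⟨u, v, h, rfl⟩
    rw [map_mul, map_inv, mul_inv_eq_one]
    cases h with
    | comm i j hij hj => rw [map_mul, map_mul, mul_comm]
    | braid i hi hik =>
      simp only [map_mul, lift_wT p k v₀ vₖ (show i ≤ k by omega),
        lift_wT p k v₀ vₖ (show i + 1 ≤ k by omega), if_neg (show i ≠ 0 by omega),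
        if_neg (show i ≠ k by omega), if_neg (show i + 1 ≠ 0 by omega),
        if_neg (show i + 1 ≠ k by omega)]
    | left hk => simp only [map_mul, mul_comm, mul_left_comm, mul_assoc]
    | right hk => simp only [map_mul, mul_comm, mul_left_comm, mul_assoc]
    | twistX => simp only [map_mul, map_inv, mul_inv_cancel_comm, inv_mul_cancel_comm]
    | twistY => simp only [map_mul, map_inv, mul_inv_cancel_comm, inv_mul_cancel_comm]
    | twistZ => simp only [map_mul, map_inv, mul_inv_cancel_comm]
    | twistT i hi hik => simp only [map_mul, map_inv, mul_inv_cancel_comm]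

theorem braidChar_br (v₀ vₖ : ℂˣ) (w : FreeGroup (Gen k)) :
    braidChar p k v₀ vₖ (br k w) = FreeGroup.lift (charGen p k v₀ vₖ) w := by
  induction w using FreeGroup.induction_on with
  | C1 => rw [map_one, show br k 1 = 1 from map_one _, map_one]
  | of x => rw [FreeGroup.lift_apply_of]; exact PresentedGroup.toGroup.of _
  | inv_of x h =>
    rw [show br k (FreeGroup.of x)⁻¹ = (br k (FreeGroup.of x))⁻¹ from map_inv _ _, map_inv, map_inv,
      h]
  | mul u v hu hv =>
    rw [show br k (u * v) = br k u * br k v from map_mul _ _ _, map_mul, map_mul, hu, hv]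

/-- In a commutative group the braid relations only ask that T_1, …, T_{k-1} have equal images, so
each generator may take any of its eigenvalues subject to this. The characters certify that the
explicit idempotents do not vanish. -/
theorem exists_character (hk : 1 ≤ k) {v₀ vₖ : ℂˣ} (h₀ : v₀ = p.rt₀ ∨ v₀ = -p.rt₀⁻¹)
    (hₖ : vₖ = p.rtₖ ∨ vₖ = -p.rtₖ⁻¹) :
    ∃ χ : Hext p k →ₐ[ℂ] ℂ, χ (T p k 0 : Hext p k) = v₀ ∧
      (∀ i, 1 ≤ i → i < k → χ (T p k i : Hext p k) = -(p.rt : ℂ)⁻¹) ∧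
      χ ((pole k (T p k) 1 : (Hext p k)ˣ) : Hext p k) = vₖ := by
  let φ : MonoidAlgebra ℂ (BraidGroup k) →ₐ[ℂ] ℂ :=
    MonoidAlgebra.lift ℂ ℂ (BraidGroup k) ((Units.coeHom ℂ).comp (braidChar p k v₀ vₖ))
  have hφ : ∀ w, φ (ga k w) = (FreeGroup.lift (charGen p k v₀ vₖ) w : ℂˣ) := fun w => by
    rw [← braidChar_br]
    simp [φ, ga]
  have hrel : ∀ ⦃a b⦄, HeckeRel p k a b → φ a = φ b := by
    have ha₁ := p.ra₁.ne_zero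
    have ha₂ := p.ra₂.ne_zero
    have hb₁ := p.rb₁.ne_zero
    have hb₂ := p.rb₂.ne_zero
    intro a b h
    cases h with
    | X =>
      simp only [map_mul, map_sub, AlgHom.commutes, hφ, lift_wX p k v₀ vₖ hk, map_zero]
      rcases hₖ with rfl | rfl <;>
      · simp [Params.rtₖ]
        field_simp
        simp
    | Y =>
      simp only [map_mul, map_sub, AlgHom.commutes, hφ, wY, lift_wT p k v₀ vₖ (Nat.zero_le k),
        map_zero, if_true]
      rcases h₀ with rfl | rfl <;>
      · simp [Params.rt₀]
        field_simp
        simp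
    | T i hi hik =>
      simp only [map_mul, map_sub, map_add, AlgHom.commutes, hφ, map_zero,
        lift_wT p k v₀ vₖ (show i ≤ k by omega), if_neg (show i ≠ 0 by omega),
        if_neg (show i ≠ k by omega)]
      simp
  let χ : Hext p k →ₐ[ℂ] ℂ := RingQuot.liftAlgHom ℂ ⟨φ, hrel⟩
  have hχ : ∀ w, χ (toH p k (br k w) : Hext p k) =
      (FreeGroup.lift (charGen p k v₀ vₖ) w : ℂˣ) := fun w => by
    rw [← hφ, ← mkAlgHom_ga]
    exact RingQuot.liftAlgHom_mkAlgHom_apply ..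
  refine ⟨χ, ?_, fun i h1 h2 => ?_, ?_⟩
  · rw [T_zero_eq, gen, Units.val_smul, Units.smul_def, map_smul, hχ, lift_wT p k v₀ vₖ (Nat.zero_le k),
      if_pos rfl, smul_eq_mul, ← Units.val_mul, inv_mul_cancel_left]
  · rw [T_mid_eq p k h1 h2, gen, hχ, lift_wT p k v₀ vₖ h2.le, if_neg (by omega), if_neg (by omega)]
    simp
  · rw [pole_one_eq p k hk, Units.val_smul, Units.smul_def, map_smul, hχ, lift_wX p k v₀ vₖ hk,
      smul_eq_mul, ← Units.val_mul, inv_mul_cancel_left]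

end Characters

/-! ### The quotients of the extended Hecke algebra -/

section Quotient

variable {A : Type} [Ring A] [Algebra ℂ A]

theorem dbl_eq (r : ℂˣ) : dbl r = (r : ℂ) + (r : ℂ)⁻¹ := by
  rw [dbl, Units.val_inv_eq_inv_val]

theorem dbl_mul_inv (r s : ℂˣ) : dbl (r * s⁻¹) = (r : ℂ) * (s : ℂ)⁻¹ + (r : ℂ)⁻¹ * s := by
  rw [dbl_eq, Units.val_mul, Units.val_inv_eq_inv_val, mul_inv, inv_inv]

theorem Quad.map {B : Type} [Ring B] [Algebra ℂ B] (f : A →ₐ[ℂ] B) {s : ℂ} {t : A}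
    (h : Quad s t) : Quad s (f t) := by
  rw [Quad, ← map_mul, show t * t = _ from h, map_add, map_one, map_smul]

theorem map_signB {B : Type} [Ring B] [Algebra ℂ B] (f : A →ₐ[ℂ] B) (u s : ℂ) (t₀ t₁ : A) :
    f (signB u s t₀ t₁) = signB u s (f t₀) (f t₁) := by
  simp only [signB, map_sub, map_mul, map_smul, map_one]

variable (p : Params) (k : ℕ)

theorem ae_zero : ae p k 0 = T p k 0 - (p.rt₀ : ℂ) • 1 := by
  rw [ae, if_pos rfl, Algebra.algebraMap_eq_smul_one]

theorem ae_mid {i : ℕ} (h1 : 1 ≤ i) (h2 : i < k) : ae p k i = T p k i - (p.rt : ℂ) • 1 := by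
  rw [ae, if_neg (by omega), if_neg (by omega), Algebra.algebraMap_eq_smul_one]

theorem ae_last (hk : 1 ≤ k) : ae p k k = T p k k - (p.rtₖ : ℂ) • 1 := by
  rw [ae, if_neg (by omega), if_pos rfl, Algebra.algebraMap_eq_smul_one]

theorem e_zero : e p k 0 = (p.a₀ : ℂ)⁻¹ • ae p k 0 := by
  rw [e, if_pos rfl, Units.smul_def, Units.val_inv_eq_inv_val]

theorem e_mid {i : ℕ} (h1 : 1 ≤ i) (h2 : i < k) : e p k i = (p.a : ℂ)⁻¹ • ae p k i := by
  rw [e, if_neg (by omega), if_neg (by omega), Units.smul_def, Units.val_inv_eq_inv_val]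

theorem e_last (hk : 1 ≤ k) : e p k k = (p.aₖ : ℂ)⁻¹ • ae p k k := by
  rw [e, if_neg (by omega), if_pos rfl, Units.smul_def, Units.val_inv_eq_inv_val]

/-- The images of the `T_i` under a homomorphism. -/
def imT {p : Params} {k : ℕ} (f : Hext p k →ₐ[ℂ] A) (i : ℕ) : Aˣ :=
  Units.map (f : Hext p k →* A) (T p k i)

theorem braidC_imT {p : Params} {k : ℕ} (hk : 1 ≤ k) (f : Hext p k →ₐ[ℂ] A) :
    BraidC k (imT f) :=
  (braidC_T p k hk).map (Units.map (f : Hext p k →* A))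

theorem map_Z {p : Params} {k : ℕ} (f : Hext p k →ₐ[ℂ] A) : f (Z p k) = murphySum k (imT f) := by
  rw [Z_eq, murphySum, murphySum, map_sum]
  refine Finset.sum_congr rfl fun j _ => ?_
  have h := map_murphyOf k (T p k) (Units.map (f : Hext p k →* A)) j
  change _ = ((murphyOf k (fun i => Units.map (f : Hext p k →* A) (T p k i)) j : Aˣ) : A) +
    (((murphyOf k (fun i => Units.map (f : Hext p k →* A) (T p k i)) j)⁻¹ : Aˣ) : A)
  rw [← h, map_add, ← map_inv]
  rfl

theorem tlData_of_hom {p : Params} {k : ℕ} (hk : 1 ≤ k) (f : Hext p k →ₐ[ℂ] A)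
    (up : ∀ i, 1 ≤ i → i + 2 ≤ k →
      f (ae p k i) * (f (ae p k (i + 1)) * f (ae p k i)) = f (ae p k i))
    (down : ∀ i, 1 ≤ i → i + 2 ≤ k →
      f (ae p k (i + 1)) * (f (ae p k i) * f (ae p k (i + 1))) = f (ae p k (i + 1)))
    (left : 2 ≤ k → f (ae p k 1) * (f (ae p k 0) * f (ae p k 1)) =
      dbl (p.rt₀ * p.rt⁻¹) • f (ae p k 1))
    (right : 2 ≤ k → f (ae p k (k - 1)) * (f (ae p k k) * f (ae p k (k - 1))) =
      dbl (p.rtₖ * p.rt⁻¹) • f (ae p k (k - 1))) :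
    TLData k (p.rt : ℂ) p.rt₀ p.rtₖ (imT f) (fun i => f (ae p k i)) :=
  TLData.of_hecke (braidC_imT hk f) hk p.rt.ne_zero p.rt₀.ne_zero p.rtₖ.ne_zero
    ((quad_T_zero p k).map f) (fun _ h1 h2 => (quad_T_mid p k h1 h2).map f)
    ((quad_T_last p k hk).map f)
    (by rw [ae_zero, map_sub, map_smul, map_one]; rfl)
    (fun i h1 h2 => by rw [ae_mid p k h1 h2, map_sub, map_smul, map_one]; rfl)
    (by rw [ae_last p k hk, map_sub, map_smul, map_one]; rfl)
    up down (fun h => by rw [left h, dbl_mul_inv]) (fun h => by rw [right h, dbl_mul_inv])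

theorem mul_mul_of_scaled {a b d w : ℂ} {u v : A}
    (h : d • (a • u * b • v * a • u) - w • a • u = 0) (h1 : d * (a * b * a) = 1) :
    u * (v * u) = (w * a) • u := by
  have h2 : a • u * b • v * a • u = (a * b * a) • (u * (v * u)) := by
    simp only [smul_mul_assoc, mul_smul_comm, smul_smul, mul_assoc]
  rw [h2, smul_smul, h1, one_smul, smul_smul, sub_eq_zero] at h
  exact h

theorem tlData_tlRel (hk : 1 ≤ k) :
    TLData k (p.rt : ℂ) p.rt₀ p.rtₖ (imT (quo p k (TLRel p k)))
      (fun i => quo p k (TLRel p k) (ae p k i)) := by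
  have ha := p.a.ne_zero
  have ha₀ := p.a₀.ne_zero
  have haₖ := p.aₖ.ne_zero
  refine tlData_of_hom hk _ (fun i h1 h2 => ?_) (fun i h1 h2 => ?_) (fun h => ?_) (fun h => ?_)
  · have h := RingQuot.mkAlgHom_rel ℂ (TLRel.up (p := p) (k := k) i h1 h2)
    rw [e_mid p k h1 (by omega), e_mid p k (i := i + 1) (by omega) (by omega)] at h
    simp only [map_sub, map_zero, Units.smul_def, map_smul, map_mul, Units.val_pow_eq_pow_val] at h
    refine (mul_mul_of_scaled h (by field_simp)).trans ?_
    rw [mul_inv_cancel₀ ha]; exact one_smul _ _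
  · have h := RingQuot.mkAlgHom_rel ℂ (TLRel.down (p := p) (k := k) i h1 h2)
    rw [e_mid p k h1 (by omega), e_mid p k (i := i + 1) (by omega) (by omega)] at h
    simp only [map_sub, map_zero, Units.smul_def, map_smul, map_mul, Units.val_pow_eq_pow_val] at h
    refine (mul_mul_of_scaled h (by field_simp)).trans ?_
    rw [mul_inv_cancel₀ ha]; exact one_smul _ _
  · have h := RingQuot.mkAlgHom_rel ℂ (TLRel.left (p := p) (k := k) h)
    rw [e_mid p k le_rfl (by omega), e_zero] at h
    simp only [map_sub, map_zero, Units.smul_def, map_smul, map_mul, Units.val_pow_eq_pow_val,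
      Units.val_mul] at h
    refine (mul_mul_of_scaled h (by field_simp)).trans ?_
    rw [mul_right_comm, mul_inv_cancel₀ ha, one_mul]
  · have h := RingQuot.mkAlgHom_rel ℂ (TLRel.right (p := p) (k := k) h)
    rw [e_mid p k (i := k - 1) (by omega) (by omega), e_last p k hk] at h
    simp only [map_sub, map_zero, Units.smul_def, map_smul, map_mul, Units.val_pow_eq_pow_val,
      Units.val_mul] at h
    refine (mul_mul_of_scaled h (by field_simp)).trans ?_
    rw [mul_right_comm, mul_inv_cancel₀ ha, one_mul]

/-- The explicit idempotents are built from `signB` at u and at -u⁻¹; `h3` makes the first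
normalizable and `h4` the second. -/
theorem boundary_of_isEigenIdem {H : Type} [Ring H] [Algebra ℂ H] (f : H →ₐ[ℂ] A) {u s : ℂˣ}
    {t₀ t₁ : H} (q0 : Quad (u : ℂ) t₀) (q1 : Quad (s : ℂ) t₁)
    (h : t₀ * t₁ * t₀ * t₁ = t₁ * t₀ * t₁ * t₀)
    (h1 : dbl u ≠ 0) (h2 : dbl s ≠ 0) (h3 : dbl (u * s) ≠ 0) (h4 : dbl (u * s⁻¹) ≠ 0)
    (χ : H →ₐ[ℂ] ℂ) (χ0 : χ t₀ = -(u : ℂ)⁻¹) (χ1 : χ t₁ = -(s : ℂ)⁻¹)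
    (ψ : H →ₐ[ℂ] ℂ) (ψ0 : ψ t₀ = u) (ψ1 : ψ t₁ = -(s : ℂ)⁻¹)
    (hf : ∀ q q', IsEigenIdem t₀ t₁ (-((u⁻¹ : ℂˣ) : ℂ)) (-((s⁻¹ : ℂˣ) : ℂ)) q →
      IsEigenIdem t₀ t₁ (u : ℂ) (-((s⁻¹ : ℂˣ) : ℂ)) q' → f q = f q') :
    f (t₁ - (s : ℂ) • 1) * (f (t₀ - (u : ℂ) • 1) * f (t₁ - (s : ℂ) • 1)) =
      dbl (u * s⁻¹) • f (t₁ - (s : ℂ) • 1) := by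
  have hu := u.ne_zero
  have hs := s.ne_zero
  have hs' := hs
  rw [dbl_mul_inv] at h4 ⊢
  rw [dbl_eq, Units.val_mul] at h3
  rw [dbl_eq] at h1 h2
  have h1' : -(u : ℂ)⁻¹ + (-(u : ℂ)⁻¹)⁻¹ ≠ 0 := by
    rw [inv_neg, inv_inv, ← neg_add, add_comm]; exact neg_ne_zero.mpr h1
  have h3' : -(u : ℂ)⁻¹ * s + (-(u : ℂ)⁻¹ * s)⁻¹ ≠ 0 := by
    rw [mul_inv, inv_neg, inv_inv, neg_mul, neg_mul, ← neg_add, add_comm]; exact neg_ne_zero.mpr h4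
  have hu' : -(u : ℂ)⁻¹ ≠ 0 := neg_ne_zero.mpr (inv_ne_zero hu)
  have i1 := isEigenIdem_signB hu hs q0 q1 h h1 h2 h3 χ χ0 χ1
  have i2 := isEigenIdem_signB hu' hs q0.neg_inv q1 h h1' h2 h3' ψ
    (by rw [ψ0, inv_neg, inv_inv, neg_neg]) ψ1
  rw [inv_neg, inv_inv, neg_neg] at i2
  have h5 := hf _ _ (by rw [Units.val_inv_eq_inv_val, Units.val_inv_eq_inv_val]; exact i1)
    (by rw [Units.val_inv_eq_inv_val]; exact i2)
  rw [map_smul, map_smul, map_signB, map_signB] at h5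
  have h6 := boundary_of_signB_eq hu hs h1
    (inv_ne_zero (mul_ne_zero (mul_ne_zero h1 h2) h3))
    (inv_ne_zero (mul_ne_zero (mul_ne_zero (by rwa [inv_neg, inv_inv] at h1') h2)
      (by exact h3'))) (q0.map f) (q1.map f) h5
  simpa only [map_sub, map_smul, map_one] using h6

theorem tlData_idemRel (hk : 1 ≤ k) (hp : IdemExist p k) :
    TLData k (p.rt : ℂ) p.rt₀ p.rtₖ (imT (quo p k (IdemRel p k)))
      (fun i => quo p k (IdemRel p k) (ae p k i)) := by
  obtain ⟨hp2, hp3⟩ := hp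
  have B := braidC_T p k hk
  obtain ⟨χ, χ0, χ1, χk⟩ := exists_character p k hk (Or.inr rfl) (Or.inr rfl)
  obtain ⟨ψ, ψ0, ψ1, ψk⟩ := exists_character p k hk (Or.inl rfl) (Or.inl rfl)
  rw [Units.val_neg, Units.val_inv_eq_inv_val] at χ0 χk
  -- The vanishing of `signA`, read in its two symmetric forms, gives both bulk relations.
  have bulk : ∀ i, 1 ≤ i → i + 2 ≤ k →
      signA (p.rt : ℂ) (T p k i : Hext p k) (T p k (i + 1)) =
        signA (p.rt : ℂ) (T p k (i + 1) : Hext p k) (T p k i) ∧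
      quo p k (IdemRel p k) (signA (p.rt : ℂ) (T p k i : Hext p k) (T p k (i + 1))) = 0 := by
    intro i h1 h2
    obtain ⟨ht, -⟩ := hp2 (by omega)
    have h3 := hp3 (by omega)
    rw [Units.val_inv_eq_inv_val] at h3
    rw [dbl_eq] at ht
    have hb : (T p k i : Hext p k) * T p k (i + 1) * T p k i =
        T p k (i + 1) * T p k i * T p k (i + 1) := by
      have := congrArg (Units.val) (B.braid i h1 h2)
      simpa only [Units.val_mul] using this
    have q1 := quad_T_mid p k h1 (show i < k by omega)
    have q2 := quad_T_mid p k (show 1 ≤ i + 1 by omega) (show i + 1 < k by omega)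
    refine ⟨signA_eq p.rt.ne_zero q1 q2 hb, ?_⟩
    have id := isEigenIdem_signA p.rt.ne_zero q1 q2 hb ht h3 χ (χ1 i h1 (by omega))
      (χ1 (i + 1) (by omega) (by omega))
    have hz := RingQuot.mkAlgHom_rel ℂ (IdemRel.bulk (p := p) (k := k) i h1 h2 _
      (by rw [Units.val_inv_eq_inv_val]; exact id))
    rw [map_zero, map_smul] at hz
    exact (smul_eq_zero.mp hz).resolve_left
      (inv_ne_zero (neg_ne_zero.mpr (mul_ne_zero ht h3)))
  refine tlData_of_hom hk _ (fun i h1 h2 => ?_) (fun i h1 h2 => ?_) (fun h => ?_) (fun h => ?_)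
  · have := (bulk i h1 h2).2
    rw [signA, map_sub, sub_eq_zero, map_mul, map_mul] at this
    rwa [ae_mid p k h1 (by omega), ae_mid p k (i := i + 1) (by omega) (by omega)]
  · have := (bulk i h1 h2).2
    rw [(bulk i h1 h2).1, signA, map_sub, sub_eq_zero, map_mul, map_mul] at this
    rwa [ae_mid p k h1 (by omega), ae_mid p k (i := i + 1) (by omega) (by omega)]
  · obtain ⟨ht, h0, h0t, h0t', -⟩ := hp2 h
    rw [ae_mid p k le_rfl (by omega), ae_zero]
    refine boundary_of_isEigenIdem _ (quad_T_zero p k) (quad_T_mid p k le_rfl (by omega)) ?_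
      h0 ht h0t h0t' χ χ0 (χ1 1 le_rfl (by omega)) ψ ψ0 (ψ1 1 le_rfl (by omega))
      fun q q' hq hq' => RingQuot.mkAlgHom_rel ℂ (IdemRel.left h q q' hq hq')
    have := congrArg (Units.val) (B.left h)
    simpa only [Units.val_mul] using this
  · obtain ⟨ht, -, -, -, h0, h0t, h0t'⟩ := hp2 h
    have h5 := boundary_of_isEigenIdem (A := RingQuot (IdemRel p k)) (quo p k (IdemRel p k))
      (quad_pole_one p k hk)
      (quad_T_mid p k le_rfl (by omega)) (by
        have := congrArg (Units.val) (B.pole_four_one h)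
        simpa only [Units.val_mul] using this)
      h0 ht h0t h0t' χ χk (χ1 1 le_rfl (by omega)) ψ ψk (ψ1 1 le_rfl (by omega))
      fun q q' hq hq' => RingQuot.mkAlgHom_rel ℂ (IdemRel.right h q q'
        (by rw [Tvee_eq]; exact hq) (by rw [Tvee_eq]; exact hq'))
    -- The idempotent relation concerns T_{0^∨}, the pole at 1, together with T_1; it has to be
    -- carried to T_k and T_{k-1}.
    have h6 := (braidC_imT (A := RingQuot (IdemRel p k)) hk (quo p k (IdemRel p k))).pole_relation h p.rt.ne_zero
      ((quad_T_mid p k le_rfl (by omega)).map _) (y := p.rtₖ) (c := dbl (p.rtₖ * p.rt⁻¹)) (by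
        have h7 := map_pole k (T p k) (Units.map
          ((quo p k (IdemRel p k) : Hext p k →ₐ[ℂ] RingQuot (IdemRel p k)) :
            Hext p k →* RingQuot (IdemRel p k))) 1
        change _ = pole k (imT (A := RingQuot (IdemRel p k)) (quo p k (IdemRel p k))) 1 at h7
        rw [← h7]
        simp only [map_sub, map_smul, map_one] at h5
        exact h5)
    rw [ae_mid p k (i := k - 1) (by omega) (by omega), ae_last p k hk]
    simp only [map_sub, map_smul, map_one]
    exact h6

end Quotient

/-! ### The alternating products in a quotient of the extended Hecke algebra -/

section Products

variable {A : Type} [Ring A] [Algebra ℂ A] {p : Params} {k : ℕ} (f : Hext p k →ₐ[ℂ] A)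

theorem map_range_prod (a n : ℕ) :
    f ((List.range n).map fun j => ae p k (2 * j + a)).prod = row (fun i => f (ae p k i)) a n := by
  rw [row, map_list_prod, List.map_map]
  congr 1
  refine List.map_congr_left fun j _ => ?_
  rw [Function.comp_apply, add_comm]

theorem map_I₁_even {n : ℕ} (hk : k = 2 * n) :
    f (I₁ p k) = row (fun i => f (ae p k i)) 1 n := by
  rw [I₁, if_pos ⟨n, by omega⟩, map_range_prod, show k / 2 = n by omega]

theorem map_I₁_odd {n : ℕ} (hk : k = 2 * n + 1) :
    f (I₁ p k) = (p.aₖ : ℂ)⁻¹ • row (fun i => f (ae p k i)) 1 (n + 1) := by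
  rw [I₁, if_neg (by rw [Nat.not_even_iff_odd]; exact ⟨n, hk⟩), map_mul, map_range_prod,
    e_last p k (by omega), map_smul, show (k - 1) / 2 = n by omega, row_succ, mul_smul_comm,
    show 1 + 2 * n = k by omega]

theorem map_I₂_even {n : ℕ} (hn : 1 ≤ n) (hk : k = 2 * n) :
    f (I₂ p k) = ((p.a₀ : ℂ)⁻¹ * (p.aₖ : ℂ)⁻¹) • row (fun i => f (ae p k i)) 0 (n + 1) := by
  obtain ⟨m, rfl⟩ : ∃ m, n = m + 1 := ⟨n - 1, by omega⟩
  rw [I₂, if_pos ⟨m + 1, by omega⟩, map_mul, map_mul, map_range_prod, e_zero,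
    e_last p k (by omega), map_smul, map_smul, show (k - 2) / 2 = m by omega, row_succ', row_succ,
    show 0 + 2 + 2 * m = k by omega, zero_add, mul_assoc, smul_mul_assoc, mul_smul_comm,
    mul_smul_comm, smul_smul]

theorem map_I₂_odd {n : ℕ} (hk : k = 2 * n + 1) :
    f (I₂ p k) = (p.a₀ : ℂ)⁻¹ • row (fun i => f (ae p k i)) 0 (n + 1) := by
  rw [I₂, if_neg (by rw [Nat.not_even_iff_odd]; exact ⟨n, hk⟩), map_mul, map_range_prod,
    e_zero, map_smul, show (k - 1) / 2 = n by omega, row_succ', smul_mul_assoc]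

/-! ### Membership in the subalgebra generated by the `e_i` -/

theorem map_ae_mem {i : ℕ} (hi : i ≤ k) :
    f (ae p k i) ∈ Algebra.adjoin ℂ {x | ∃ i ≤ k, x = f (ae p k i)} :=
  Algebra.subset_adjoin ⟨i, hi, rfl⟩

theorem row_mem {S : Subalgebra ℂ A} {E : ℕ → A} (h : ∀ i ≤ k, E i ∈ S) {a n : ℕ}
    (han : a + 2 * n ≤ k + 2) : row E a n ∈ S := by
  induction n with
  | zero => rw [row_zero]; exact S.one_mem
  | succ n ih => rw [row_succ]; exact S.mul_mem (ih (by omega)) (h _ (by omega))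

/-- The units of an algebra that belong to a subalgebra together with their inverses. -/
def unitsIn (S : Subalgebra ℂ A) : Subgroup Aˣ where
  carrier := {u | (u : A) ∈ S ∧ ((u⁻¹ : Aˣ) : A) ∈ S}
  mul_mem' := fun ha hb => ⟨S.mul_mem ha.1 hb.1, by rw [mul_inv_rev]; exact S.mul_mem hb.2 ha.2⟩
  one_mem' := ⟨S.one_mem, by rw [inv_one]; exact S.one_mem⟩
  inv_mem' := fun ha => ⟨ha.2, by rw [inv_inv]; exact ha.1⟩

theorem murphyOf_mem {G : Type*} [Group G] {S : Subgroup G} {k : ℕ} {T : ℕ → G} (hk : 1 ≤ k)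
    (h : ∀ i ≤ k, T i ∈ S) {j : ℕ} (hj : j < k) : murphyOf k T j ∈ S := by
  induction j with
  | zero =>
    refine S.mul_mem ?_ (h 0 (by omega))
    rw [pole]
    suffices H : ∀ n, poleAux k T n ∈ S from H _
    intro n
    induction n with
    | zero => exact h k le_rfl
    | succ n ih =>
      exact S.mul_mem (S.mul_mem (S.inv_mem (h _ (by omega))) ih) (h _ (by omega))
  | succ j ih => exact S.mul_mem (S.mul_mem (h _ (by omega)) (ih (by omega))) (h _ (by omega))

theorem TLData.murphySum_mem {s x y : ℂ} {T : ℕ → Aˣ} {E : ℕ → A} (D : TLData k s x y T E)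
    (hk : 1 ≤ k) {S : Subalgebra ℂ A} (h : ∀ i ≤ k, E i ∈ S) : murphySum k T ∈ S := by
  have hc : ∀ c : ℂ, c • (1 : A) ∈ S := fun c => S.smul_mem S.one_mem c
  -- Inverses stay in the subalgebra because each T_i⁻¹ is also `E i` plus a scalar.
  have hT : ∀ i ≤ k, T i ∈ unitsIn S := fun i hi => by
    rcases Nat.eq_zero_or_pos i with rfl | h1
    · exact ⟨by rw [D.T_zero]; exact S.add_mem (h 0 hi) (hc _),
        by rw [D.T_zero_inv]; exact S.add_mem (h 0 hi) (hc _)⟩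
    · rcases hi.lt_or_eq with h2 | rfl
      · exact ⟨by rw [D.T_mid i h1 h2]; exact S.add_mem (h i hi) (hc _),
          by rw [D.T_mid_inv i h1 h2]; exact S.add_mem (h i hi) (hc _)⟩
      · exact ⟨by rw [D.T_last]; exact S.add_mem (h i hi) (hc _),
          by rw [D.T_last_inv]; exact S.add_mem (h i hi) (hc _)⟩
  rw [murphySum]
  refine S.sum_mem fun j hj => ?_
  have := murphyOf_mem hk hT (Finset.mem_range.mp hj)
  exact S.add_mem this.1 this.2

/-! ### The main identities -/

theorem map_Z_mem_center (hk : 1 ≤ k) (hf : Function.Surjective f) :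
    f (Z p k) ∈ Subalgebra.center ℂ A := by
  rw [Subalgebra.mem_center_iff]
  intro b
  obtain ⟨a, rfl⟩ := hf b
  rw [← map_mul, ← map_mul, Subalgebra.mem_center_iff.mp (Z_mem_center p k hk) a]

theorem main_identities (hk : 1 ≤ k) (hq : qInt p k ≠ 0) (hf : Function.Surjective f)
    (D : TLData k (p.rt : ℂ) p.rt₀ p.rtₖ (imT f) (fun i => f (ae p k i))) :
    (f (Z p k) ∈ Algebra.adjoin ℂ {x | ∃ i ≤ k, x = f (ae p k i)} ∧
      f (I₁ p k) ∈ Algebra.adjoin ℂ {x | ∃ i ≤ k, x = f (ae p k i)} ∧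
      f (I₂ p k) ∈ Algebra.adjoin ℂ {x | ∃ i ≤ k, x = f (ae p k i)}) ∧
    f (Z p k) ∈ Subalgebra.center ℂ A ∧
    (Even k →
      ((p.a₀ : ℂ) * (p.aₖ : ℂ)) • (f (I₁ p k) * f (I₂ p k) * f (I₁ p k)) =
        ((1 / qInt p k) • f (Z p k) - algebraMap ℂ A (dbl (p.rt₀ * p.rtₖ * p.rt⁻¹))) *
          f (I₁ p k) ∧
      ((p.a₀ : ℂ) * (p.aₖ : ℂ)) • (f (I₂ p k) * f (I₁ p k) * f (I₂ p k)) =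
        ((1 / qInt p k) • f (Z p k) - algebraMap ℂ A (dbl (p.rt₀ * p.rtₖ * p.rt⁻¹))) *
          f (I₂ p k)) ∧
    (Odd k →
      ((p.a₀ : ℂ) * (p.aₖ : ℂ)) • (f (I₁ p k) * f (I₂ p k) * f (I₁ p k)) =
        ((1 / qInt p k) • f (Z p k) + algebraMap ℂ A (dbl (p.rt₀ * p.rtₖ⁻¹))) * f (I₁ p k) ∧
      ((p.a₀ : ℂ) * (p.aₖ : ℂ)) • (f (I₂ p k) * f (I₁ p k) * f (I₂ p k)) =
        ((1 / qInt p k) • f (Z p k) + algebraMap ℂ A (dbl (p.rt₀ * p.rtₖ⁻¹))) * f (I₂ p k)) ∧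
    (∃ c ∈ Algebra.adjoin ℂ {x | ∃ i ≤ k, x = f (ae p k i)}, c ∈ Subalgebra.center ℂ A ∧
      f (I₁ p k) * f (I₂ p k) * f (I₁ p k) = c * f (I₁ p k) ∧
      f (I₂ p k) * f (I₁ p k) * f (I₂ p k) = c * f (I₂ p k)) := by
  have h₀ := p.a₀.ne_zero
  have hₖ := p.aₖ.ne_zero
  have B := braidC_imT hk f
  have hm : ∀ i ≤ k, f (ae p k i) ∈ Algebra.adjoin ℂ {x | ∃ i ≤ k, x = f (ae p k i)} :=
    fun i hi => map_ae_mem f hi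
  have hZ : f (Z p k) ∈ Algebra.adjoin ℂ {x | ∃ i ≤ k, x = f (ae p k i)} := by
    rw [map_Z]; exact D.murphySum_mem hk hm
  have hC := map_Z_mem_center f hk hf
  have hI : f (I₁ p k) ∈ Algebra.adjoin ℂ {x | ∃ i ≤ k, x = f (ae p k i)} ∧
      f (I₂ p k) ∈ Algebra.adjoin ℂ {x | ∃ i ≤ k, x = f (ae p k i)} := by
    rcases Nat.even_or_odd' k with ⟨n, hn | hn⟩
    · rw [map_I₁_even f hn, map_I₂_even f (by omega) hn]
      exact ⟨row_mem hm (by omega), Subalgebra.smul_mem _ (row_mem hm (by omega)) _⟩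
    · rw [map_I₁_odd f hn, map_I₂_odd f hn]
      exact ⟨Subalgebra.smul_mem _ (row_mem hm (by omega)) _,
        Subalgebra.smul_mem _ (row_mem hm (by omega)) _⟩
  have even : Even k →
      ((p.a₀ : ℂ) * (p.aₖ : ℂ)) • (f (I₁ p k) * f (I₂ p k) * f (I₁ p k)) =
        ((1 / qInt p k) • f (Z p k) - algebraMap ℂ A (dbl (p.rt₀ * p.rtₖ * p.rt⁻¹))) *
          f (I₁ p k) ∧
      ((p.a₀ : ℂ) * (p.aₖ : ℂ)) • (f (I₂ p k) * f (I₁ p k) * f (I₂ p k)) =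
        ((1 / qInt p k) • f (Z p k) - algebraMap ℂ A (dbl (p.rt₀ * p.rtₖ * p.rt⁻¹))) *
          f (I₂ p k) := by
    intro h
    obtain ⟨n, hn⟩ := h.exists_two_nsmul
    rw [smul_eq_mul] at hn
    have h1 := D.murphySum_mul_row_one_even B (by omega) hn
    have h2 := D.murphySum_mul_row_zero_even B (by omega) hn
    rw [← map_Z] at h1 h2
    rw [map_I₁_even f hn, map_I₂_even f (by omega) hn, dbl_mul_inv, Units.val_mul,
      Algebra.algebraMap_eq_smul_one]
    -- `qInt p k` is by definition `quantumInt` at t^{1/2}.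
    change _ = qInt p k • _ at h1
    change _ = qInt p k • _ at h2
    generalize row (fun i => f (ae p k i)) 1 n = R₁ at *
    generalize row (fun i => f (ae p k i)) 0 (n + 1) = R₀ at *
    constructor
    · simp only [sub_mul, smul_mul_assoc, mul_smul_comm, one_mul, h1, mul_assoc]
      match_scalars <;> (field_simp; try ring)
    · simp only [sub_mul, smul_mul_assoc, mul_smul_comm, one_mul, h2, mul_assoc]
      match_scalars <;> (field_simp; try ring)
  have odd : Odd k →
      ((p.a₀ : ℂ) * (p.aₖ : ℂ)) • (f (I₁ p k) * f (I₂ p k) * f (I₁ p k)) =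
        ((1 / qInt p k) • f (Z p k) + algebraMap ℂ A (dbl (p.rt₀ * p.rtₖ⁻¹))) * f (I₁ p k) ∧
      ((p.a₀ : ℂ) * (p.aₖ : ℂ)) • (f (I₂ p k) * f (I₁ p k) * f (I₂ p k)) =
        ((1 / qInt p k) • f (Z p k) + algebraMap ℂ A (dbl (p.rt₀ * p.rtₖ⁻¹))) *
          f (I₂ p k) := by
    rintro ⟨n, hn⟩
    have h1 := D.murphySum_mul_row_one_odd B hn
    have h2 := D.murphySum_mul_row_zero_odd B hn
    rw [← map_Z] at h1 h2
    rw [map_I₁_odd f hn, map_I₂_odd f hn, dbl_mul_inv, Algebra.algebraMap_eq_smul_one]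
    change _ = qInt p k • _ at h1
    change _ = qInt p k • _ at h2
    generalize row (fun i => f (ae p k i)) 1 (n + 1) = R₁ at *
    generalize row (fun i => f (ae p k i)) 0 (n + 1) = R₀ at *
    constructor
    · simp only [add_mul, smul_mul_assoc, mul_smul_comm, one_mul, h1, mul_assoc]
      match_scalars <;> (field_simp; try ring)
    · simp only [add_mul, smul_mul_assoc, mul_smul_comm, one_mul, h2, mul_assoc]
      match_scalars <;> (field_simp; try ring)
  -- The same c serves both products: it is (a_0 a_k)⁻¹ times the bracket of the identities.
  have cancel : ∀ {d u v : A}, ((p.a₀ : ℂ) * (p.aₖ : ℂ)) • u = d * v →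
      u = (((p.a₀ : ℂ) * (p.aₖ : ℂ))⁻¹ • d) * v := fun {d u v} h => by
    rw [smul_mul_assoc, ← h, inv_smul_smul₀ (mul_ne_zero h₀ hₖ)]
  refine ⟨⟨hZ, hI⟩, hC, even, odd, ?_⟩
  rcases Nat.even_or_odd k with h | h
  · exact ⟨_, Subalgebra.smul_mem _ (Subalgebra.sub_mem _ (Subalgebra.smul_mem _ hZ _)
      (Subalgebra.algebraMap_mem _ _)) _, Subalgebra.smul_mem _ (Subalgebra.sub_mem _
      (Subalgebra.smul_mem _ hC _) (Subalgebra.algebraMap_mem _ _)) _, cancel (even h).1,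
      cancel (even h).2⟩
  · exact ⟨_, Subalgebra.smul_mem _ (Subalgebra.add_mem _ (Subalgebra.smul_mem _ hZ _)
      (Subalgebra.algebraMap_mem _ _)) _, Subalgebra.smul_mem _ (Subalgebra.add_mem _
      (Subalgebra.smul_mem _ hC _) (Subalgebra.algebraMap_mem _ _)) _, cancel (odd h).1,
      cancel (odd h).2⟩

end Products

end TwoBoundary

end

/-- The relations `r` may be either of the two defining sets of relations of the extended
two boundary Temperley-Lieb algebra: the relations in the `e_i` (for all parameters), or the
relations between idempotents (whenever these idempotents exist). -/
theorem corollary3p3 (k : ℕ) (hk : 1 ≤ k) (p : Params) (hq : qInt p k ≠ 0)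
    (r : Hext p k → Hext p k → Prop)
    (hr : r = TLRel p k ∨ (IdemExist p k ∧ r = IdemRel p k)) :
    let π : Hext p k →ₐ[ℂ] RingQuot r := quo p k r
    let z := π (Z p k)
    let i₁ := π (I₁ p k)
    let i₂ := π (I₂ p k)
    (z ∈ TL p k r ∧ i₁ ∈ TL p k r ∧ i₂ ∈ TL p k r) ∧
    z ∈ Subalgebra.center ℂ (RingQuot r) ∧
    (Even k →
      ((p.a₀ : ℂ) * (p.aₖ : ℂ)) • (i₁ * i₂ * i₁) =
        ((1 / qInt p k) • z - algebraMap ℂ _ (dbl (p.rt₀ * p.rtₖ * p.rt⁻¹))) * i₁ ∧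
      ((p.a₀ : ℂ) * (p.aₖ : ℂ)) • (i₂ * i₁ * i₂) =
        ((1 / qInt p k) • z - algebraMap ℂ _ (dbl (p.rt₀ * p.rtₖ * p.rt⁻¹))) * i₂) ∧
    (Odd k →
      ((p.a₀ : ℂ) * (p.aₖ : ℂ)) • (i₁ * i₂ * i₁) =
        ((1 / qInt p k) • z + algebraMap ℂ _ (dbl (p.rt₀ * p.rtₖ⁻¹))) * i₁ ∧
      ((p.a₀ : ℂ) * (p.aₖ : ℂ)) • (i₂ * i₁ * i₂) =
        ((1 / qInt p k) • z + algebraMap ℂ _ (dbl (p.rt₀ * p.rtₖ⁻¹))) * i₂) ∧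
    (∃ c ∈ TL p k r, c ∈ Subalgebra.center ℂ (RingQuot r) ∧
      i₁ * i₂ * i₁ = c * i₁ ∧ i₂ * i₁ * i₂ = c * i₂) := by
  have hf : Function.Surjective (quo p k r) := RingQuot.mkAlgHom_surjective ℂ r
  have D : TLData (A := RingQuot r) k (p.rt : ℂ) p.rt₀ p.rtₖ (imT (A := RingQuot r) (quo p k r))
      (fun i => quo p k r (ae p k i)) := by
    rcases hr with rfl | ⟨hp, rfl⟩
    · exact tlData_tlRel p k hk
    · exact tlData_idemRel p k hk hp
  obtain ⟨⟨h1, h2, h3⟩, h4, h5, h6, c, h7, h8, h9, h10⟩ :=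
    main_identities (A := RingQuot r) (quo p k r) hk hq hf D
  exact ⟨⟨h1, h2, h3⟩, h4, fun h => ⟨(h5 h).1, (h5 h).2⟩, fun h => ⟨(h6 h).1, (h6 h).2⟩,
    c, h7, h8, h9, h10⟩
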